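/- **Setting.** Let $d\ge 1$, $H=L^2([0,1])$, and let $(X_{s})_{s\in\mathbb Z^d}$ be a field of random elements of $H$ (real-valued functions) with $E\|X_s\|^2<\infty$. Assume: * $(X_s)$ is Gaussian: for all $s_1,\dots,s_n\in\mathbb Z^d$ and $v_1,\dots,v_n\in H$ the vector $(\langle X_{s_i},v_i\rangle)_{i\le n}$ is (possibly degenerate) multivariate normal. * $(X_s)$ is weakly stationary with mean zero, with autocovariance operators $C_h$ (kernel $\mathrm{cov}(X_{s+h}(u),X_s(v))$) satisfying $\sum_{h\in\mathbb Z^d}\|C_h\|_{\mathrm{tr}}<\infty$, where $\|\cdot\|_{\mathrm{tr}}$ is the sum of the singular values. * For $\theta\in[-\pi,\pi]^d$ let $\mathcal F_\theta=(2\pi)^{-d}\sum_h C_h e^{-i h^\top\theta}$ be the spectral density operator on $L^2([0,1];\mathbb C)$, with ordered eigenvalues $\lambda_1(\theta)\ge\lambda_2(\theta)\ge\cdots$ (with multiplicity) and orthonormal eigenvectors $\varphi_1(\theta),\varphi_2(\theta),\dots$. For a fixed $p$ and every $1\le m\le p$, $\inf_\theta\min\{\lambda_m(\theta)-\lambda_{m+1}(\theta),\lambda_{m-1}(\theta)-\lambda_m(\theta)\}>0$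 (with $\lambda_0=\infty$), and the phases are chosen so that $\varphi_m$ is measurable in $\theta$ and $\varphi_m(-\theta)=\overline{\varphi_m(\theta)}$ for almost every $\theta$. * The sampling regions are $R_{\mathbf n}=\{s\in\mathbb Z^d:1\le s_i\le n_i\ \forall i\}$, $N=|R_{\mathbf n}|$, along a sequence with $\min_i n_i\to\infty$. * $\widehat{\mathcal F}_\theta$ are (random, self-adjoint) estimators of $\mathcal F_\theta$ with $\int_{[-\pi,\pi]^d}E\|\widehat{\mathcal F}_\theta-\mathcal F_\theta\|\,d\theta\to0$ (operator norm), and $\hat\varphi_1(\theta),\dots,\hat\varphi_p(\theta)$ are orthonormal eigenvectors of $\widehat{\mathcal F}_\theta$ for its $p$ largest eigenvalues, jointly measurable in the outcome and $\theta$, with phases chosen so that, almost surely and for almost every $\theta$, $\hat\varphi_m(-\theta)=\overline{\hat\varphi_m(\theta)}$ and $\langle\hat\varphi_m(\theta),\varphi_m(\theta)\rangle\ge0$. **Notation.** Put $\phi_{m,l}=(2\pi)^{-d}\int_{[-\pi,\pi]^d}\varphi_m(\theta)e^{-i l^\top\theta}d\theta$, and define $\hat\phi_{m,l}$ in the same way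 from $\hat\varphi_m$. Put $$Y_{m,s}=\sum_{l\in\mathbb Z^d}\langle X_{s-l},\phi_{m,l}\rangle\ \text{ (in mean square)},\qquad \widehat Y_{m,s}=\sum_{\|l\|_\infty\le L}\langle X_{s-l},\hat\phi_{m,l}\rangle,$$ $$\gamma_{m,h}=\mathrm{cov}(Y_{m,h},Y_{m,0}),\qquad \hat\gamma_{m,h}=\frac1N\sum_{s\in R_{\mathbf n},\,s+h\in R_{\mathbf n}}(\widehat Y_{m,s+h}-\bar Y_m)(\widehat Y_{m,s}-\bar Y_m),\qquad \bar Y_m=\frac1N\sum_{s\in R_{\mathbf n}}\widehat Y_{m,s},$$ $$G(N)=\int_{[-\pi,\pi]^d}\|\widehat{\mathcal F}_\theta-\mathcal F_\theta\|\,d\theta,\qquad H_m(L)=\Big(\sum_{\|l\|_\infty>L}\|\phi_{m,l}\|^2\Big)^{1/4}.$$ **Proposition.** Let $1\le m\le p$, and let $L,L'\to\infty$ be (deterministic) integer sequences such that $L^dG(N)\to0$ in probability, $L'=o(\min_i n_i)$ and $(L')^{d/3}H_m(L)\to0$. Then the series defining $Y_{m,s}$ converges in mean square, the series $\sigma^2_{S,m}=\sum_{h\in\mathbb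 Z^d}\gamma_{m,h}^3$ and $\sigma^2_{K,m}=\sum_{h\in\mathbb Z^d}\gamma_{m,h}^4$ converge absolutely, and $$\sum_{\|l\|_\infty\le L'}\hat\gamma_{m,l}^3\to\sigma^2_{S,m},\qquad \sum_{\|l\|_\infty\le L'}\hat\gamma_{m,l}^4\to\sigma^2_{K,m}\qquad\text{in probability.}$$ -/

import Mathlib

open MeasureTheory ProbabilityTheory Filter Topology
open scoped ENNReal NNReal

noncomputable section

namespace SFPC

/-- The Lebesgue measure on `[0,1]`. -/
abbrev unitMeasure : Measure ℝ := volume.restrict (Set.Icc (0 : ℝ) 1)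

/-- The real Hilbert space `H = L²([0,1])` in which the random functions live. -/
abbrev L2R : Type := Lp ℝ 2 unitMeasure

/-- The complex space `L²([0,1]; ℂ)`, on which spectral density operators act. Its `star` is
pointwise complex conjugation, and `inner ℂ x y` is conjugate-linear in `x`. -/
abbrev L2C : Type := Lp ℂ 2 unitMeasure

/-- The inclusion of `L²([0,1]; ℝ)` into `L²([0,1]; ℂ)`. -/
def toC : L2R →L[ℝ] L2C := Complex.ofRealCLM.compLpL 2 unitMeasure

/-- The frequency domain `[-π,π]^d`. -/
def cube (d : ℕ) : Set (Fin d → ℝ) := Set.Icc (fun _ => -Real.pi) (fun _ => Real.pi)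

/-- The Lebesgue measure on `[-π,π]^d`. -/
abbrev cubeMeasure (d : ℕ) : Measure (Fin d → ℝ) := volume.restrict (cube d)

/-- The character `e^{-i hᵀθ}`. -/
def character {d : ℕ} (h : Fin d → ℤ) (θ : Fin d → ℝ) : ℂ :=
  Complex.exp (-Complex.I * ((∑ i, (h i : ℝ) * θ i : ℝ) : ℂ))

/-! ### Random fields with values in `L²([0,1])` -/

section Field

variable {Ω : Type*} [MeasurableSpace Ω] {d : ℕ}

/-- The field `X` is Gaussian: all vectors of finitely many projections `⟨X_{s_i}, v_i⟩` are
(possibly degenerate) multivariate normal. -/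
def IsGaussianField (P : Measure Ω) (X : (Fin d → ℤ) → Ω → L2R) : Prop :=
  ∀ (n : ℕ) (s : Fin n → Fin d → ℤ) (v : Fin n → L2R),
    HasGaussianLaw (fun ω (i : Fin n) => inner ℝ (X (s i) ω) (v i)) P

/-- The cross-covariance operator of `U` and `V`, that is the integral operator with kernel
`(u,v) ↦ cov(U(u), V(v))`, equivalently `y ↦ E[⟨y, V - EV⟩ (U - EU)]`, acting on
`L²([0,1]; ℂ)`. -/
def covOp (P : Measure Ω) (U V : Ω → L2R) : L2C →L[ℂ] L2C :=
  ∫ ω, InnerProductSpace.rankOne ℂ (toC (U ω - ∫ ω', U ω' ∂P)) (toC (V ω - ∫ ω', V ω' ∂P)) ∂P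

/-- The autocovariance operator `C_h` at lag `h`, with kernel `cov(X_h(u), X_0(v))`. -/
def autocovOp (P : Measure Ω) (X : (Fin d → ℤ) → Ω → L2R) (h : Fin d → ℤ) : L2C →L[ℂ] L2C :=
  covOp P (X h) (X 0)

/-- Weak stationarity of a (square integrable) field. -/
structure IsWeaklyStationary (P : Measure Ω) (X : (Fin d → ℤ) → Ω → L2R) : Prop where
  mean_eq : ∀ s, ∫ ω, X s ω ∂P = ∫ ω, X 0 ω ∂P
  cov_eq : ∀ s h, covOp P (X (s + h)) (X s) = autocovOp P X h

/-- `A = ∑ₙ σₙ ⟨eₙ, ·⟩ fₙ` is a singular value decomposition of `A`. (The space is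
infinite-dimensional and separable, so every compact operator has one, with zeros among the `σₙ`
if necessary; the nonzero `σₙ` are the nonzero singular values of `A` with multiplicity.) -/
structure IsSVD (A : L2C →L[ℂ] L2C) (σ : ℕ → ℝ≥0) (e f : ℕ → L2C) : Prop where
  orthonormal_left : Orthonormal ℂ e
  orthonormal_right : Orthonormal ℂ f
  hasSum : ∀ x, HasSum (fun n => (((σ n : ℝ) : ℂ) * inner ℂ (e n) x) • f n) (A x)

/-- The trace norm: the sum of the singular values, and `∞` if there is no singular value
decomposition. All decompositions of `A` give the same sum. -/
def traceNorm (A : L2C →L[ℂ] L2C) : ℝ≥0∞ :=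
  ⨅ (σ : ℕ → ℝ≥0) (e : ℕ → L2C) (f : ℕ → L2C) (_ : IsSVD A σ e f), ∑' n, (σ n : ℝ≥0∞)

/-- The spectral density operator `(2π)^{-d} ∑_h e^{-i hᵀθ} C_h`. -/
def spectralDensity (P : Measure Ω) (X : (Fin d → ℤ) → Ω → L2R) (θ : Fin d → ℝ) :
    L2C →L[ℂ] L2C :=
  (((2 * Real.pi) ^ d : ℝ) : ℂ)⁻¹ • ∑' h : Fin d → ℤ, character h θ • autocovOp P X h

end Field

/-! ### Eigenvectors, filters and scores -/

/-- `lam 0 ≥ … ≥ lam (q-1)` are the `q` largest eigenvalues, with multiplicity, of the self-adjoint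
operator `A`, and `v 0, …, v (q-1)` are corresponding orthonormal eigenvectors; the last field says
that on the orthogonal complement of these eigenvectors there is no spectrum above `lam (q-1)`.
Indices start at `0`, and the values at `j ≥ q` are irrelevant. -/
structure IsLeadingEigensystem (A : L2C →L[ℂ] L2C) (q : ℕ) (lam : ℕ → ℝ) (v : ℕ → L2C) : Prop where
  selfAdjoint : IsSelfAdjoint A
  orthonormal : Orthonormal ℂ (fun j : Fin q => v j)
  eigen : ∀ j < q, A (v j) = (lam j : ℂ) • v j
  ordered : ∀ i j, i ≤ j → j < q → lam j ≤ lam i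
  leading : ∀ x : L2C, (∀ i < q, inner ℂ (v i) x = 0) →
    ∀ j < q, (inner ℂ x (A x)).re ≤ lam j * ‖x‖ ^ 2

section Scores

variable {Ω : Type*} [MeasurableSpace Ω] {d : ℕ}

/-- The filter coefficients `φ_l = (2π)^{-d} ∫_{[-π,π]^d} φ(θ) e^{-i lᵀθ} dθ`. -/
def filterCoeff (φ : (Fin d → ℝ) → L2C) (l : Fin d → ℤ) : L2C :=
  (((2 * Real.pi) ^ d : ℝ) : ℂ)⁻¹ • ∫ θ in cube d, character l θ • φ θ

/-- `x ↦ ⟨x, ψ⟩` for real-valued `x`. The filter functions `ψ` are real-valued when the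
eigenvectors satisfy `φ(-θ) = conj φ(θ)`; then taking the real part changes nothing. -/
def pairing (ψ : L2C) : L2R →L[ℝ] ℝ :=
  Complex.reCLM ∘L ((innerSL ℂ ψ).restrictScalars ℝ) ∘L toC

/-- The box `{l ∈ ℤ^d : ‖l‖_∞ ≤ K}`. -/
def box (d K : ℕ) : Finset (Fin d → ℤ) := Finset.Icc (fun _ => -(K : ℤ)) (fun _ => (K : ℤ))

/-- `H(L) = (∑_{‖l‖_∞ > L} ‖φ_l‖²)^{1/4}`. -/
def tailH (φ : (Fin d → ℝ) → L2C) (L : ℕ) : ℝ :=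
  (∑' l : {l : Fin d → ℤ // l ∉ box d L}, ‖filterCoeff φ l‖ ^ 2) ^ ((1 : ℝ) / 4)

/-- The summand `⟨X_{s-l}, φ_l⟩` of the score at `s`, as an element of `L²(P)`. -/
def scoreTerm {P : Measure Ω} {X : (Fin d → ℤ) → Ω → L2R} (hX : ∀ s, MemLp (X s) 2 P)
    (φ : (Fin d → ℝ) → L2C) (s l : Fin d → ℤ) : Lp ℝ 2 P :=
  ((pairing (filterCoeff φ l)).comp_memLp' (hX (s - l))).toLp _

/-- The population score `Y_s = ∑_l ⟨X_{s-l}, φ_l⟩`, the series being taken in `L²(P)`. -/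
def score {P : Measure Ω} {X : (Fin d → ℤ) → Ω → L2R} (hX : ∀ s, MemLp (X s) 2 P)
    (φ : (Fin d → ℝ) → L2C) (s : Fin d → ℤ) : Lp ℝ 2 P :=
  ∑' l, scoreTerm hX φ s l

/-- The autocovariance `γ_h = cov(Y_h, Y_0)` of the population scores. -/
def scoreAutocov {P : Measure Ω} {X : (Fin d → ℤ) → Ω → L2R} (hX : ∀ s, MemLp (X s) 2 P)
    (φ : (Fin d → ℝ) → L2C) (h : Fin d → ℤ) : ℝ :=
  covariance (score hX φ h) (score hX φ 0) P

/-- The estimated score `Ŷ_s = ∑_{‖l‖_∞ ≤ L} ⟨X_{s-l}, φ̂_l⟩` at the outcome `ω`; `φhat` is the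
realized estimated eigenvector function. -/
def estScore (X : (Fin d → ℤ) → Ω → L2R) (φhat : (Fin d → ℝ) → L2C) (L : ℕ) (ω : Ω)
    (s : Fin d → ℤ) : ℝ :=
  ∑ l ∈ box d L, pairing (filterCoeff φhat l) (X (s - l) ω)

/-- The sampling region `{s ∈ ℤ^d : 1 ≤ s_i ≤ n_i}`. -/
def region (n : Fin d → ℕ) : Finset (Fin d → ℤ) := Finset.Icc (fun _ => 1) (fun i => (n i : ℤ))

/-- The sample mean of a scalar field over the sampling region. -/
def sampleMean (n : Fin d → ℕ) (Z : (Fin d → ℤ) → ℝ) : ℝ :=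
  ((region n).card : ℝ)⁻¹ * ∑ s ∈ region n, Z s

/-- The sample autocovariance of a scalar field at lag `h`: the sum is over all `s` with `s` and
`s + h` in the sampling region, and it is divided by the size of the region. -/
def sampleAutocov (n : Fin d → ℕ) (Z : (Fin d → ℤ) → ℝ) (h : Fin d → ℤ) : ℝ :=
  ((region n).card : ℝ)⁻¹ * ∑ s ∈ (region n).filter (fun s => s + h ∈ region n),
    (Z (s + h) - sampleMean n Z) * (Z s - sampleMean n Z)

/-- The sum over `‖l‖_∞ ≤ L'` of the `r`-th powers of the sample autocovariances of the estimated
scores: `r = 3` is the estimator of `σ²_S`, and `r = 4` that of `σ²_K`. -/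
def varEstimator (X : (Fin d → ℤ) → Ω → L2R) (φhat : (Fin d → ℝ) → L2C) (n : Fin d → ℕ)
    (L L' r : ℕ) (ω : Ω) : ℝ :=
  ∑ l ∈ box d L', sampleAutocov n (estScore X φhat L ω) l ^ r

/-- `G = ∫_{[-π,π]^d} ‖F̂_θ - F_θ‖ dθ` for a realized estimate `Fhat` (operator norm). -/
def specError (P : Measure Ω) (X : (Fin d → ℤ) → Ω → L2R)
    (Fhat : (Fin d → ℝ) → L2C →L[ℂ] L2C) : ℝ≥0∞ :=
  ∫⁻ θ in cube d, ‖Fhat θ - spectralDensity P X θ‖ₑ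

end Scores

end SFPC

end

set_option linter.unusedSectionVars false

/-! Let `a l` be the real part of the filter coefficient φ_{m,l} and `Δ l` the real part of its
estimation error, so that the estimated score is ∑ ⟨a l + Δ l, X_{s-l}⟩ over the box of radius L. It
is split as B - T, where B_s = Y_s + ∑ ⟨Δ l, X_{s-l}⟩ and T_s = Y_s - ∑ ⟨a l, X_{s-l}⟩ is the
truncation error. The lag averages of B are close to γ in ℓ² over the lags; T and the centering
shift every lag by a uniformly small amount.

The obstacle is that `Δ` depends on the whole sample, so moments of B are out of reach. The remedy
is the joint field Z = (Y, X) (`pairField`). The lag products of B are bilinear forms, with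
coefficient vectors (1, 0) and (0, Δ l), in empirical covariance operators of Z.
`sum_lagProduct_sub_sq_le` keeps only the operator norms of the centered empirical covariances, with
deterministic weights that are valid once |box L| · sup ‖Δ l‖ ≤ 1. By Isserlis' formula a centered
sum of these operators over S has mean squared norm at most 3 |S| ∑ κ_h², where κ_h bounds the
covariance of Z at lag h in the nuclear sense (`lintegral_enorm_noise_sq_le`). Summing over the lags
in the box of radius L' and dividing by N² leaves O(|box L'| / N), which vanishes.

That κ is square summable comes from Fourier analysis. Eigenvectors have norm one, so convolution
with the filter coefficients contracts ℓ² (`sum_norm_conv_filterCoeff_sq_le`); hence linear forms in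
Z are bounded on ℓ², and duality gives square summable covariances in each direction
(`sum_norm_pairCov_sq_le`). In particular ∑ γ_h² is finite, whence the series of cubes and fourth
powers converge.

The size of `Δ` comes from perturbation theory: the spectral gap β and Weyl's inequality bound the
eigenvector error by (4/β) ‖F̂ - F‖ at each frequency (`norm_eigenvector_sub_le`), and integrating
bounds all coefficient errors by (4/β) G at once.

Finally, in a sum of cubes or fourth powers an ℓ² error √A and a uniform error τ cost terms of order
√A + τ, A^{3/2} and |box L'| τ³ (`abs_sum_pow_sub_sum_pow_le`). So τ must be o(|box L'|^{-1/3}),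
which is where the factor (L')^{d/3} enters. Convergence in probability is treated as a limit along
the filter `probFilter`, so that the usual calculus of limits and squeezing applies to random
errors. -/

namespace SFPC

/-! ### Convergence in probability as convergence along a filter -/

section ProbFilter

variable {Ω : Type*} [MeasurableSpace Ω] {P : Measure Ω}

/-- The filter of all `U ⊆ ℕ × Ω` whose sections have probability tending to one. Convergence in
probability is convergence along this filter. -/
def probFilter (P : Measure Ω) : Filter (ℕ × Ω) where
  sets := {U | Tendsto (fun k => P {ω | (k, ω) ∉ U}) atTop (𝓝 0)}
  univ_sets := by simp
  sets_of_superset := by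
    intro U V hU hUV
    refine tendsto_of_tendsto_of_tendsto_of_le_of_le tendsto_const_nhds hU (fun _ => zero_le) ?_
    intro k
    exact measure_mono fun ω hω h => hω (hUV h)
  inter_sets := by
    intro U V hU hV
    have h := Tendsto.add hU hV
    rw [add_zero] at h
    refine tendsto_of_tendsto_of_tendsto_of_le_of_le tendsto_const_nhds h (fun _ => zero_le) ?_
    intro k
    refine (measure_mono ?_).trans (measure_union_le _ _)
    intro ω hω
    by_contra hc
    simp only [Set.mem_union, Set.mem_ofPred_eq, not_or, not_not] at hc
    exact hω hc

theorem eventually_probFilter {p : ℕ × Ω → Prop} :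
    (∀ᶠ x in probFilter P, p x) ↔ Tendsto (fun k => P {ω | ¬ p (k, ω)}) atTop (𝓝 0) :=
  Iff.rfl

theorem eventually_probFilter_of_ae {p : ℕ × Ω → Prop} (h : ∀ k, ∀ᵐ ω ∂P, p (k, ω)) :
    ∀ᶠ x in probFilter P, p x := by
  rw [eventually_probFilter]
  have : ∀ k, P {ω | ¬ p (k, ω)} = 0 := fun k => h k
  simp [this]

theorem tendsto_fst_probFilter : Tendsto Prod.fst (probFilter P) atTop := by
  intro s hs
  change ∀ᶠ x in probFilter P, x.1 ∈ s
  rw [eventually_probFilter]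
  refine tendsto_const_nhds.congr' ?_
  filter_upwards [hs] with k hk
  simp [hk]

theorem tendstoInMeasure_of_tendsto_probFilter {f : ℕ → Ω → ℝ} {c : ℝ}
    (h : Tendsto (fun x : ℕ × Ω => f x.1 x.2) (probFilter P) (𝓝 c)) :
    TendstoInMeasure P f atTop (fun _ => c) := by
  intro ε hε
  have h' := h.eventually (Metric.eball_mem_nhds c hε)
  rw [eventually_probFilter] at h'
  simpa [Metric.mem_eball] using h'

/-- Only monotonicity of the outer measure enters, so `f k` need not be measurable; this matters for
the integrated spectral error. -/
theorem tendsto_probFilter_of_measure_le {f : ℕ → Ω → ℝ≥0∞}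
    (h : ∀ ε : ℝ≥0∞, 0 < ε → Tendsto (fun k => P {ω | ε ≤ f k ω}) atTop (𝓝 0)) :
    Tendsto (fun x : ℕ × Ω => f x.1 x.2) (probFilter P) (𝓝 0) := by
  rw [ENNReal.tendsto_nhds_zero]
  intro ε hε
  rw [eventually_probFilter]
  refine tendsto_of_tendsto_of_tendsto_of_le_of_le tendsto_const_nhds (h ε hε)
    (fun _ => zero_le) fun k => measure_mono fun ω hω => ?_
  exact (not_le.1 hω).le

/-- Markov's inequality: convergence in mean implies convergence in probability. -/
theorem tendsto_probFilter_of_lintegral {f : ℕ → Ω → ℝ≥0∞} (hf : ∀ k, AEMeasurable (f k) P)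
    (h : Tendsto (fun k => ∫⁻ ω, f k ω ∂P) atTop (𝓝 0)) :
    Tendsto (fun x : ℕ × Ω => f x.1 x.2) (probFilter P) (𝓝 0) := by
  refine tendsto_probFilter_of_measure_le fun ε hε => ?_
  -- Dividing by an infinite level is useless, so this case applies Markov's inequality at level 1.
  by_cases hε' : ε = ∞
  · refine tendsto_of_tendsto_of_tendsto_of_le_of_le tendsto_const_nhds h
      (fun _ => zero_le) fun k => ?_
    have := meas_ge_le_lintegral_div (hf k) (ε := 1) (by simp) (by simp)
    refine (measure_mono fun ω hω => ?_).trans (this.trans (by simp))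
    have hω' : ε ≤ f k ω := hω
    exact le_trans (by simp [hε']) hω'
  have h' := ENNReal.Tendsto.div_const h (Or.inr hε.ne')
  rw [ENNReal.zero_div] at h'
  exact tendsto_of_tendsto_of_tendsto_of_le_of_le tendsto_const_nhds h'
    (fun _ => zero_le) fun k => meas_ge_le_lintegral_div (hf k) hε.ne' hε'

end ProbFilter

/-! ### Gaussian subspaces of `L²(P)` -/

section Gaussian

/-- The fourth moment of a centered Gaussian distribution. -/
theorem integral_pow_four_gaussianReal (v : ℝ≥0) : ∫ x, x ^ 4 ∂gaussianReal 0 v = 3 * (v : ℝ) ^ 2 := by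
  have h1 : ∫ x, x ^ 4 ∂gaussianReal 0 v = iteratedDeriv 4 (mgf (fun x => x) (gaussianReal 0 v)) 0 := by
    rw [iteratedDeriv_mgf_zero] <;> simp
  -- The derivatives of the moment generating function stay of the form polynomial times exp(v
  -- t²/2); `key` gives the recursion for the polynomial, applied four times.
  have key : ∀ (p p' : ℝ → ℝ), (∀ t, HasDerivAt p (p' t) t) →
      deriv (fun t : ℝ => p t * Real.exp (v * t ^ 2 / 2)) =
        fun t => (p' t + p t * (v * t)) * Real.exp (v * t ^ 2 / 2) := by
    intro p p' hp
    ext t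
    have he : HasDerivAt (fun t : ℝ => Real.exp (v * t ^ 2 / 2))
        (Real.exp (v * t ^ 2 / 2) * (v * t)) t := by
      refine HasDerivAt.exp ?_
      have := (((hasDerivAt_id t).pow 2).const_mul (v : ℝ)).div_const 2
      refine this.congr_deriv ?_
      norm_num
      ring
    rw [((hp t).fun_mul he).deriv]
    ring
  rw [h1, mgf_fun_id_gaussianReal]
  have e0 : (fun t : ℝ => Real.exp (0 * t + v * t ^ 2 / 2)) =
      fun t => (1 : ℝ) * Real.exp (v * t ^ 2 / 2) := by ext t; simp
  rw [e0]
  simp only [iteratedDeriv_succ, iteratedDeriv_zero]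
  rw [key (fun _ => 1) (fun _ => 0) (fun t => hasDerivAt_const t 1)]
  rw [key (fun t => 0 + 1 * (v * t)) (fun _ => v) (fun t => by
    simpa using (hasDerivAt_id t).const_mul (v : ℝ))]
  rw [key (fun t => v + (0 + 1 * (v * t)) * (v * t)) (fun t => 2 * v ^ 2 * t) (fun t => by
    have := ((hasDerivAt_pow 2 t).const_mul ((v : ℝ) ^ 2)).const_add (v : ℝ)
    refine (this.congr_deriv (by norm_num; ring)).congr_of_eventuallyEq
      (Eventually.of_forall fun s => by ring))]
  rw [key (fun t => 2 * v ^ 2 * t + (v + (0 + 1 * (v * t)) * (v * t)) * (v * t))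
    (fun t => 3 * v ^ 2 + 3 * v ^ 3 * t ^ 2) (fun t => by
    have := ((hasDerivAt_id t).const_mul (3 * (v : ℝ) ^ 2)).add
      ((hasDerivAt_pow 3 t).const_mul ((v : ℝ) ^ 3))
    refine (this.congr_deriv (by norm_num; ring)).congr_of_eventuallyEq
      (Eventually.of_forall fun s => by simp only [Pi.add_apply, id]; ring))]
  simp

variable {Ω : Type*} [MeasurableSpace Ω] {P : Measure Ω} [IsProbabilityMeasure P]

/-- The element `f` of `L²(P)` has a centered (possibly degenerate) normal distribution. -/
def IsCenteredGaussian (f : Lp ℝ 2 P) : Prop :=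
  P.map f = gaussianReal 0 (‖f‖₊ ^ 2)

theorem lp_norm_sq (f : Lp ℝ 2 P) : ‖f‖ ^ 2 = ∫ ω, f ω ^ 2 ∂P := by
  rw [← real_inner_self_eq_norm_sq, L2.inner_def]
  simp [pow_two]

theorem lp_inner (f g : Lp ℝ 2 P) : inner ℝ f g = ∫ ω, f ω * g ω ∂P := by
  rw [L2.inner_def]
  simp [mul_comm]

/-- This is nonnegativity of the variance of |f|. -/
theorem integral_abs_le_lp_norm (f : Lp ℝ 2 P) : ∫ ω, |f ω| ∂P ≤ ‖f‖ := by
  have h1 : MemLp (fun ω => |f ω|) 2 P := (Lp.memLp f).norm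
  have h2 := variance_nonneg (fun ω => |f ω|) P
  rw [variance_eq_sub h1] at h2
  have h3 : ∫ ω, |f ω| ^ 2 ∂P = ‖f‖ ^ 2 := by rw [lp_norm_sq]; simp
  have h4 : (∫ ω, |f ω| ∂P) ^ 2 ≤ ‖f‖ ^ 2 := by
    rw [← h3]
    simpa [Pi.pow_apply] using h2
  exact le_of_sq_le_sq h4 (norm_nonneg _)

/-- Since |e^{ita} - e^{itb}| ≤ |t| |a - b|, the characteristic function at t is Lipschitz for the
L¹ distance, hence for the L² distance. -/
theorem continuous_charFun_map (t : ℝ) :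
    Continuous (fun f : Lp ℝ 2 P => charFun (P.map f) t) := by
  have hL : LipschitzWith ‖t‖₊ (fun f : Lp ℝ 2 P => charFun (P.map f) t) := by
    refine LipschitzWith.of_dist_le_mul fun f g => ?_
    rw [dist_eq_norm, dist_eq_norm]
    have hinteg : ∀ f : Lp ℝ 2 P, Integrable (fun ω => Complex.exp (t * f ω * Complex.I)) P := by
      intro f
      refine Integrable.of_bound (C := 1) ?_ (ae_of_all _ fun ω => ?_)
      · have := (Lp.aestronglyMeasurable f).aemeasurable
        exact AEMeasurable.aestronglyMeasurable (by fun_prop)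
      · rw [← Complex.ofReal_mul, Complex.norm_exp_ofReal_mul_I]
    have hch : ∀ f : Lp ℝ 2 P, charFun (P.map f) t = ∫ ω, Complex.exp (t * f ω * Complex.I) ∂P := by
      intro f
      rw [charFun_apply_real, integral_map (Lp.aestronglyMeasurable f).aemeasurable]
      fun_prop
    rw [hch, hch, ← integral_sub (hinteg f) (hinteg g)]
    have hpt : ∀ a b : ℝ, ‖Complex.exp (t * a * Complex.I) - Complex.exp (t * b * Complex.I)‖ ≤
        |t| * |a - b| := by
      intro a b
      have : Complex.exp (t * a * Complex.I) - Complex.exp (t * b * Complex.I) =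
          Complex.exp ((t * b : ℝ) * Complex.I) *
            (Complex.exp (Complex.I * (t * (a - b) : ℝ)) - 1) := by
        rw [mul_sub, ← Complex.exp_add, mul_one]
        push_cast
        congr 2
        ring
      rw [this, norm_mul, Complex.norm_exp_ofReal_mul_I, one_mul]
      refine Real.norm_exp_I_mul_ofReal_sub_one_le.trans ?_
      simp
    calc ‖∫ ω, (Complex.exp (t * f ω * Complex.I) - Complex.exp (t * g ω * Complex.I)) ∂P‖
        ≤ ∫ ω, |t| * |(f - g) ω| ∂P := by
          refine norm_integral_le_of_norm_le ?_ ?_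
          · exact (((Lp.memLp (f - g)).integrable (by norm_num)).abs).const_mul _
          · filter_upwards [Lp.coeFn_sub f g] with ω hω
            rw [hω]
            exact hpt _ _
      _ = |t| * ∫ ω, |(f - g) ω| ∂P := integral_const_mul _ _
      _ ≤ ‖t‖₊ * ‖f - g‖ := by
          rw [coe_nnnorm, Real.norm_eq_abs]
          gcongr
          exact integral_abs_le_lp_norm _
  exact hL.continuous

theorem isCenteredGaussian_iff (f : Lp ℝ 2 P) :
    IsCenteredGaussian f ↔
      ∀ t : ℝ, charFun (P.map f) t = Complex.exp (-((‖f‖ ^ 2 * t ^ 2 / 2 : ℝ) : ℂ)) := by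
  have hg : ∀ t : ℝ, charFun (gaussianReal 0 (‖f‖₊ ^ 2)) t =
      Complex.exp (-((‖f‖ ^ 2 * t ^ 2 / 2 : ℝ) : ℂ)) := by
    intro t
    rw [charFun_gaussianReal]
    simp
  constructor
  · intro h t
    rw [h, hg]
  · intro h
    have : IsProbabilityMeasure (P.map f) :=
      Measure.isProbabilityMeasure_map (Lp.aestronglyMeasurable f).aemeasurable
    refine Measure.ext_of_charFun ?_
    ext t
    rw [h, hg]

/-- Being centered Gaussian is, for each t, an equation between two continuous functions of f. Hence
mean square limits, such as the scores, stay Gaussian. -/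
theorem isClosed_setOf_isCenteredGaussian : IsClosed {f : Lp ℝ 2 P | IsCenteredGaussian f} := by
  simp only [isCenteredGaussian_iff, Set.ofPred_forall]
  refine isClosed_iInter fun t => isClosed_eq (continuous_charFun_map t) ?_
  fun_prop

/-- A square integrable centered random variable with a Gaussian law defines a centered Gaussian
element of `L²(P)`. -/
theorem isCenteredGaussian_toLp {Z : Ω → ℝ} (hZ : MemLp Z 2 P) (hG : HasGaussianLaw Z P)
    (h0 : ∫ ω, Z ω ∂P = 0) : IsCenteredGaussian (hZ.toLp Z) := by
  unfold IsCenteredGaussian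
  rw [Measure.map_congr hZ.coeFn_toLp, hG.map_eq_gaussianReal, h0]
  congr 1
  have : Var[Z; P] = ‖hZ.toLp Z‖ ^ 2 := by
    rw [variance_of_integral_eq_zero hG.aemeasurable h0, lp_norm_sq]
    refine integral_congr_ae ?_
    filter_upwards [hZ.coeFn_toLp] with ω hω
    rw [hω]
  rw [this]
  ext
  rw [Real.coe_toNNReal _ (sq_nonneg _), NNReal.coe_pow, coe_nnnorm]

theorem IsCenteredGaussian.memLp_four {f : Lp ℝ 2 P} (hf : IsCenteredGaussian f) :
    MemLp f 4 P := by
  have h : MemLp id 4 (P.map f) := by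
    rw [hf]
    exact memLp_id_gaussianReal' 4 (by simp)
  exact (memLp_map_measure_iff (by fun_prop) (Lp.aestronglyMeasurable f).aemeasurable).1 h

theorem IsCenteredGaussian.integral_pow_four {f : Lp ℝ 2 P} (hf : IsCenteredGaussian f) :
    ∫ ω, f ω ^ 4 ∂P = 3 * ‖f‖ ^ 4 := by
  have h : ∫ x, x ^ 4 ∂(P.map f) = ∫ ω, f ω ^ 4 ∂P :=
    integral_map (Lp.aestronglyMeasurable f).aemeasurable (by fun_prop)
  rw [← h, hf, integral_pow_four_gaussianReal]
  simp
  ring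

theorem integrable_pow_four {Z : Ω → ℝ} (hZ : MemLp Z 4 P) : Integrable (fun ω => Z ω ^ 4) P := by
  have := hZ.integrable_norm_pow (by norm_num)
  refine this.congr (ae_of_all _ fun ω => ?_)
  simp only [Real.norm_eq_abs]
  exact Even.pow_abs (by decide) _

theorem memLp_two_mul {Z W : Ω → ℝ} (hZ : MemLp Z 4 P) (hW : MemLp W 4 P) :
    MemLp (fun ω => Z ω * W ω) 2 P := by
  have : ENNReal.HolderTriple 4 4 2 := ⟨by
    have h4 : (4 : ℝ≥0∞) = 2 * 2 := by norm_num
    rw [h4, ENNReal.mul_inv (by simp) (by simp), ← mul_two, mul_assoc,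
      ENNReal.inv_mul_cancel (by simp) (by simp), mul_one]⟩
  exact hW.mul hZ

section Isserlis

variable {M : Submodule ℝ (Lp ℝ 2 P)}

/-- Isserlis' formula for the fourth moments of a Gaussian family. -/
theorem isserlis (hM : ∀ f ∈ M, IsCenteredGaussian f)
    {f g h k : Lp ℝ 2 P} (hf : f ∈ M) (hg : g ∈ M) (hh : h ∈ M) (hk : k ∈ M) :
    ∫ ω, f ω * g ω * (h ω * k ω) ∂P =
      inner ℝ f g * inner ℝ h k + inner ℝ f h * inner ℝ g k + inner ℝ f k * inner ℝ g h := by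
  have hmem : ∀ a b c : ℝ, f + a • g + b • h + c • k ∈ M := fun a b c =>
    M.add_mem (M.add_mem (M.add_mem hf (M.smul_mem _ hg)) (M.smul_mem _ hh)) (M.smul_mem _ hk)
  have hcoe : ∀ a b c : ℝ, ∀ᵐ ω ∂P, (f + a • g + b • h + c • k : Lp ℝ 2 P) ω =
      f ω + a * g ω + b * h ω + c * k ω := by
    intro a b c
    filter_upwards [Lp.coeFn_add (f + a • g + b • h) (c • k), Lp.coeFn_add (f + a • g) (b • h),
      Lp.coeFn_add f (a • g), Lp.coeFn_smul a g, Lp.coeFn_smul b h, Lp.coeFn_smul c k]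
      with ω h1 h2 h3 h4 h5 h6
    rw [h1, Pi.add_apply, h2, Pi.add_apply, h3, Pi.add_apply, h4, h5, h6]
    rfl
  have hinteg : ∀ a b c : ℝ, Integrable (fun ω => (f ω + a * g ω + b * h ω + c * k ω) ^ 4) P := by
    intro a b c
    refine (integrable_pow_four (hM _ (hmem a b c)).memLp_four).congr ?_
    filter_upwards [hcoe a b c] with ω hω
    rw [hω]
  have hval : ∀ a b c : ℝ, ∫ ω, (f ω + a * g ω + b * h ω + c * k ω) ^ 4 ∂P =
      3 * (inner ℝ f f + a ^ 2 * inner ℝ g g + b ^ 2 * inner ℝ h h + c ^ 2 * inner ℝ k k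
        + 2 * a * inner ℝ f g + 2 * b * inner ℝ f h + 2 * c * inner ℝ f k
        + 2 * a * b * inner ℝ g h + 2 * a * c * inner ℝ g k + 2 * b * c * inner ℝ h k) ^ 2 := by
    intro a b c
    have h1 := (hM _ (hmem a b c)).integral_pow_four
    have h2 : ‖f + a • g + b • h + c • k‖ ^ 4 = (inner ℝ (f + a • g + b • h + c • k)
        (f + a • g + b • h + c • k)) ^ 2 := by
      rw [real_inner_self_eq_norm_sq]; ring
    rw [h2] at h1
    have h3 : ∫ ω, (f ω + a * g ω + b * h ω + c * k ω) ^ 4 ∂P =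
        ∫ ω, ((f + a • g + b • h + c • k : Lp ℝ 2 P) ω) ^ 4 ∂P := by
      refine integral_congr_ae ?_
      filter_upwards [hcoe a b c] with ω hω
      rw [hω]
    rw [h3, h1]
    simp only [inner_add_left, inner_add_right, real_inner_smul_left, real_inner_smul_right]
    rw [real_inner_comm f g, real_inner_comm f h, real_inner_comm f k, real_inner_comm g h,
      real_inner_comm g k, real_inner_comm h k]
    ring
  -- Polarization: the signed sum over the 8 choices of signs keeps only the monomial f g h k, with
  -- coefficient 8 · 4! = 192.
  have hpol : ∀ ω, f ω * g ω * (h ω * k ω) = (1 / 192 : ℝ) *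
      ((f ω + 1 * g ω + 1 * h ω + 1 * k ω) ^ 4 - (f ω + 1 * g ω + 1 * h ω + (-1) * k ω) ^ 4
      - (f ω + 1 * g ω + (-1) * h ω + 1 * k ω) ^ 4 + (f ω + 1 * g ω + (-1) * h ω + (-1) * k ω) ^ 4
      - (f ω + (-1) * g ω + 1 * h ω + 1 * k ω) ^ 4 + (f ω + (-1) * g ω + 1 * h ω + (-1) * k ω) ^ 4
      + (f ω + (-1) * g ω + (-1) * h ω + 1 * k ω) ^ 4
      - (f ω + (-1) * g ω + (-1) * h ω + (-1) * k ω) ^ 4) := by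
    intro ω
    ring
  simp_rw [hpol]
  rw [integral_const_mul, integral_sub (by fun_prop) (by fun_prop),
    integral_add (by fun_prop) (by fun_prop), integral_add (by fun_prop) (by fun_prop),
    integral_sub (by fun_prop) (by fun_prop), integral_add (by fun_prop) (by fun_prop),
    integral_sub (by fun_prop) (by fun_prop), integral_sub (by fun_prop) (by fun_prop)]
  simp only [hval]
  ring

/-- The variance of a sum of products of jointly Gaussian variables. -/
theorem integral_sq_sum_mul_sub (hM : ∀ f ∈ M, IsCenteredGaussian f)
    {ι : Type*} (S : Finset ι) {u v : ι → Lp ℝ 2 P}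
    (hu : ∀ s, u s ∈ M) (hv : ∀ s, v s ∈ M) :
    ∫ ω, (∑ s ∈ S, (u s ω * v s ω - inner ℝ (u s) (v s))) ^ 2 ∂P =
      ∑ s ∈ S, ∑ t ∈ S, (inner ℝ (u s) (u t) * inner ℝ (v s) (v t)
        + inner ℝ (u s) (v t) * inner ℝ (v s) (u t)) := by
  have h2 : ∀ s, MemLp (fun ω => u s ω * v s ω) 2 P := fun s =>
    memLp_two_mul (hM _ (hu s)).memLp_four (hM _ (hv s)).memLp_four
  have h1 : ∀ s, Integrable (fun ω => u s ω * v s ω) P := fun s => (h2 s).integrable (by norm_num)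
  have h22 : ∀ s t, Integrable (fun ω => u s ω * v s ω * (u t ω * v t ω)) P := fun s t =>
    (h2 s).integrable_mul (h2 t)
  have hexp : ∀ ω, (∑ s ∈ S, (u s ω * v s ω - inner ℝ (u s) (v s))) ^ 2 =
      ∑ s ∈ S, ∑ t ∈ S, ((u s ω * v s ω * (u t ω * v t ω) - inner ℝ (u t) (v t) * (u s ω * v s ω))
        - (inner ℝ (u s) (v s) * (u t ω * v t ω) - inner ℝ (u s) (v s) * inner ℝ (u t) (v t))) := by
    intro ω
    rw [pow_two, Finset.sum_mul_sum]
    refine Finset.sum_congr rfl fun s _ => Finset.sum_congr rfl fun t _ => ?_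
    ring
  simp_rw [hexp]
  have hA : ∀ s t, Integrable (fun ω => u s ω * v s ω * (u t ω * v t ω)
      - inner ℝ (u t) (v t) * (u s ω * v s ω)) P := fun s t => (h22 s t).sub ((h1 s).const_mul _)
  have hB : ∀ s t, Integrable (fun ω => inner ℝ (u s) (v s) * (u t ω * v t ω)
      - inner ℝ (u s) (v s) * inner ℝ (u t) (v t)) P := fun s t =>
    ((h1 t).const_mul _).sub (integrable_const _)
  have hAB : ∀ s t, Integrable (fun ω => (u s ω * v s ω * (u t ω * v t ω)
      - inner ℝ (u t) (v t) * (u s ω * v s ω)) - (inner ℝ (u s) (v s) * (u t ω * v t ω)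
      - inner ℝ (u s) (v s) * inner ℝ (u t) (v t))) P := fun s t => (hA s t).sub (hB s t)
  rw [integral_finsetSum _ fun s _ => integrable_finsetSum _ fun t _ => hAB s t]
  refine Finset.sum_congr rfl fun s _ => ?_
  rw [integral_finsetSum _ fun t _ => hAB s t]
  refine Finset.sum_congr rfl fun t _ => ?_
  -- Of the three pairings in Isserlis' formula, the one within each product cancels against the
  -- product of the means.
  rw [integral_sub (hA s t) (hB s t), integral_sub (h22 s t) ((h1 s).const_mul _),
    integral_sub ((h1 t).const_mul _) (integrable_const _), integral_const_mul, integral_const_mul,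
    isserlis hM (hu s) (hv s) (hu t) (hv t), ← lp_inner, ← lp_inner]
  simp
  ring

theorem integrable_sq_sum_mul_sub (hM : ∀ f ∈ M, IsCenteredGaussian f)
    {ι : Type*} (S : Finset ι) {u v : ι → Lp ℝ 2 P}
    (hu : ∀ s, u s ∈ M) (hv : ∀ s, v s ∈ M) :
    Integrable (fun ω => (∑ s ∈ S, (u s ω * v s ω - inner ℝ (u s) (v s))) ^ 2) P := by
  refine MemLp.integrable_sq ?_
  refine memLp_finsetSum _ fun s _ => ?_
  exact (memLp_two_mul (hM _ (hu s)).memLp_four (hM _ (hv s)).memLp_four).sub (memLp_const _)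

end Isserlis

end Gaussian

/-! ### Nuclear operators and empirical covariances -/

section Nuclear

variable {E : Type*} [NormedAddCommGroup E] [InnerProductSpace ℝ E]

/-- Distinct orthonormal vectors are at distance √2, so the balls of radius 1/2 around them are
disjoint and separability leaves countably many. Countability allows exchanging basis sums with
integrals and with almost sure statements. -/
theorem exists_countable_hilbertBasis (E : Type*) [NormedAddCommGroup E] [InnerProductSpace ℝ E]
    [CompleteSpace E] [TopologicalSpace.SeparableSpace E] :
    ∃ w : Set E, Countable w ∧ Nonempty (HilbertBasis w ℝ E) := by
  obtain ⟨w, b, hb⟩ := exists_hilbertBasis ℝ E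
  refine ⟨w, ?_, ⟨b⟩⟩
  refine Pairwise.countable_of_isOpen_disjoint (s := fun i => Metric.ball (b i) (1 / 2)) ?_
    (fun i => Metric.isOpen_ball) fun i => ⟨b i, Metric.mem_ball_self (by norm_num)⟩
  intro i j hij
  refine Metric.ball_disjoint_ball ?_
  rw [dist_eq_norm]
  have h1 : ‖b i - b j‖ ^ 2 = 2 := by
    rw [norm_sub_sq_real, b.orthonormal.1, b.orthonormal.1, b.orthonormal.2 hij]
    norm_num
  nlinarith [norm_nonneg (b i - b j)]

theorem enorm_sq_eq_ofReal {V : Type*} [SeminormedAddCommGroup V] (x : V) : ‖x‖ₑ ^ 2 = ENNReal.ofReal (‖x‖ ^ 2) := by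
  rw [ENNReal.ofReal_pow (norm_nonneg _), ofReal_norm]

theorem tsum_enorm_inner_sq {ι : Type*} (b : HilbertBasis ι ℝ E) (x : E) :
    ∑' i, ‖inner ℝ (b i) x‖ₑ ^ 2 = ‖x‖ₑ ^ 2 := by
  have h := b.hasSum_inner_mul_inner x x
  have h2 : HasSum (fun i => ‖inner ℝ (b i) x‖ ^ 2) (‖x‖ ^ 2) := by
    rw [real_inner_self_eq_norm_sq] at h
    refine h.congr_fun ?_
    intro i
    rw [real_inner_comm x, Real.norm_eq_abs, sq_abs, pow_two]
  rw [enorm_sq_eq_ofReal, ← h2.tsum_eq, ENNReal.ofReal_tsum_of_nonneg (fun i => sq_nonneg _)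
    h2.summable]
  simp_rw [← enorm_sq_eq_ofReal]

/-- Cauchy–Schwarz followed by Bessel's inequality for each factor. -/
theorem tsum_enorm_inner_mul_le {ι : Type*} {b : ι → E} (hb : Orthonormal ℝ b) (x y : E) :
    ∑' i, ‖inner ℝ x (b i)‖ₑ * ‖inner ℝ y (b i)‖ₑ ≤ ‖x‖ₑ * ‖y‖ₑ := by
  rw [ENNReal.tsum_eq_iSup_sum]
  refine iSup_le fun s => ?_
  have h : ∑ i ∈ s, ‖inner ℝ x (b i)‖ * ‖inner ℝ y (b i)‖ ≤ ‖x‖ * ‖y‖ := by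
    have h1 := Finset.sum_mul_sq_le_sq_mul_sq s (fun i => ‖inner ℝ x (b i)‖)
      (fun i => ‖inner ℝ y (b i)‖)
    have hx := hb.sum_inner_products_le x (s := s)
    have hy := hb.sum_inner_products_le y (s := s)
    simp_rw [real_inner_comm (_ : E) (b _)] at hx hy
    refine le_of_sq_le_sq ?_ (by positivity)
    rw [mul_pow]
    exact h1.trans (mul_le_mul hx hy (Finset.sum_nonneg fun i _ => sq_nonneg _) (sq_nonneg _))
  calc ∑ i ∈ s, ‖inner ℝ x (b i)‖ₑ * ‖inner ℝ y (b i)‖ₑ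
      = ENNReal.ofReal (∑ i ∈ s, ‖inner ℝ x (b i)‖ * ‖inner ℝ y (b i)‖) := by
        rw [ENNReal.ofReal_sum_of_nonneg fun i _ => by positivity]
        refine Finset.sum_congr rfl fun i _ => ?_
        rw [ENNReal.ofReal_mul (norm_nonneg _), ofReal_norm, ofReal_norm]
    _ ≤ ENNReal.ofReal (‖x‖ * ‖y‖) := ENNReal.ofReal_le_ofReal h
    _ = ‖x‖ₑ * ‖y‖ₑ := by rw [ENNReal.ofReal_mul (norm_nonneg _), ofReal_norm, ofReal_norm]

/-- The bilinear form `⟨u, A v⟩` is dominated by a sum of products of linear functionals with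
total norm at most `ν`. -/
def HasNuclearBound (A : E →L[ℝ] E) (ν : ℝ≥0∞) : Prop :=
  ∃ (κ : Type) (x y : κ → E),
    (∀ u v, ‖inner ℝ u (A v)‖ₑ ≤ ∑' n, ‖inner ℝ (x n) u‖ₑ * ‖inner ℝ (y n) v‖ₑ) ∧
    ∑' n, ‖x n‖ₑ * ‖y n‖ₑ ≤ ν

/-- The trace is controlled one rank-one term at a time: exchange the sums and apply Cauchy–Schwarz
and Bessel to each term. -/
theorem HasNuclearBound.tsum_diag_le {A : E →L[ℝ] E} {ν : ℝ≥0∞} (hA : HasNuclearBound A ν)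
    {ι : Type*} {b : ι → E} (hb : Orthonormal ℝ b) :
    ∑' i, ‖inner ℝ (b i) (A (b i))‖ₑ ≤ ν := by
  obtain ⟨κ, x, y, h, hν⟩ := hA
  calc ∑' i, ‖inner ℝ (b i) (A (b i))‖ₑ
      ≤ ∑' i, ∑' n, ‖inner ℝ (x n) (b i)‖ₑ * ‖inner ℝ (y n) (b i)‖ₑ :=
        ENNReal.tsum_le_tsum fun i => h _ _
    _ = ∑' n, ∑' i, ‖inner ℝ (x n) (b i)‖ₑ * ‖inner ℝ (y n) (b i)‖ₑ := ENNReal.tsum_comm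
    _ ≤ ∑' n, ‖x n‖ₑ * ‖y n‖ₑ := ENNReal.tsum_le_tsum fun n => tsum_enorm_inner_mul_le hb _ _
    _ ≤ ν := hν

/-- After expanding both forms, the sum over i sees one functional from each of A and B, and so does
the sum over j, so each inner sum is again Cauchy–Schwarz and Bessel. This handles the crossed
pairing in Isserlis' formula, where two different lags meet. -/
theorem HasNuclearBound.tsum_mul_le {A B : E →L[ℝ] E} {ν μ : ℝ≥0∞} (hA : HasNuclearBound A ν)
    (hB : HasNuclearBound B μ) {ι : Type*} {b : ι → E} (hb : Orthonormal ℝ b) :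
    ∑' i, ∑' j, ‖inner ℝ (b i) (A (b j))‖ₑ * ‖inner ℝ (b j) (B (b i))‖ₑ ≤ ν * μ := by
  obtain ⟨κ, x, y, h, hν⟩ := hA
  obtain ⟨κ', x', y', h', hμ⟩ := hB
  calc ∑' i, ∑' j, ‖inner ℝ (b i) (A (b j))‖ₑ * ‖inner ℝ (b j) (B (b i))‖ₑ
      ≤ ∑' i, ∑' j, ∑' n, ∑' m, (‖inner ℝ (x n) (b i)‖ₑ * ‖inner ℝ (y' m) (b i)‖ₑ) *
          (‖inner ℝ (y n) (b j)‖ₑ * ‖inner ℝ (x' m) (b j)‖ₑ) := by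
        refine ENNReal.tsum_le_tsum fun i => ENNReal.tsum_le_tsum fun j => ?_
        refine (mul_le_mul' (h _ _) (h' _ _)).trans (le_of_eq ?_)
        rw [← ENNReal.tsum_mul_right]
        refine tsum_congr fun n => ?_
        rw [← ENNReal.tsum_mul_left]
        refine tsum_congr fun m => ?_
        ring
    _ = ∑' n, ∑' m, ∑' i, ∑' j, (‖inner ℝ (x n) (b i)‖ₑ * ‖inner ℝ (y' m) (b i)‖ₑ) *
          (‖inner ℝ (y n) (b j)‖ₑ * ‖inner ℝ (x' m) (b j)‖ₑ) := by
        conv_lhs => enter [1, i]; rw [ENNReal.tsum_comm]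
        rw [ENNReal.tsum_comm]
        refine tsum_congr fun n => ?_
        conv_lhs => enter [1, i]; rw [ENNReal.tsum_comm]
        rw [ENNReal.tsum_comm]
    _ ≤ ∑' n, ∑' m, (‖x n‖ₑ * ‖y n‖ₑ) * (‖x' m‖ₑ * ‖y' m‖ₑ) := by
        refine ENNReal.tsum_le_tsum fun n => ENNReal.tsum_le_tsum fun m => ?_
        simp_rw [ENNReal.tsum_mul_left, ENNReal.tsum_mul_right]
        refine (mul_le_mul' (tsum_enorm_inner_mul_le hb _ _)
          (tsum_enorm_inner_mul_le hb _ _)).trans (le_of_eq ?_)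
        ring
    _ = (∑' n, ‖x n‖ₑ * ‖y n‖ₑ) * (∑' m, ‖x' m‖ₑ * ‖y' m‖ₑ) := by
        simp_rw [ENNReal.tsum_mul_left, ENNReal.tsum_mul_right]
    _ ≤ ν * μ := mul_le_mul' hν hμ

/-- The operator norm is at most the Hilbert–Schmidt norm. -/
theorem enorm_sq_le_tsum_inner [CompleteSpace E] {ι : Type*} (b : HilbertBasis ι ℝ E)
    (A : E →L[ℝ] E) : ‖A‖ₑ ^ 2 ≤ ∑' i, ∑' j, ‖inner ℝ (b i) (A (b j))‖ₑ ^ 2 := by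
  set Q := ∑' i, ∑' j, ‖inner ℝ (b i) (A (b j))‖ₑ ^ 2 with hQ
  by_cases hQt : Q = ∞
  · rw [hQt]; exact le_top
  have hx : ∀ x, ‖A x‖ₑ ^ 2 ≤ Q * ‖x‖ₑ ^ 2 := by
    intro x
    rw [← tsum_enorm_inner_sq b, hQ, ← ENNReal.tsum_mul_right]
    refine ENNReal.tsum_le_tsum fun i => ?_
    -- Parseval for the adjoint: each row sum is ‖A* b_i‖², which dominates the i-th coordinate of A
    -- x.
    have h1 : ∑' j, ‖inner ℝ (b i) (A (b j))‖ₑ ^ 2 = ‖A.adjoint (b i)‖ₑ ^ 2 := by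
      rw [← tsum_enorm_inner_sq b]
      refine tsum_congr fun j => ?_
      rw [ContinuousLinearMap.adjoint_inner_right, real_inner_comm]
    rw [h1, ← ContinuousLinearMap.adjoint_inner_left, ← mul_pow]
    gcongr
    rw [← ofReal_norm, ← ofReal_norm, ← ofReal_norm, ← ENNReal.ofReal_mul (norm_nonneg _)]
    exact ENNReal.ofReal_le_ofReal (norm_inner_le_norm _ _)
  have hb : ‖A‖ ≤ √Q.toReal := by
    refine A.opNorm_le_bound (Real.sqrt_nonneg _) fun x => ?_
    refine le_of_sq_le_sq ?_ (by positivity)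
    rw [mul_pow, Real.sq_sqrt ENNReal.toReal_nonneg]
    have := ENNReal.toReal_mono (ENNReal.mul_ne_top hQt (by simp)) (hx x)
    simpa using this
  rw [enorm_sq_eq_ofReal]
  refine ENNReal.ofReal_le_of_le_toReal ?_
  calc ‖A‖ ^ 2 ≤ √Q.toReal ^ 2 := by gcongr
    _ = Q.toReal := Real.sq_sqrt ENNReal.toReal_nonneg

end Nuclear

/-! ### Second moments of sums and of empirical covariance operators. -/

section Noise

variable {Ω : Type*} [MeasurableSpace Ω] {P : Measure Ω} [IsProbabilityMeasure P]
variable {E : Type*} [NormedAddCommGroup E] [InnerProductSpace ℝ E]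
variable {G : Type*} [AddCommGroup G]

/-- The projection `⟨u, Z⟩` of a random element `Z` as an element of `L²(P)`. -/
noncomputable def proj {Z : Ω → E} (hZ : MemLp Z 2 P) (u : E) : Lp ℝ 2 P :=
  (hZ.const_inner (𝕜 := ℝ) u).toLp _

theorem coeFn_proj {Z : Ω → E} (hZ : MemLp Z 2 P) (u : E) :
    proj hZ u =ᵐ[P] fun ω => inner ℝ u (Z ω) := MemLp.coeFn_toLp _

theorem inner_proj {Z W : Ω → E} (hZ : MemLp Z 2 P) (hW : MemLp W 2 P) (u v : E) :
    inner ℝ (proj hZ u) (proj hW v) = ∫ ω, inner ℝ u (Z ω) * inner ℝ v (W ω) ∂P := by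
  rw [lp_inner]
  refine integral_congr_ae ?_
  filter_upwards [coeFn_proj hZ u, coeFn_proj hW v] with ω h1 h2
  rw [h1, h2]

theorem lintegral_enorm_sq_lp (f : Lp ℝ 2 P) : ∫⁻ ω, ‖f ω‖ₑ ^ 2 ∂P = ‖f‖ₑ ^ 2 := by
  rw [enorm_sq_eq_ofReal, lp_norm_sq, ofReal_integral_eq_lintegral_ofReal
    (Lp.memLp f).integrable_sq (ae_of_all _ fun ω => sq_nonneg _)]
  refine lintegral_congr fun ω => ?_
  rw [enorm_sq_eq_ofReal, Real.norm_eq_abs, sq_abs]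

theorem coeFn_lp_sum {ι : Type*} (S : Finset ι) (f : ι → Lp ℝ 2 P) :
    ∀ᵐ ω ∂P, (∑ s ∈ S, f s : Lp ℝ 2 P) ω = ∑ s ∈ S, f s ω := by
  classical
  induction S using Finset.induction_on with
  | empty =>
    filter_upwards [Lp.coeFn_zero ℝ 2 P] with ω h
    simp
  | insert s S hs ih =>
    rw [Finset.sum_insert hs]
    filter_upwards [ih, Lp.coeFn_add (f s) (∑ s ∈ S, f s)] with ω h1 h2
    rw [h2, Pi.add_apply, h1, Finset.sum_insert hs]

/-- `Z` is a field of square integrable random elements whose projections belong to the Gaussian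
space `M`, with stationary covariances given by the operators `C`. -/
structure IsStationaryIn (M : Submodule ℝ (Lp ℝ 2 P)) (Z : G → Ω → E) (C : G → E →L[ℝ] E) :
    Prop where
  memLp : ∀ s, MemLp (Z s) 2 P
  proj_mem : ∀ s u, proj (memLp s) u ∈ M
  cov : ∀ s t u v, inner ℝ (proj (memLp s) u) (proj (memLp t) v) = inner ℝ u (C (s - t) v)

variable {M : Submodule ℝ (Lp ℝ 2 P)} {Z : G → Ω → E} {C : G → E →L[ℝ] E}

/-- For fixed s the lag s - t + c determines t, so the inner sum runs over distinct lags. -/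
theorem sum_sum_enorm_sub_le (S : Finset G) (ν : G → ℝ≥0∞) (c : G) :
    ∑ s ∈ S, ∑ t ∈ S, ν (s - t + c) ≤ S.card * ∑' h, ν h := by
  classical
  rw [← nsmul_eq_mul]
  refine Finset.sum_le_card_nsmul _ _ _ fun s _ => ?_
  have hinj : Function.Injective (fun t : G => s - t + c) := by
    intro t t' h
    simpa using h
  calc ∑ t ∈ S, ν (s - t + c) ≤ ∑' t, ν (s - t + c) := ENNReal.sum_le_tsum S
    _ ≤ ∑' h, ν h := ENNReal.tsum_comp_le_tsum_of_injective hinj ν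

/-- The second moment of a sum of a field with nuclear covariances. -/
theorem IsStationaryIn.lintegral_enorm_sum_sq_le [CompleteSpace E]
    [TopologicalSpace.SeparableSpace E] (hZ : IsStationaryIn M Z C) {ν : G → ℝ≥0∞}
    (hν : ∀ h, HasNuclearBound (C h) (ν h)) (S : Finset G) (a : G) :
    ∫⁻ ω, ‖∑ s ∈ S, Z (s + a) ω‖ₑ ^ 2 ∂P ≤ S.card * ∑' h, ν h := by
  obtain ⟨w, hw, ⟨b⟩⟩ := exists_countable_hilbertBasis E
  have hco : ∀ i, ∀ᵐ ω ∂P, inner ℝ (b i) (∑ s ∈ S, Z (s + a) ω) =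
      (∑ s ∈ S, proj (hZ.memLp (s + a)) (b i) : Lp ℝ 2 P) ω := by
    intro i
    filter_upwards [coeFn_lp_sum S fun s => proj (hZ.memLp (s + a)) (b i),
      (eventually_all_finset S).2 fun s _ => coeFn_proj (hZ.memLp (s + a)) (b i)] with ω h1 h2
    rw [h1, inner_sum]
    exact Finset.sum_congr rfl fun s hs => (h2 s hs).symm
  calc ∫⁻ ω, ‖∑ s ∈ S, Z (s + a) ω‖ₑ ^ 2 ∂P
      = ∫⁻ ω, ∑' i, ‖(∑ s ∈ S, proj (hZ.memLp (s + a)) (b i) : Lp ℝ 2 P) ω‖ₑ ^ 2 ∂P := by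
        refine lintegral_congr_ae ?_
        filter_upwards [ae_all_iff.2 hco] with ω hω
        rw [← tsum_enorm_inner_sq b]
        refine tsum_congr fun i => ?_
        rw [hω i]
    _ = ∑' i, ‖(∑ s ∈ S, proj (hZ.memLp (s + a)) (b i) : Lp ℝ 2 P)‖ₑ ^ 2 := by
        rw [lintegral_tsum fun i => by
          have := (Lp.aestronglyMeasurable
            (∑ s ∈ S, proj (hZ.memLp (s + a)) (b i) : Lp ℝ 2 P)).enorm
          fun_prop]
        exact tsum_congr fun i => lintegral_enorm_sq_lp _
    _ ≤ ∑' i, ∑ s ∈ S, ∑ t ∈ S, ‖inner ℝ (b i) (C (s - t) (b i))‖ₑ := by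
        refine ENNReal.tsum_le_tsum fun i => ?_
        rw [enorm_sq_eq_ofReal, ← real_inner_self_eq_norm_sq, sum_inner]
        simp_rw [inner_sum, hZ.cov, add_sub_add_right_eq_sub]
        refine (ENNReal.ofReal_le_ofReal (le_abs_self _)).trans ?_
        rw [← Real.norm_eq_abs, ofReal_norm]
        refine (enorm_sum_le _ _).trans (Finset.sum_le_sum fun s _ => enorm_sum_le _ _)
    _ = ∑ s ∈ S, ∑ t ∈ S, ∑' i, ‖inner ℝ (b i) (C (s - t) (b i))‖ₑ := by
        rw [Summable.tsum_finsetSum fun _ _ => ENNReal.summable]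
        refine Finset.sum_congr rfl fun s _ => ?_
        rw [Summable.tsum_finsetSum fun _ _ => ENNReal.summable]
    _ ≤ ∑ s ∈ S, ∑ t ∈ S, ν (s - t + 0) := by
        refine Finset.sum_le_sum fun s _ => Finset.sum_le_sum fun t _ => ?_
        rw [add_zero]
        exact (hν _).tsum_diag_le b.orthonormal
    _ ≤ S.card * ∑' h, ν h := sum_sum_enorm_sub_le S ν 0

theorem aestronglyMeasurable_rankOne {𝕜 V : Type*} [RCLike 𝕜] [NormedAddCommGroup V]
    [InnerProductSpace 𝕜 V] {f g : Ω → V} (hf : AEStronglyMeasurable f P)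
    (hg : AEStronglyMeasurable g P) :
    AEStronglyMeasurable (fun ω => InnerProductSpace.rankOne 𝕜 (f ω) (g ω)) P := by
  have h := ContinuousLinearMap.continuous₂ (ContinuousLinearMap.smulRightL 𝕜 V V)
  exact h.comp_aestronglyMeasurable₂ ((innerSL 𝕜).continuous.comp_aestronglyMeasurable hg) hf

/-- The centered sum of the rank one operators `⟨Z_{s+b}, ·⟩ Z_{s+a}` over `s ∈ S`. -/
noncomputable def noise (Z : G → Ω → E) (C : G → E →L[ℝ] E) (S : Finset G) (a b : G) (ω : Ω) :
    E →L[ℝ] E :=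
  ∑ s ∈ S, (InnerProductSpace.rankOne ℝ (Z (s + a) ω) (Z (s + b) ω) - C (a - b))

theorem IsStationaryIn.aestronglyMeasurable_noise (hZ : IsStationaryIn M Z C) (S : Finset G)
    (a b : G) : AEStronglyMeasurable (noise Z C S a b) P := by
  unfold noise
  refine Finset.aestronglyMeasurable_fun_sum S fun s _ => ?_
  refine AEStronglyMeasurable.sub ?_ aestronglyMeasurable_const
  exact aestronglyMeasurable_rankOne (hZ.memLp (s + a)).aestronglyMeasurable
    (hZ.memLp (s + b)).aestronglyMeasurable

/-- A matrix coefficient of the noise is a centered sum of products of two Gaussian variables, whose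
variance is given by the two surviving pairings: (u,u)(v,v) at lag s - t, and (u,v)(v,u) at the lags
shifted by ±(a - b). -/
theorem IsStationaryIn.lintegral_inner_noise_sq_le (hM : ∀ f ∈ M, IsCenteredGaussian f)
    (hZ : IsStationaryIn M Z C) (S : Finset G) (a b : G) (u v : E) :
    ∫⁻ ω, ‖inner ℝ u (noise Z C S a b ω v)‖ₑ ^ 2 ∂P ≤
      ∑ s ∈ S, ∑ t ∈ S, (‖inner ℝ u (C (s - t) u)‖ₑ * ‖inner ℝ v (C (s - t) v)‖ₑ +
        ‖inner ℝ u (C (s - t + (a - b)) v)‖ₑ * ‖inner ℝ v (C (s - t + (b - a)) u)‖ₑ) := by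
  set U : G → Lp ℝ 2 P := fun s => proj (hZ.memLp (s + a)) u
  set V : G → Lp ℝ 2 P := fun s => proj (hZ.memLp (s + b)) v
  have hU : ∀ s, U s ∈ M := fun s => hZ.proj_mem _ _
  have hV : ∀ s, V s ∈ M := fun s => hZ.proj_mem _ _
  have h1 : ∀ᵐ ω ∂P, inner ℝ u (noise Z C S a b ω v) =
      ∑ s ∈ S, (U s ω * V s ω - inner ℝ (U s) (V s)) := by
    filter_upwards [(eventually_all_finset S).2 fun s _ => coeFn_proj (hZ.memLp (s + a)) u,
      (eventually_all_finset S).2 fun s _ => coeFn_proj (hZ.memLp (s + b)) v] with ω hu hv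
    simp only [noise, sum_apply, inner_sum, sub_apply,
      inner_sub_right, InnerProductSpace.rankOne_apply, real_inner_smul_right]
    refine Finset.sum_congr rfl fun s hs => ?_
    simp only [U, V, hZ.cov, add_sub_add_left_eq_sub]
    rw [hu s hs, hv s hs, real_inner_comm v, mul_comm]
  calc ∫⁻ ω, ‖inner ℝ u (noise Z C S a b ω v)‖ₑ ^ 2 ∂P
      = ∫⁻ ω, ENNReal.ofReal ((∑ s ∈ S, (U s ω * V s ω - inner ℝ (U s) (V s))) ^ 2) ∂P := by
        refine lintegral_congr_ae ?_
        filter_upwards [h1] with ω hω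
        rw [hω, enorm_sq_eq_ofReal, Real.norm_eq_abs, sq_abs]
    _ = ENNReal.ofReal (∑ s ∈ S, ∑ t ∈ S, (inner ℝ (U s) (U t) * inner ℝ (V s) (V t)
        + inner ℝ (U s) (V t) * inner ℝ (V s) (U t))) := by
        rw [← ofReal_integral_eq_lintegral_ofReal (integrable_sq_sum_mul_sub hM S hU hV)
          (ae_of_all _ fun ω => sq_nonneg _), integral_sq_sum_mul_sub hM S hU hV]
    _ ≤ ∑ s ∈ S, ∑ t ∈ S, ‖inner ℝ (U s) (U t) * inner ℝ (V s) (V t)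
        + inner ℝ (U s) (V t) * inner ℝ (V s) (U t)‖ₑ := by
        refine (ENNReal.ofReal_le_ofReal (le_abs_self _)).trans ?_
        rw [← Real.norm_eq_abs, ofReal_norm]
        refine (enorm_sum_le _ _).trans (Finset.sum_le_sum fun s _ => enorm_sum_le _ _)
    _ ≤ _ := by
        refine Finset.sum_le_sum fun s _ => Finset.sum_le_sum fun t _ => ?_
        refine (enorm_add_le _ _).trans (le_of_eq ?_)
        rw [enorm_mul, enorm_mul]
        simp only [U, V, hZ.cov, add_sub_add_right_eq_sub]
        rw [show s + a - (t + b) = s - t + (a - b) by abel,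
          show s + b - (t + a) = s - t + (b - a) by abel]

/-- The mean square error of empirical covariance operators. -/
theorem IsStationaryIn.lintegral_enorm_noise_sq_le [CompleteSpace E]
    [TopologicalSpace.SeparableSpace E] (hM : ∀ f ∈ M, IsCenteredGaussian f)
    (hZ : IsStationaryIn M Z C) {ν : G → ℝ≥0∞} (hν : ∀ h, HasNuclearBound (C h) (ν h))
    (S : Finset G) (a b : G) :
    ∫⁻ ω, ‖noise Z C S a b ω‖ₑ ^ 2 ∂P ≤ 3 * (S.card * ∑' h, ν h ^ 2) := by
  obtain ⟨w, hw, ⟨e⟩⟩ := exists_countable_hilbertBasis E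
  have hmeas : ∀ i j, AEMeasurable (fun ω => ‖inner ℝ (e i) (noise Z C S a b ω (e j))‖ₑ ^ 2) P := by
    intro i j
    have := hZ.aestronglyMeasurable_noise S a b
    have h2 : AEStronglyMeasurable (fun ω => inner ℝ (e i) (noise Z C S a b ω (e j))) P := by
      have h3 : Continuous fun T : E →L[ℝ] E => inner ℝ (e i) (T (e j)) := by fun_prop
      exact h3.comp_aestronglyMeasurable this
    exact h2.enorm.pow_const 2
  calc ∫⁻ ω, ‖noise Z C S a b ω‖ₑ ^ 2 ∂P
      ≤ ∫⁻ ω, ∑' i, ∑' j, ‖inner ℝ (e i) (noise Z C S a b ω (e j))‖ₑ ^ 2 ∂P :=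
        lintegral_mono fun ω => enorm_sq_le_tsum_inner e _
    _ = ∑' i, ∑' j, ∫⁻ ω, ‖inner ℝ (e i) (noise Z C S a b ω (e j))‖ₑ ^ 2 ∂P := by
        rw [lintegral_tsum fun i => AEMeasurable.tsum fun j => hmeas i j]
        exact tsum_congr fun i => lintegral_tsum fun j => hmeas i j
    _ ≤ ∑' i, ∑' j, ∑ s ∈ S, ∑ t ∈ S,
        (‖inner ℝ (e i) (C (s - t) (e i))‖ₑ * ‖inner ℝ (e j) (C (s - t) (e j))‖ₑ +
        ‖inner ℝ (e i) (C (s - t + (a - b)) (e j))‖ₑ *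
          ‖inner ℝ (e j) (C (s - t + (b - a)) (e i))‖ₑ) :=
        ENNReal.tsum_le_tsum fun i => ENNReal.tsum_le_tsum fun j =>
          hZ.lintegral_inner_noise_sq_le hM S a b _ _
    _ = ∑ s ∈ S, ∑ t ∈ S, ∑' i, ∑' j,
        (‖inner ℝ (e i) (C (s - t) (e i))‖ₑ * ‖inner ℝ (e j) (C (s - t) (e j))‖ₑ +
        ‖inner ℝ (e i) (C (s - t + (a - b)) (e j))‖ₑ *
          ‖inner ℝ (e j) (C (s - t + (b - a)) (e i))‖ₑ) := by
        simp_rw [Summable.tsum_finsetSum fun _ _ => ENNReal.summable]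
    _ ≤ ∑ s ∈ S, ∑ t ∈ S, (ν (s - t + 0) ^ 2 + (ν (s - t + (a - b)) ^ 2
        + ν (s - t + (b - a)) ^ 2)) := by
        refine Finset.sum_le_sum fun s _ => Finset.sum_le_sum fun t _ => ?_
        simp_rw [ENNReal.tsum_add]
        refine add_le_add ?_ ?_
        · simp_rw [ENNReal.tsum_mul_left, ENNReal.tsum_mul_right]
          rw [pow_two, add_zero]
          exact mul_le_mul' ((hν _).tsum_diag_le e.orthonormal)
            ((hν _).tsum_diag_le e.orthonormal)
        · refine ((hν _).tsum_mul_le (hν _) e.orthonormal).trans ?_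
          -- The crossed pairing mixes two lags; the product is at most the larger square, hence at
          -- most the sum of the squares. With the direct pairing this makes three sums and the
          -- constant 3.
          rcases le_total (ν (s - t + (a - b))) (ν (s - t + (b - a))) with h | h
          · refine (mul_le_mul' h le_rfl).trans ?_
            rw [← pow_two]
            exact le_add_self
          · refine (mul_le_mul' le_rfl h).trans ?_
            rw [← pow_two]
            exact le_self_add
    _ ≤ 3 * (S.card * ∑' h, ν h ^ 2) := by
        simp_rw [Finset.sum_add_distrib]
        refine (add_le_add (sum_sum_enorm_sub_le S (fun h => ν h ^ 2) 0)
          (add_le_add (sum_sum_enorm_sub_le S (fun h => ν h ^ 2) (a - b))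
          (sum_sum_enorm_sub_le S (fun h => ν h ^ 2) (b - a)))).trans (le_of_eq ?_)
        ring

end Noise

/-! ### Perturbation of eigenvectors -/

section Perturbation

variable {H : Type*} [NormedAddCommGroup H] [InnerProductSpace ℂ H] {q : ℕ}

/-- The component of `x` orthogonal to the family `v`. -/
noncomputable def remainder (v : Fin q → H) (x : H) : H := x - ∑ i, inner ℂ (v i) x • v i

theorem inner_remainder {v : Fin q → H} (hv : Orthonormal ℂ v) (x : H) (i : Fin q) :
    inner ℂ (v i) (remainder v x) = 0 := by
  rw [remainder, inner_sub_right, hv.inner_right_fintype, sub_self]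

theorem norm_sq_eq_sum_add_remainder {v : Fin q → H} (hv : Orthonormal ℂ v) (x : H) :
    ‖x‖ ^ 2 = ∑ i, ‖inner ℂ (v i) x‖ ^ 2 + ‖remainder v x‖ ^ 2 := by
  have hx : x = ∑ i, inner ℂ (v i) x • v i + remainder v x := by rw [remainder]; abel
  have h0 : inner ℂ (∑ i, inner ℂ (v i) x • v i) (remainder v x) = 0 := by
    rw [sum_inner]
    refine Finset.sum_eq_zero fun i _ => ?_
    rw [inner_smul_left, inner_remainder hv, mul_zero]
  have h1 := norm_add_sq_eq_norm_sq_add_norm_sq_of_inner_eq_zero _ _ h0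
  rw [← hx, ← pow_two, ← pow_two, ← pow_two] at h1
  rw [h1, add_left_inj]
  have h2 := hv.inner_sum (fun i => inner ℂ (v i) x) (fun i => inner ℂ (v i) x) Finset.univ
  have h3 := inner_self_eq_norm_sq_to_K (𝕜 := ℂ) (∑ i, inner ℂ (v i) x • v i)
  rw [h2] at h3
  have h4 : ((∑ i, ‖inner ℂ (v i) x‖ ^ 2 : ℝ) : ℂ) = ((‖∑ i, inner ℂ (v i) x • v i‖ ^ 2 : ℝ) : ℂ) := by
    push_cast
    refine Eq.trans (Finset.sum_congr rfl fun i _ => ?_) h3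
    rw [Complex.conj_mul']
  exact_mod_cast h4.symm

variable {A : H →L[ℂ] H} {lam : ℕ → ℝ} {v : Fin q → H}

theorem inner_eigen (hA : (A : H →ₗ[ℂ] H).IsSymmetric) (he : ∀ i, A (v i) = (lam i : ℂ) • v i)
    (i : Fin q) (x : H) : inner ℂ (v i) (A x) = lam i * inner ℂ (v i) x := by
  have h := hA (v i) x
  simp only [ContinuousLinearMap.coe_coe] at h
  rw [← h, he, inner_smul_left, Complex.conj_ofReal]

/-- The span of the eigenvectors is invariant under the symmetric A, so the projection off it
commutes with A. The quadratic form therefore splits without cross terms. -/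
theorem remainder_apply (hA : (A : H →ₗ[ℂ] H).IsSymmetric)
    (he : ∀ i, A (v i) = (lam i : ℂ) • v i) (x : H) :
    remainder v (A x) = A (remainder v x) := by
  simp only [remainder, inner_eigen hA he, map_sub, map_sum, map_smul, he, smul_smul]
  congr 1
  refine Finset.sum_congr rfl fun i _ => ?_
  rw [mul_comm]

theorem re_inner_eq_sum_add_remainder (hA : (A : H →ₗ[ℂ] H).IsSymmetric) (hv : Orthonormal ℂ v)
    (he : ∀ i, A (v i) = (lam i : ℂ) • v i) (x : H) :
    (inner ℂ x (A x)).re = ∑ i : Fin q, lam i * ‖inner ℂ (v i) x‖ ^ 2 +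
      (inner ℂ (remainder v x) (A (remainder v x))).re := by
  have h1 : inner ℂ x (A x) = inner ℂ (∑ i, inner ℂ (v i) x • v i) (A x) +
      inner ℂ (remainder v x) (A x) := by
    rw [← inner_add_left]
    congr 1
    rw [remainder]; abel
  have h2 : inner ℂ (remainder v x) (A x) = inner ℂ (remainder v x) (A (remainder v x)) := by
    rw [← remainder_apply hA he]
    conv_rhs => rw [remainder.eq_1 v (A x)]
    rw [inner_sub_right, inner_sum, Finset.sum_eq_zero, sub_zero]
    intro i _
    rw [inner_smul_right, inner_eq_zero_symm.1 (inner_remainder hv x i), mul_zero]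
  rw [h1, h2, Complex.add_re, sum_inner, Complex.re_sum]
  congr 1
  refine Finset.sum_congr rfl fun i _ => ?_
  rw [inner_smul_left, inner_eigen hA he, mul_left_comm, Complex.conj_mul']
  norm_cast

/-- The Rayleigh quotient is at most `lam m` on the complement of the first `m` eigenvectors. -/
theorem re_inner_le_of_orthogonal (hA : (A : H →ₗ[ℂ] H).IsSymmetric) (hv : Orthonormal ℂ v)
    (he : ∀ i, A (v i) = (lam i : ℂ) • v i)
    (hord : ∀ i j, i ≤ j → j < q → lam j ≤ lam i)
    (hlead : ∀ x, (∀ i, inner ℂ (v i) x = 0) → ∀ j < q, (inner ℂ x (A x)).re ≤ lam j * ‖x‖ ^ 2)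
    {m : ℕ} (hm : m < q) {x : H} (hx : ∀ i : Fin q, (i : ℕ) < m → inner ℂ (v i) x = 0) :
    (inner ℂ x (A x)).re ≤ lam m * ‖x‖ ^ 2 := by
  rw [re_inner_eq_sum_add_remainder hA hv he, norm_sq_eq_sum_add_remainder hv x, mul_add,
    Finset.mul_sum]
  refine add_le_add (Finset.sum_le_sum fun i _ => ?_) (hlead _ (inner_remainder hv x) m hm)
  rcases lt_or_ge (i : ℕ) m with h | h
  · simp [hx i h]
  · exact mul_le_mul_of_nonneg_right (hord _ _ h i.2) (sq_nonneg _)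

/-- One half of Weyl's inequality. -/
theorem eigenvalue_le_add_norm_sub {q' : ℕ} {B : H →L[ℂ] H} {mu : ℕ → ℝ} {w : Fin q' → H}
    (hA : (A : H →ₗ[ℂ] H).IsSymmetric) (hv : Orthonormal ℂ v)
    (he : ∀ i, A (v i) = (lam i : ℂ) • v i)
    (hord : ∀ i j, i ≤ j → j < q → lam j ≤ lam i)
    (hlead : ∀ x, (∀ i, inner ℂ (v i) x = 0) → ∀ j < q, (inner ℂ x (A x)).re ≤ lam j * ‖x‖ ^ 2)
    (hB : (B : H →ₗ[ℂ] H).IsSymmetric) (hw : Orthonormal ℂ w)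
    (heB : ∀ i, B (w i) = (mu i : ℂ) • w i)
    (hordB : ∀ i j, i ≤ j → j < q' → mu j ≤ mu i)
    {m : ℕ} (hm : m < q) (hm' : m < q') : mu m ≤ lam m + ‖B - A‖ := by
  obtain ⟨a, ha, ha0⟩ : ∃ a : Fin (m + 1) → ℂ, (∀ i : Fin m, inner ℂ (v ⟨i, i.2.trans hm⟩)
      (∑ j : Fin (m + 1), a j • w ⟨j, by omega⟩) = 0) ∧ a ≠ 0 := by
    let T : (Fin (m + 1) → ℂ) →ₗ[ℂ] (Fin m → ℂ) :=
      { toFun := fun a i => inner ℂ (v ⟨i, i.2.trans hm⟩)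
          (∑ j : Fin (m + 1), a j • w ⟨j, by omega⟩)
        map_add' := by
          intro a b
          ext i
          simp [add_smul, Finset.sum_add_distrib]
        map_smul' := by
          intro c a
          ext i
          simp only [Pi.smul_apply, smul_eq_mul, RingHom.id_apply, mul_smul]
          rw [← Finset.smul_sum, inner_smul_right] }
    have hT : LinearMap.ker T ≠ ⊥ := LinearMap.ker_ne_bot_of_finrank_lt (by simp)
    obtain ⟨a, ha, ha0⟩ := Submodule.exists_mem_ne_zero_of_ne_bot hT
    exact ⟨a, fun i => congrFun (LinearMap.mem_ker.1 ha) i, ha0⟩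
  set x := ∑ j : Fin (m + 1), a j • w ⟨j, by omega⟩ with hxdef
  have hw' : Orthonormal ℂ (fun j : Fin (m + 1) => w ⟨j, by omega⟩) :=
    hw.comp _ fun i j h => by
      have := congrArg Fin.val h
      exact Fin.ext this
  have hcoef : ∀ j : Fin (m + 1), inner ℂ (w ⟨j, by omega⟩) x = a j := by
    intro j
    rw [hxdef]
    exact hw'.inner_right_fintype a j
  have hrem : remainder (fun j : Fin (m + 1) => w ⟨j, by omega⟩) x = 0 := by
    rw [remainder]
    simp_rw [hcoef]
    rw [hxdef, sub_self]
  have hnorm : ‖x‖ ^ 2 = ∑ j, ‖a j‖ ^ 2 := by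
    rw [norm_sq_eq_sum_add_remainder hw', hrem]
    simp [hcoef]
  have hpos : 0 < ‖x‖ ^ 2 := by
    rw [hnorm]
    obtain ⟨j, hj⟩ := Function.ne_iff.1 ha0
    refine Finset.sum_pos' (fun j _ => sq_nonneg _) ⟨j, Finset.mem_univ j, ?_⟩
    have : 0 < ‖a j‖ := norm_pos_iff.2 hj
    positivity
  have hlow : mu m * ‖x‖ ^ 2 ≤ (inner ℂ x (B x)).re := by
    rw [re_inner_eq_sum_add_remainder (lam := mu) hB hw' (fun j => heB ⟨j, by omega⟩), hrem, hnorm,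
      Finset.mul_sum]
    simp only [hcoef, map_zero, inner_zero_left, Complex.zero_re, add_zero]
    refine Finset.sum_le_sum fun j _ => ?_
    exact mul_le_mul_of_nonneg_right (hordB _ _ (by omega) hm') (sq_nonneg _)
  have hup : (inner ℂ x (A x)).re ≤ lam m * ‖x‖ ^ 2 :=
    re_inner_le_of_orthogonal hA hv he hord hlead hm fun i hi => ha ⟨i, hi⟩
  have hdiff : (inner ℂ x (B x)).re - (inner ℂ x (A x)).re ≤ ‖B - A‖ * ‖x‖ ^ 2 := by
    rw [← Complex.sub_re, ← inner_sub_right, ← sub_apply]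
    refine (Complex.re_le_norm _).trans ((norm_inner_le_norm _ _).trans ?_)
    have := (B - A).le_opNorm x
    nlinarith [norm_nonneg x]
  by_contra! hcon
  nlinarith

/-- A spectral gap bounds the resolvent on the complement of the eigenvector. -/
theorem gap_mul_norm_le (hA : (A : H →ₗ[ℂ] H).IsSymmetric) (hv : Orthonormal ℂ v)
    (he : ∀ i, A (v i) = (lam i : ℂ) • v i)
    (hord : ∀ i j, i ≤ j → j < q → lam j ≤ lam i)
    (hlead : ∀ x, (∀ i, inner ℂ (v i) x = 0) → ∀ j < q, (inner ℂ x (A x)).re ≤ lam j * ‖x‖ ^ 2)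
    {m : ℕ} (hm : m + 1 < q) {β : ℝ} (hβ : 0 < β) (hlo : β ≤ lam m - lam (m + 1))
    (hhi : 1 ≤ m → β ≤ lam (m - 1) - lam m) {w : H} (hw : inner ℂ (v ⟨m, by omega⟩) w = 0) :
    β * ‖w‖ ≤ ‖A w - (lam m : ℂ) • w‖ := by
  refine le_of_sq_le_sq ?_ (norm_nonneg _)
  rw [mul_pow, norm_sq_eq_sum_add_remainder hv w,
    norm_sq_eq_sum_add_remainder hv (A w - (lam m : ℂ) • w), mul_add, Finset.mul_sum]
  refine add_le_add (Finset.sum_le_sum fun i _ => ?_) ?_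
  · rw [inner_sub_right, inner_smul_right, inner_eigen hA he, ← sub_mul, norm_mul, mul_pow]
    by_cases him : (i : ℕ) = m
    · have : i = ⟨m, by omega⟩ := Fin.ext him
      simp [this, hw]
    refine mul_le_mul_of_nonneg_right ?_ (sq_nonneg _)
    rw [← Complex.ofReal_sub, Complex.norm_real, Real.norm_eq_abs, sq_abs]
    -- Indices below m are separated by the gap above `lam m`, those beyond m by the gap below it.
    rcases lt_or_gt_of_ne him with h | h
    · have h1 := hord i (m - 1) (by omega) (by omega)
      have h2 := hhi (by omega)
      nlinarith
    · have h1 := hord (m + 1) i (by omega) i.2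
      nlinarith
  · have hr : remainder v (A w - (lam m : ℂ) • w) =
        A (remainder v w) - (lam m : ℂ) • remainder v w := by
      rw [← remainder_apply hA he]
      simp only [remainder, inner_sub_right, inner_smul_right, sub_smul, Finset.sum_sub_distrib,
        mul_smul, smul_sub, ← Finset.smul_sum]
      abel
    rw [hr]
    set y := remainder v w
    have h1 := hlead y (inner_remainder hv w) (m + 1) hm
    -- Off all q eigenvectors the form of A is at most `lam (m + 1)`, so that of `lam m` - A is at
    -- least β; Cauchy–Schwarz converts this into a norm bound.
    have h2 : β * ‖y‖ ^ 2 ≤ ‖y‖ * ‖A y - (lam m : ℂ) • y‖ := by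
      have h3 : -(inner ℂ y (A y - (lam m : ℂ) • y)).re ≤ ‖y‖ * ‖A y - (lam m : ℂ) • y‖ := by
        refine (neg_le_abs _).trans ((Complex.abs_re_le_norm _).trans (norm_inner_le_norm _ _))
      have h4 : (inner ℂ y (A y - (lam m : ℂ) • y)).re =
          (inner ℂ y (A y)).re - lam m * ‖y‖ ^ 2 := by
        rw [inner_sub_right, inner_smul_right, Complex.sub_re, Complex.re_ofReal_mul,
          inner_self_eq_norm_sq_to_K]
        norm_cast
      nlinarith [sq_nonneg ‖y‖]
    rcases eq_or_lt_of_le (norm_nonneg y) with h0 | h0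
    · rw [← h0]
      simp
    · rw [← mul_pow]
      refine pow_le_pow_left₀ (by positivity) ?_ 2
      refine le_of_mul_le_mul_left ?_ h0
      nlinarith

end Perturbation

/-- The estimated eigenvector is close to the true one if the operators are close, the spectral
gaps are positive and the phases agree. -/
theorem norm_eigenvector_sub_le {A B : L2C →L[ℂ] L2C} {p m : ℕ} {lam mu : ℕ → ℝ}
    {v w : ℕ → L2C} (hA : IsLeadingEigensystem A (p + 1) lam v)
    (hB : IsLeadingEigensystem B p mu w) (hm : m < p) {β : ℝ} (hβ : 0 < β)
    (hlo : β ≤ lam m - lam (m + 1)) (hhi : 1 ≤ m → β ≤ lam (m - 1) - lam m)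
    (hre : 0 ≤ (inner ℂ (v m) (w m)).re) (him : (inner ℂ (v m) (w m)).im = 0) :
    ‖w m - v m‖ ≤ 4 / β * ‖B - A‖ := by
  have hAs : (A : L2C →ₗ[ℂ] L2C).IsSymmetric := hA.selfAdjoint.isSymmetric
  have hBs : (B : L2C →ₗ[ℂ] L2C).IsSymmetric := hB.selfAdjoint.isSymmetric
  have hAe : ∀ i : Fin (p + 1), A (v i) = (lam i : ℂ) • v i := fun i => hA.eigen i i.2
  have hBe : ∀ i : Fin p, B (w i) = (mu i : ℂ) • w i := fun i => hB.eigen i i.2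
  have hAl : ∀ x, (∀ i : Fin (p + 1), inner ℂ (v i) x = 0) → ∀ j < p + 1,
      (inner ℂ x (A x)).re ≤ lam j * ‖x‖ ^ 2 := fun x hx => hA.leading x fun i hi => hx ⟨i, hi⟩
  have hBl : ∀ x, (∀ i : Fin p, inner ℂ (w i) x = 0) → ∀ j < p,
      (inner ℂ x (B x)).re ≤ mu j * ‖x‖ ^ 2 := fun x hx => hB.leading x fun i hi => hx ⟨i, hi⟩
  have hvm : ‖v m‖ = 1 := hA.orthonormal.1 ⟨m, by omega⟩
  have hwm : ‖w m‖ = 1 := hB.orthonormal.1 ⟨m, hm⟩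
  have hW1 := eigenvalue_le_add_norm_sub hAs hA.orthonormal hAe hA.ordered hAl hBs hB.orthonormal
    hBe hB.ordered (m := m) (by omega) hm
  have hW2 := eigenvalue_le_add_norm_sub hBs hB.orthonormal hBe hB.ordered hBl hAs hA.orthonormal
    hAe hA.ordered (m := m) hm (by omega)
  rw [norm_sub_rev] at hW2
  set ε := ‖B - A‖ with hε
  set c : ℝ := (inner ℂ (v m) (w m)).re with hc
  have hcc : inner ℂ (v m) (w m) = (c : ℂ) := Complex.ext (by simp [hc]) (by simpa using him)
  set y := w m - (c : ℂ) • v m with hy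
  have hvv : inner ℂ (v m) (v m) = 1 := by rw [inner_self_eq_norm_sq_to_K, hvm]; simp
  have hyo : inner ℂ (v m) y = 0 := by
    rw [hy, inner_sub_right, inner_smul_right, hvv, hcc, mul_one, sub_self]
  have hgap : β * ‖y‖ ≤ ‖A y - (lam m : ℂ) • y‖ :=
    gap_mul_norm_le hAs hA.orthonormal hAe hA.ordered hAl (by omega) hβ hlo hhi hyo
  -- A - `lam m` kills `v m`, so only `w m` contributes, and A `w m` is rewritten through B. Both
  -- terms are bounded by ε, the first by Weyl's inequality.
  have hAy : A y - (lam m : ℂ) • y = ((mu m - lam m : ℝ) : ℂ) • w m - (B - A) (w m) := by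
    have h1 : A (v m) = (lam m : ℂ) • v m := hA.eigen m (by omega)
    have h2 : B (w m) = (mu m : ℂ) • w m := hB.eigen m hm
    rw [hy, map_sub, map_smul, h1, sub_apply, h2]
    push_cast
    module
  have hAy' : ‖A y - (lam m : ℂ) • y‖ ≤ 2 * ε := by
    rw [hAy]
    refine (norm_sub_le _ _).trans ?_
    have h1 := (B - A).le_opNorm (w m)
    rw [hwm, mul_one] at h1
    rw [norm_smul, hwm, mul_one, Complex.norm_real, Real.norm_eq_abs]
    have h2 : |mu m - lam m| ≤ ε := abs_le.2 ⟨by linarith, by linarith⟩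
    linarith
  have hyb : β * ‖y‖ ≤ 2 * ε := hgap.trans hAy'
  have horth : inner ℂ ((c : ℂ) • v m) y = 0 := by rw [inner_smul_left, hyo, mul_zero]
  have hpy : 1 = c ^ 2 + ‖y‖ ^ 2 := by
    have := norm_add_sq_eq_norm_sq_add_norm_sq_of_inner_eq_zero _ _ horth
    rw [hy, add_sub_cancel, hwm, ← hy, norm_smul, hvm, Complex.norm_real, Real.norm_eq_abs] at this
    nlinarith [sq_abs c]
  have hdiff : ‖w m - v m‖ ^ 2 = (1 - c) ^ 2 + ‖y‖ ^ 2 := by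
    have horth' : inner ℂ (((c - 1 : ℝ) : ℂ) • v m) y = 0 := by
      rw [inner_smul_left, hyo, mul_zero]
    have := norm_add_sq_eq_norm_sq_add_norm_sq_of_inner_eq_zero _ _ horth'
    have h1 : ((c - 1 : ℝ) : ℂ) • v m + y = w m - v m := by
      rw [hy]; push_cast; module
    rw [h1, norm_smul, hvm, Complex.norm_real, Real.norm_eq_abs] at this
    nlinarith [sq_abs (c - 1)]
  -- The phase condition gives 0 ≤ c ≤ 1, so (1 - c)² ≤ 1 - c² = ‖y‖². Without c ≥ 0 the vector `w
  -- m` could be near -`v m`.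
  have hle : ‖w m - v m‖ ≤ 2 * ‖y‖ := by
    refine le_of_sq_le_sq ?_ (by positivity)
    have hc1 : c ≤ 1 := by nlinarith [sq_nonneg ‖y‖]
    nlinarith [sq_nonneg ‖y‖]
  rw [div_mul_eq_mul_div, le_div_iff₀ hβ]
  nlinarith

/-! ### Fourier coefficients on the cube -/

section Fourier

variable {d : ℕ}

theorem character_add (h k : Fin d → ℤ) (θ : Fin d → ℝ) :
    character (h + k) θ = character h θ * character k θ := by
  rw [character, character, character, ← Complex.exp_add, ← mul_add, ← Complex.ofReal_add,
    ← Finset.sum_add_distrib]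
  congr 3
  refine Finset.sum_congr rfl fun i _ => ?_
  push_cast [Pi.add_apply]
  ring

theorem conj_character (h : Fin d → ℤ) (θ : Fin d → ℝ) :
    (starRingEnd ℂ) (character h θ) = character (-h) θ := by
  rw [character, character, ← Complex.exp_conj]
  congr 1
  simp

theorem norm_character (h : Fin d → ℤ) (θ : Fin d → ℝ) : ‖character h θ‖ = 1 := by
  rw [character, neg_mul, mul_comm, ← neg_mul, ← Complex.ofReal_neg, Complex.norm_exp_ofReal_mul_I]

theorem continuous_character (h : Fin d → ℤ) : Continuous (character h) := by
  unfold character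
  fun_prop

instance : IsFiniteMeasure (cubeMeasure d) := by
  refine ⟨?_⟩
  rw [Measure.restrict_apply_univ]
  exact isCompact_Icc.measure_lt_top

theorem cubeMeasure_eq_pi :
    cubeMeasure d = Measure.pi fun _ : Fin d => volume.restrict (Set.Icc (-Real.pi) Real.pi) := by
  rw [← Measure.restrict_pi_pi, ← volume_pi, Set.pi_univ_Icc]
  rfl

theorem integral_exp_int (k : ℤ) :
    ∫ x in Set.Icc (-Real.pi) Real.pi, Complex.exp (-Complex.I * ((k : ℝ) * x : ℝ)) =
      if k = 0 then (2 * Real.pi : ℂ) else 0 := by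
  rw [integral_Icc_eq_integral_Ioc,
    ← intervalIntegral.integral_of_le (by linarith [Real.pi_pos])]
  split_ifs with hk
  · subst hk
    simp
    ring
  · have hc : (-Complex.I * k : ℂ) ≠ 0 := by simp [hk]
    have : ∀ x : ℝ, Complex.exp (-Complex.I * ((k : ℝ) * x : ℝ)) =
        Complex.exp ((-Complex.I * k) * x) := by intro x; push_cast; ring_nf
    simp_rw [this]
    rw [integral_exp_mul_complex hc, div_eq_zero_iff]
    left
    rw [sub_eq_zero, Complex.exp_eq_exp_iff_exists_int]
    refine ⟨-k, ?_⟩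
    push_cast
    ring

theorem integral_character (h : Fin d → ℤ) :
    ∫ θ, character h θ ∂cubeMeasure d = if h = 0 then (((2 * Real.pi) ^ d : ℝ) : ℂ) else 0 := by
  rw [cubeMeasure_eq_pi]
  have h1 : ∀ θ : Fin d → ℝ, character h θ =
      ∏ i, Complex.exp (-Complex.I * ((h i : ℝ) * θ i : ℝ)) := by
    intro θ
    rw [character, ← Complex.exp_sum, ← Finset.mul_sum, Complex.ofReal_sum]
  simp_rw [h1]
  rw [integral_fintype_prod_eq_prod (f := fun i x =>
    Complex.exp (-Complex.I * ((h i : ℝ) * x : ℝ)))]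
  simp_rw [integral_exp_int]
  split_ifs with h0
  · subst h0
    simp
  · obtain ⟨i, hi⟩ := Function.ne_iff.1 h0
    exact Finset.prod_eq_zero (Finset.mem_univ i) (if_neg hi)

theorem two_pi_pow_pos : 0 < (2 * Real.pi) ^ d := by positivity

theorem integrable_character_smul (l : Fin d → ℤ) {f : (Fin d → ℝ) → L2C}
    (hf : Integrable f (cubeMeasure d)) :
    Integrable (fun θ => character l θ • f θ) (cubeMeasure d) := by
  refine hf.bdd_smul 1 (continuous_character l).aestronglyMeasurable ?_
  exact ae_of_all _ fun θ => (norm_character l θ).le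

theorem integral_character_smul (l : Fin d → ℤ) (f : (Fin d → ℝ) → L2C) :
    ∫ θ, character l θ • f θ ∂cubeMeasure d = (((2 * Real.pi) ^ d : ℝ) : ℂ) • filterCoeff f l := by
  rw [filterCoeff, smul_smul, mul_inv_cancel₀, one_smul]
  exact_mod_cast two_pi_pow_pos.ne'

/-- The trigonometric polynomial with coefficients `c`. -/
noncomputable def trigPoly (F : Finset (Fin d → ℤ)) (c : (Fin d → ℤ) → L2C) (θ : Fin d → ℝ) : L2C :=
  ∑ u ∈ F, character (-u) θ • c u

theorem continuous_trigPoly (F : Finset (Fin d → ℤ)) (c : (Fin d → ℤ) → L2C) :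
    Continuous (trigPoly F c) := by
  unfold trigPoly
  exact continuous_finsetSum _ fun u _ => (continuous_character _).smul continuous_const

theorem norm_trigPoly_le (F : Finset (Fin d → ℤ)) (c : (Fin d → ℤ) → L2C) (θ : Fin d → ℝ) :
    ‖trigPoly F c θ‖ ≤ ∑ u ∈ F, ‖c u‖ := by
  refine (norm_sum_le _ _).trans (Finset.sum_le_sum fun u _ => ?_)
  rw [norm_smul, norm_character, one_mul]

theorem integrable_trigPoly (F : Finset (Fin d → ℤ)) (c : (Fin d → ℤ) → L2C) :
    Integrable (trigPoly F c) (cubeMeasure d) :=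
  Integrable.of_bound (continuous_trigPoly F c).aestronglyMeasurable _
    (ae_of_all _ (norm_trigPoly_le F c))

theorem filterCoeff_trigPoly {F : Finset (Fin d → ℤ)} (c : (Fin d → ℤ) → L2C) {l : Fin d → ℤ}
    (hl : l ∈ F) : filterCoeff (trigPoly F c) l = c l := by
  have h1 : ∫ θ, character l θ • trigPoly F c θ ∂cubeMeasure d =
      (((2 * Real.pi) ^ d : ℝ) : ℂ) • c l := by
    have h2 : ∀ θ, character l θ • trigPoly F c θ = ∑ u ∈ F, character (l - u) θ • c u := by
      intro θ
      rw [trigPoly, Finset.smul_sum]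
      refine Finset.sum_congr rfl fun u _ => ?_
      rw [smul_smul, ← character_add, sub_eq_add_neg]
    simp_rw [h2]
    have h3 : ∀ u, Integrable (character (u : Fin d → ℤ)) (cubeMeasure d) := fun u =>
      Integrable.of_bound (continuous_character u).aestronglyMeasurable 1
        (ae_of_all _ fun θ => (norm_character u θ).le)
    rw [integral_finsetSum _ fun u _ => (h3 (l - u)).smul_const (c u)]
    simp_rw [integral_smul_const, integral_character, sub_eq_zero]
    simp [hl]
  rw [integral_character_smul] at h1
  exact smul_right_injective _ (by exact_mod_cast two_pi_pow_pos.ne') h1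

theorem integral_inner_trigPoly (F : Finset (Fin d → ℤ)) (c : (Fin d → ℤ) → L2C)
    {f : (Fin d → ℝ) → L2C} (hf : Integrable f (cubeMeasure d)) :
    ∫ θ, inner ℂ (trigPoly F c θ) (f θ) ∂cubeMeasure d =
      (((2 * Real.pi) ^ d : ℝ) : ℂ) * ∑ u ∈ F, inner ℂ (c u) (filterCoeff f u) := by
  have h1 : ∀ θ, inner ℂ (trigPoly F c θ) (f θ) = ∑ u ∈ F, inner ℂ (c u) (character u θ • f θ) := by
    intro θ
    rw [trigPoly, sum_inner]
    refine Finset.sum_congr rfl fun u _ => ?_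
    rw [inner_smul_left, inner_smul_right, conj_character, neg_neg]
  simp_rw [h1]
  rw [integral_finsetSum _ fun u _ => (integrable_character_smul u hf).const_inner (c u),
    Finset.mul_sum]
  refine Finset.sum_congr rfl fun u _ => ?_
  rw [integral_inner (integrable_character_smul u hf), integral_character_smul, inner_smul_right]

/-- Bessel's inequality for the filter coefficients of a bounded function. -/
theorem sum_norm_filterCoeff_sq_le {f : (Fin d → ℝ) → L2C}
    (hf : AEStronglyMeasurable f (cubeMeasure d)) {B : ℝ}
    (hB : ∀ᵐ θ ∂cubeMeasure d, ‖f θ‖ ≤ B) (F : Finset (Fin d → ℤ)) :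
    ∑ u ∈ F, ‖filterCoeff f u‖ ^ 2 ≤ ((2 * Real.pi) ^ d)⁻¹ * ∫ θ, ‖f θ‖ ^ 2 ∂cubeMeasure d := by
  set c := filterCoeff f
  set g := trigPoly F c
  have hfi : Integrable f (cubeMeasure d) := Integrable.of_bound hf B hB
  have hgi : Integrable g (cubeMeasure d) := integrable_trigPoly F c
  have hgb : ∀ θ, ‖g θ‖ ≤ ∑ u ∈ F, ‖c u‖ := norm_trigPoly_le F c
  have hre : ∀ f' : (Fin d → ℝ) → L2C, Integrable f' (cubeMeasure d) →
      (∀ u ∈ F, filterCoeff f' u = c u) →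
      ∫ θ, (inner ℂ (g θ) (f' θ)).re ∂cubeMeasure d =
        (2 * Real.pi) ^ d * ∑ u ∈ F, ‖c u‖ ^ 2 := by
    intro f' hf' hc
    have hinteg : Integrable (fun θ => inner ℂ (g θ) (f' θ)) (cubeMeasure d) := by
      refine Integrable.mono' (hf'.norm.const_mul (∑ u ∈ F, ‖c u‖)) ?_
        (ae_of_all _ fun θ => ?_)
      · exact hgi.aestronglyMeasurable.inner hf'.aestronglyMeasurable
      · exact (norm_inner_le_norm _ _).trans
          (mul_le_mul_of_nonneg_right (hgb θ) (norm_nonneg _))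
    have h1 : ∫ θ, (inner ℂ (g θ) (f' θ)).re ∂cubeMeasure d =
        (∫ θ, inner ℂ (g θ) (f' θ) ∂cubeMeasure d).re := integral_re hinteg
    rw [h1, integral_inner_trigPoly F c hf', Complex.re_ofReal_mul, Complex.re_sum]
    congr 1
    refine Finset.sum_congr rfl fun u hu => ?_
    rw [hc u hu, inner_self_eq_norm_sq_to_K]
    norm_cast
  have h1 := hre f hfi fun u _ => rfl
  have h2 := hre g hgi fun u hu => filterCoeff_trigPoly c hu
  -- This expands 0 ≤ ‖g - f‖². Since f and its partial Fourier sum g share the coefficients in F,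
  -- both inner products integrate to (2π)^d ∑ ‖c u‖², and 2 - 1 = 1 copy remains.
  have hpt : ∀ θ, 2 * (inner ℂ (g θ) (f θ)).re - (inner ℂ (g θ) (g θ)).re ≤ ‖f θ‖ ^ 2 := by
    intro θ
    have h3 := norm_sub_sq (𝕜 := ℂ) (g θ) (f θ)
    have h4 : (inner ℂ (g θ) (g θ)).re = ‖g θ‖ ^ 2 := by
      rw [inner_self_eq_norm_sq_to_K]; norm_cast
    have h5 : RCLike.re (inner ℂ (g θ) (f θ)) = (inner ℂ (g θ) (f θ)).re := rfl
    rw [h5] at h3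
    nlinarith [sq_nonneg ‖g θ - f θ‖]
  have hi1 : Integrable (fun θ => (inner ℂ (g θ) (f θ)).re) (cubeMeasure d) := by
    refine Integrable.mono' (hfi.norm.const_mul (∑ u ∈ F, ‖c u‖)) ?_ (ae_of_all _ fun θ => ?_)
    · exact Complex.continuous_re.comp_aestronglyMeasurable
        (AEStronglyMeasurable.inner (𝕜 := ℂ) hgi.aestronglyMeasurable hf)
    · exact (Complex.abs_re_le_norm _).trans ((norm_inner_le_norm _ _).trans
        (mul_le_mul_of_nonneg_right (hgb θ) (norm_nonneg _)))
  have hi2 : Integrable (fun θ => (inner ℂ (g θ) (g θ)).re) (cubeMeasure d) := by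
    refine Integrable.mono' (hgi.norm.const_mul (∑ u ∈ F, ‖c u‖)) ?_ (ae_of_all _ fun θ => ?_)
    · exact Complex.continuous_re.comp_aestronglyMeasurable
        (AEStronglyMeasurable.inner (𝕜 := ℂ) hgi.aestronglyMeasurable hgi.aestronglyMeasurable)
    · exact (Complex.abs_re_le_norm _).trans ((norm_inner_le_norm _ _).trans
        (mul_le_mul_of_nonneg_right (hgb θ) (norm_nonneg _)))
  have hi3 : Integrable (fun θ => ‖f θ‖ ^ 2) (cubeMeasure d) := by
    refine Integrable.of_bound (hf.norm.pow 2) (B ^ 2) ?_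
    filter_upwards [hB] with θ hθ
    rw [norm_pow, norm_norm]
    exact pow_le_pow_left₀ (norm_nonneg _) hθ 2
  have h3 := integral_mono ((hi1.const_mul 2).sub hi2) hi3 hpt
  have h4 : ∫ θ, (2 * (inner ℂ (g θ) (f θ)).re - (inner ℂ (g θ) (g θ)).re) ∂cubeMeasure d =
      (2 * Real.pi) ^ d * ∑ u ∈ F, ‖c u‖ ^ 2 := by
    rw [integral_sub (hi1.const_mul 2) hi2, integral_const_mul, h1, h2]
    ring
  rw [inv_mul_eq_div, le_div_iff₀ two_pi_pow_pos, mul_comm, ← h4]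
  exact h3

theorem integral_norm_sum_character_sq (S : Finset (Fin d → ℤ)) (a : (Fin d → ℤ) → ℝ) :
    ∫ θ, ‖∑ s ∈ S, (a s : ℂ) * character s θ‖ ^ 2 ∂cubeMeasure d =
      (2 * Real.pi) ^ d * ∑ s ∈ S, a s ^ 2 := by
  have h1 : ∀ θ : Fin d → ℝ, ((‖∑ s ∈ S, (a s : ℂ) * character s θ‖ ^ 2 : ℝ) : ℂ) =
      ∑ s ∈ S, ∑ t ∈ S, (a s * a t : ℂ) * character (s - t) θ := by
    intro θ
    push_cast
    rw [← Complex.mul_conj', map_sum, Finset.sum_mul_sum]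
    refine Finset.sum_congr rfl fun s _ => Finset.sum_congr rfl fun t _ => ?_
    rw [map_mul, conj_character, Complex.conj_ofReal, sub_eq_add_neg, character_add]
    ring
  have h3 : ∀ u, Integrable (character (u : Fin d → ℤ)) (cubeMeasure d) := fun u =>
    Integrable.of_bound (continuous_character u).aestronglyMeasurable 1
      (ae_of_all _ fun θ => (norm_character u θ).le)
  have h2 : ((∫ θ, ‖∑ s ∈ S, (a s : ℂ) * character s θ‖ ^ 2 ∂cubeMeasure d : ℝ) : ℂ) =
      (((2 * Real.pi) ^ d * ∑ s ∈ S, a s ^ 2 : ℝ) : ℂ) := by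
    rw [← integral_complex_ofReal]
    simp_rw [h1]
    rw [integral_finsetSum _ fun s _ => integrable_finsetSum _ fun t _ =>
      (h3 (s - t)).const_mul _]
    simp_rw [integral_finsetSum S fun t _ => (h3 (_ - t)).const_mul _, integral_const_mul,
      integral_character, sub_eq_zero]
    push_cast
    rw [Finset.mul_sum]
    refine Finset.sum_congr rfl fun s hs => ?_
    simp [hs]
    ring
  exact_mod_cast h2

/-- Multiplication by a trigonometric polynomial in the frequency domain is convolution of the
coefficients. -/
theorem filterCoeff_mul_character (S : Finset (Fin d → ℤ)) (a : (Fin d → ℤ) → ℝ)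
    {f : (Fin d → ℝ) → L2C} (hf : Integrable f (cubeMeasure d)) (u : Fin d → ℤ) :
    filterCoeff (fun θ => (∑ s ∈ S, (a s : ℂ) * character s θ) • f θ) u =
      ∑ s ∈ S, (a s : ℂ) • filterCoeff f (s + u) := by
  have h1 : ∀ θ, character u θ • (∑ s ∈ S, (a s : ℂ) * character s θ) • f θ =
      ∑ s ∈ S, (a s : ℂ) • (character (s + u) θ • f θ) := by
    intro θ
    rw [smul_smul, Finset.mul_sum, Finset.sum_smul]
    refine Finset.sum_congr rfl fun s _ => ?_
    rw [smul_smul, character_add]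
    congr 1
    ring
  rw [filterCoeff]
  simp_rw [h1]
  have h2 : ∀ s, Integrable (fun θ => (a s : ℂ) • (character (s + u) θ • f θ)) (cubeMeasure d) :=
    fun s => (integrable_character_smul (s + u) hf).smul (a s : ℂ)
  rw [integral_finsetSum _ fun s _ => h2 s, Finset.smul_sum]
  refine Finset.sum_congr rfl fun s _ => ?_
  rw [integral_smul, smul_comm]
  rfl

/-- Convolution with the filter coefficients of a function bounded by one is a contraction of
`ℓ²`. -/
theorem sum_norm_conv_filterCoeff_sq_le {f : (Fin d → ℝ) → L2C}
    (hf : AEStronglyMeasurable f (cubeMeasure d)) (hB : ∀ᵐ θ ∂cubeMeasure d, ‖f θ‖ ≤ 1)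
    (S F : Finset (Fin d → ℤ)) (a : (Fin d → ℤ) → ℝ) :
    ∑ u ∈ F, ‖∑ s ∈ S, (a s : ℂ) • filterCoeff f (s + u)‖ ^ 2 ≤ ∑ s ∈ S, a s ^ 2 := by
  have hfi : Integrable f (cubeMeasure d) := Integrable.of_bound hf 1 hB
  have hk : Continuous fun θ : Fin d → ℝ => ∑ s ∈ S, (a s : ℂ) * character s θ :=
    continuous_finsetSum _ fun s _ => continuous_const.mul (continuous_character s)
  have hkb : ∀ θ : Fin d → ℝ, ‖∑ s ∈ S, (a s : ℂ) * character s θ‖ ≤ ∑ s ∈ S, |a s| := by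
    intro θ
    refine (norm_sum_le _ _).trans (Finset.sum_le_sum fun s _ => ?_)
    rw [norm_mul, norm_character, mul_one, Complex.norm_real, Real.norm_eq_abs]
  have hle : ∀ᵐ θ ∂cubeMeasure d, ‖(∑ s ∈ S, (a s : ℂ) * character s θ) • f θ‖ ≤
      ‖∑ s ∈ S, (a s : ℂ) * character s θ‖ := by
    filter_upwards [hB] with θ hθ
    rw [norm_smul]
    exact mul_le_of_le_one_right (norm_nonneg _) hθ
  -- Bessel's inequality for the product of the trigonometric polynomial with f, whose norm is
  -- pointwise at most that of the polynomial.
  have h1 := sum_norm_filterCoeff_sq_le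
    (f := fun θ => (∑ s ∈ S, (a s : ℂ) * character s θ) • f θ) (hk.aestronglyMeasurable.smul hf)
    (hle.mono fun θ h => h.trans (hkb θ)) F
  simp_rw [filterCoeff_mul_character S a hfi] at h1
  refine h1.trans ?_
  rw [inv_mul_le_iff₀ two_pi_pow_pos, ← integral_norm_sum_character_sq]
  refine integral_mono_ae ?_ ?_ ?_
  · refine Integrable.of_bound ((hk.aestronglyMeasurable.smul hf).norm.pow 2)
      ((∑ s ∈ S, |a s|) ^ 2) ?_
    filter_upwards [hle] with θ h
    rw [norm_pow, norm_norm]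
    exact pow_le_pow_left₀ (norm_nonneg _) (h.trans (hkb θ)) 2
  · refine Integrable.of_bound (hk.norm.pow 2).aestronglyMeasurable ((∑ s ∈ S, |a s|) ^ 2)
      (ae_of_all _ fun θ => ?_)
    rw [norm_pow, norm_norm]
    exact pow_le_pow_left₀ (norm_nonneg _) (hkb θ) 2
  · filter_upwards [hle] with θ h
    exact pow_le_pow_left₀ (norm_nonneg _) h 2

/-- Filter coefficients are close if the functions are close in `L¹`. -/
theorem enorm_filterCoeff_sub_le {f g : (Fin d → ℝ) → L2C} (hf : Integrable f (cubeMeasure d))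
    (hg : Integrable g (cubeMeasure d)) (l : Fin d → ℤ) :
    ‖filterCoeff f l - filterCoeff g l‖ₑ ≤ ∫⁻ θ, ‖f θ - g θ‖ₑ ∂cubeMeasure d := by
  rw [filterCoeff, filterCoeff, ← smul_sub,
    ← integral_sub (integrable_character_smul l hf) (integrable_character_smul l hg), enorm_smul]
  have h1 : ‖(((2 * Real.pi) ^ d : ℝ) : ℂ)⁻¹‖ₑ ≤ 1 := by
    rw [← ofReal_norm, ← ENNReal.ofReal_one]
    refine ENNReal.ofReal_le_ofReal ?_
    rw [norm_inv, Complex.norm_real, Real.norm_eq_abs, abs_of_pos two_pi_pow_pos]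
    refine inv_le_one_of_one_le₀ (one_le_pow₀ ?_)
    linarith [Real.pi_gt_three]
  refine (mul_le_of_le_one_left zero_le h1).trans ?_
  refine (enorm_integral_le_lintegral_enorm _).trans (lintegral_mono fun θ => ?_)
  rw [← smul_sub, enorm_smul, ← ofReal_norm (character l θ), norm_character]
  simp

end Fourier

/-! ### Filtered stationary fields -/

section Filtered

variable {Ω : Type*} [MeasurableSpace Ω] {P : Measure Ω} [IsProbabilityMeasure P]
variable {E : Type*} [NormedAddCommGroup E] [InnerProductSpace ℝ E]
variable {G : Type*} [AddCommGroup G]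

theorem proj_add {Z : Ω → E} (hZ : MemLp Z 2 P) (u v : E) :
    proj hZ (u + v) = proj hZ u + proj hZ v := by
  refine Lp.ext ?_
  filter_upwards [coeFn_proj hZ (u + v), coeFn_proj hZ u, coeFn_proj hZ v,
    Lp.coeFn_add (proj hZ u) (proj hZ v)] with ω h1 h2 h3 h4
  rw [h1, h4, Pi.add_apply, h2, h3, inner_add_left]

theorem proj_smul {Z : Ω → E} (hZ : MemLp Z 2 P) (c : ℝ) (u : E) :
    proj hZ (c • u) = c • proj hZ u := by
  refine Lp.ext ?_
  filter_upwards [coeFn_proj hZ (c • u), coeFn_proj hZ u, Lp.coeFn_smul c (proj hZ u)]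
    with ω h1 h2 h4
  rw [h1, h4, Pi.smul_apply, h2, real_inner_smul_left, smul_eq_mul]

theorem proj_sum_smul {Z : Ω → E} (hZ : MemLp Z 2 P) {ι : Type*} (S : Finset ι) (α : ι → ℝ)
    (u : ι → E) : proj hZ (∑ s ∈ S, α s • u s) = ∑ s ∈ S, α s • proj hZ (u s) := by
  let L : E →ₗ[ℝ] Lp ℝ 2 P :=
    { toFun := proj hZ, map_add' := proj_add hZ, map_smul' := proj_smul hZ }
  change L _ = ∑ s ∈ S, α s • L (u s)
  simp

variable {M : Submodule ℝ (Lp ℝ 2 P)} {X : G → Ω → E} {C : G → E →L[ℝ] E} {c : G → ℝ}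

/-- A linear functional of a field with summable covariances is bounded on `ℓ²`. -/
theorem IsStationaryIn.norm_sum_proj_sq_le (hX : IsStationaryIn M X C) (hc : Summable c)
    (hC : ∀ h, ‖C h‖ ≤ c h) {ι : Type*} (F : Finset ι) {σ : ι → G} (hσ : Function.Injective σ)
    (w : ι → E) :
    ‖∑ i ∈ F, proj (hX.memLp (σ i)) (w i)‖ ^ 2 ≤ (∑' h, c h) * ∑ i ∈ F, ‖w i‖ ^ 2 := by
  have hc0 : ∀ h, 0 ≤ c h := fun h => (norm_nonneg _).trans (hC h)
  rw [← real_inner_self_eq_norm_sq, sum_inner]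
  simp_rw [inner_sum, hX.cov]
  -- Schur's test: the arithmetic–geometric mean inequality decouples i and j, after which row and
  -- column sums of c are bounded by the total sum.
  have h1 : ∀ i j, inner ℝ (w i) (C (σ i - σ j) (w j)) ≤
      c (σ i - σ j) * ‖w i‖ ^ 2 / 2 + c (σ i - σ j) * ‖w j‖ ^ 2 / 2 := by
    intro i j
    have h2 : inner ℝ (w i) (C (σ i - σ j) (w j)) ≤ ‖w i‖ * (c (σ i - σ j) * ‖w j‖) := by
      refine (real_inner_le_norm _ _).trans ?_
      gcongr
      exact ((C (σ i - σ j)).le_opNorm _).trans (by gcongr; exact hC _)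
    nlinarith [mul_nonneg (hc0 (σ i - σ j)) (sq_nonneg (‖w i‖ - ‖w j‖))]
  have h3 : ∀ i, ∑ j ∈ F, c (σ i - σ j) ≤ ∑' h, c h := by
    intro i
    have hinj : Function.Injective fun j => σ i - σ j := fun j k h => hσ (by simpa using h)
    exact ((hc.comp_injective hinj).sum_le_tsum F fun _ _ => hc0 _).trans
      (Summable.tsum_le_tsum_of_inj _ hinj (fun h _ => hc0 h) (fun _ => le_rfl)
        (hc.comp_injective hinj) hc)
  have h4 : ∀ j, ∑ i ∈ F, c (σ i - σ j) ≤ ∑' h, c h := by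
    intro j
    have hinj : Function.Injective fun i => σ i - σ j := fun i k h => hσ (by simpa using h)
    exact ((hc.comp_injective hinj).sum_le_tsum F fun _ _ => hc0 _).trans
      (Summable.tsum_le_tsum_of_inj _ hinj (fun h _ => hc0 h) (fun _ => le_rfl)
        (hc.comp_injective hinj) hc)
  calc ∑ i ∈ F, ∑ j ∈ F, inner ℝ (w i) (C (σ i - σ j) (w j))
      ≤ ∑ i ∈ F, ∑ j ∈ F, (c (σ i - σ j) * ‖w i‖ ^ 2 / 2 + c (σ i - σ j) * ‖w j‖ ^ 2 / 2) :=
        Finset.sum_le_sum fun i _ => Finset.sum_le_sum fun j _ => h1 i j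
    _ = ∑ i ∈ F, (∑ j ∈ F, c (σ i - σ j)) * ‖w i‖ ^ 2 / 2
        + ∑ j ∈ F, (∑ i ∈ F, c (σ i - σ j)) * ‖w j‖ ^ 2 / 2 := by
        simp_rw [Finset.sum_add_distrib]
        congr 1
        · refine Finset.sum_congr rfl fun i _ => ?_
          rw [Finset.sum_mul, Finset.sum_div]
        · rw [Finset.sum_comm]
          refine Finset.sum_congr rfl fun i _ => ?_
          rw [Finset.sum_mul, Finset.sum_div]
    _ ≤ ∑ i ∈ F, (∑' h, c h) * ‖w i‖ ^ 2 / 2 + ∑ j ∈ F, (∑' h, c h) * ‖w j‖ ^ 2 / 2 := by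
        gcongr with i _ j _
        · exact h3 i
        · exact h4 j
    _ = (∑' h, c h) * ∑ i ∈ F, ‖w i‖ ^ 2 := by
        rw [Finset.mul_sum, ← Finset.sum_add_distrib]
        refine Finset.sum_congr rfl fun i _ => ?_
        ring

theorem IsStationaryIn.summable_proj (hX : IsStationaryIn M X C) (hc : Summable c)
    (hC : ∀ h, ‖C h‖ ≤ c h) {ι : Type*} {σ : ι → G} (hσ : Function.Injective σ)
    {w : ι → E} (hw : Summable fun i => ‖w i‖ ^ 2) :
    Summable fun i => proj (hX.memLp (σ i)) (w i) := by
  have hK : 0 ≤ ∑' h, c h := tsum_nonneg fun h => (norm_nonneg _).trans (hC h)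
  rw [summable_iff_vanishing_norm]
  intro ε hε
  obtain ⟨s, hs⟩ := summable_iff_vanishing_norm.1 hw (ε ^ 2 / (∑' h, c h + 1)) (by positivity)
  refine ⟨s, fun t ht => ?_⟩
  have h1 := hX.norm_sum_proj_sq_le hc hC t hσ w
  have h2 := hs t ht
  rw [Real.norm_eq_abs, abs_of_nonneg (Finset.sum_nonneg fun i _ => sq_nonneg _),
    lt_div_iff₀ (by positivity)] at h2
  have h0 : 0 ≤ ∑ i ∈ t, ‖w i‖ ^ 2 := Finset.sum_nonneg fun i _ => sq_nonneg _
  refine lt_of_pow_lt_pow_left₀ 2 hε.le ?_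
  nlinarith

theorem IsStationaryIn.norm_tsum_proj_sq_le (hX : IsStationaryIn M X C) (hc : Summable c)
    (hC : ∀ h, ‖C h‖ ≤ c h) {ι : Type*} {σ : ι → G} (hσ : Function.Injective σ)
    {w : ι → E} {B : ℝ} (hw : ∀ F : Finset ι, ∑ i ∈ F, ‖w i‖ ^ 2 ≤ B) :
    ‖∑' i, proj (hX.memLp (σ i)) (w i)‖ ^ 2 ≤ (∑' h, c h) * B := by
  have hK : 0 ≤ ∑' h, c h := tsum_nonneg fun h => (norm_nonneg _).trans (hC h)
  have hs : Summable fun i => ‖w i‖ ^ 2 :=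
    summable_of_sum_le (fun i => sq_nonneg _) hw
  have h1 : Tendsto (fun F : Finset ι => ‖∑ i ∈ F, proj (hX.memLp (σ i)) (w i)‖ ^ 2) atTop
      (𝓝 (‖∑' i, proj (hX.memLp (σ i)) (w i)‖ ^ 2)) :=
    ((hX.summable_proj hc hC hσ hs).hasSum.norm).pow 2
  refine le_of_tendsto h1 (Eventually.of_forall fun F => ?_)
  exact (hX.norm_sum_proj_sq_le hc hC F hσ w).trans (mul_le_mul_of_nonneg_left (hw F) hK)

/-- The field `∑_l ⟨a_l, X_{s-l}⟩`. -/
noncomputable def filtered (hX : IsStationaryIn M X C) (a : G → E) (s : G) : Lp ℝ 2 P :=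
  ∑' l, proj (hX.memLp (s - l)) (a l)

variable {a : G → E}

theorem IsStationaryIn.hasSum_filtered (hX : IsStationaryIn M X C) (hc : Summable c)
    (hC : ∀ h, ‖C h‖ ≤ c h) (ha : Summable fun l => ‖a l‖ ^ 2) (s : G) :
    HasSum (fun l => proj (hX.memLp (s - l)) (a l)) (filtered hX a s) :=
  (hX.summable_proj hc hC (σ := fun l => s - l) (fun l k h => by simpa using h) ha).hasSum

/-- Indexing by the site u = s - l of X lets combinations over several s be collected at each u. -/
theorem IsStationaryIn.hasSum_filtered_shift (hX : IsStationaryIn M X C) (hc : Summable c)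
    (hC : ∀ h, ‖C h‖ ≤ c h) (ha : Summable fun l => ‖a l‖ ^ 2) (s : G) :
    HasSum (fun u => proj (hX.memLp u) (a (s - u))) (filtered hX a s) := by
  have h := hX.hasSum_filtered hc hC ha s
  rw [← (Equiv.subLeft s).hasSum_iff] at h
  convert h using 2 with u
  simp

theorem IsStationaryIn.filtered_mem (hX : IsStationaryIn M X C) (hc : Summable c)
    (hC : ∀ h, ‖C h‖ ≤ c h) (ha : Summable fun l => ‖a l‖ ^ 2)
    (hM : IsClosed (M : Set (Lp ℝ 2 P))) (s : G) : filtered hX a s ∈ M :=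
  hM.mem_of_tendsto (hX.hasSum_filtered hc hC ha s)
    (Eventually.of_forall fun _ => M.sum_mem fun _ _ => hX.proj_mem _ _)

theorem IsStationaryIn.inner_filtered_proj (hX : IsStationaryIn M X C) (hc : Summable c)
    (hC : ∀ h, ‖C h‖ ≤ c h) (ha : Summable fun l => ‖a l‖ ^ 2) (s t : G) (x : E) :
    inner ℝ (filtered hX a s) (proj (hX.memLp t) x) =
      ∑' l, inner ℝ (a l) (C (s - t - l) x) := by
  have h := (hX.hasSum_filtered hc hC ha s).mapL
    ((innerSL ℝ).flip (proj (hX.memLp t) x))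
  simp only [ContinuousLinearMap.flip_apply, innerSL_apply_apply, hX.cov] at h
  rw [← h.tsum_eq]
  refine tsum_congr fun l => ?_
  rw [show s - t - l = s - l - t by abel]

theorem IsStationaryIn.inner_filtered_filtered (hX : IsStationaryIn M X C) (hc : Summable c)
    (hC : ∀ h, ‖C h‖ ≤ c h) (ha : Summable fun l => ‖a l‖ ^ 2) (s t : G) :
    inner ℝ (filtered hX a s) (filtered hX a t) =
      ∑' k, ∑' l, inner ℝ (a l) (C (s - t + k - l) (a k)) := by
  have h := (hX.hasSum_filtered hc hC ha t).mapL (innerSL ℝ (filtered hX a s))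
  simp only [innerSL_apply_apply, hX.inner_filtered_proj hc hC ha] at h
  rw [← h.tsum_eq]
  refine tsum_congr fun k => tsum_congr fun l => ?_
  rw [show s - t + k - l = s - (t - k) - l by abel]

/-- Truncating the filter changes the field by at most the tail of the filter. -/
theorem IsStationaryIn.norm_filtered_sub_sum_sq_le (hX : IsStationaryIn M X C) (hc : Summable c)
    (hC : ∀ h, ‖C h‖ ≤ c h) (ha : Summable fun l => ‖a l‖ ^ 2) (s : G) (F : Finset G) :
    ‖filtered hX a s - ∑ l ∈ F, proj (hX.memLp (s - l)) (a l)‖ ^ 2 ≤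
      (∑' h, c h) * ∑' l : {l // l ∉ F}, ‖a l‖ ^ 2 := by
  have hsum := hX.hasSum_filtered hc hC ha s
  have h1 := hsum.summable.sum_add_tsum_subtype_compl F
  rw [hsum.tsum_eq] at h1
  rw [← h1, add_sub_cancel_left]
  refine hX.norm_tsum_proj_sq_le hc hC (σ := fun l : {l // l ∉ F} => s - l)
    (fun l k h => Subtype.ext (by simpa using h)) (w := fun l : {l // l ∉ F} => a l) fun T => ?_
  exact (ha.subtype _).sum_le_tsum T fun _ _ => sq_nonneg _

/-- Collecting terms at each site, the coefficient of X_u is the convolution of α with the filter,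
whose ℓ² norm is at most that of α by `hconv`. This expresses that the spectral density of Y is
bounded, although the autocovariances of Y need not be summable. -/
theorem IsStationaryIn.norm_sum_smul_filtered_sq_le (hX : IsStationaryIn M X C) (hc : Summable c)
    (hC : ∀ h, ‖C h‖ ≤ c h) (ha : Summable fun l => ‖a l‖ ^ 2)
    (hconv : ∀ (S F : Finset G) (α : G → ℝ),
      ∑ u ∈ F, ‖∑ s ∈ S, α s • a (s + u)‖ ^ 2 ≤ ∑ s ∈ S, α s ^ 2)
    (S : Finset G) (α : G → ℝ) :
    ‖∑ s ∈ S, α s • filtered hX a s‖ ^ 2 ≤ (∑' h, c h) * ∑ s ∈ S, α s ^ 2 := by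
  classical
  have h1 : HasSum (fun u => proj (hX.memLp u) (∑ s ∈ S, α s • a (s - u)))
      (∑ s ∈ S, α s • filtered hX a s) := by
    simp_rw [proj_sum_smul]
    exact hasSum_sum fun s _ => (hX.hasSum_filtered_shift hc hC ha s).const_smul (α s)
  rw [← h1.tsum_eq]
  refine hX.norm_tsum_proj_sq_le hc hC (σ := id) Function.injective_id fun F => ?_
  -- The filter is evaluated at s - u here but at s + u in `hconv`, hence the reflection.
  have h2 := hconv S (F.map (Equiv.neg G).toEmbedding) α
  rw [Finset.sum_map] at h2
  simpa [sub_eq_add_neg] using h2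

end Filtered

/-! ### The joint field of scores and observations -/

section CrossCov

variable {Ω : Type*} [MeasurableSpace Ω] {P : Measure Ω} [IsProbabilityMeasure P]
variable {E : Type*} [NormedAddCommGroup E] [InnerProductSpace ℝ E] [CompleteSpace E]

theorem integrable_rankOne {𝕜 V : Type*} [RCLike 𝕜] [NormedAddCommGroup V]
    [InnerProductSpace 𝕜 V] {U W : Ω → V} (hU : MemLp U 2 P) (hW : MemLp W 2 P) :
    Integrable (fun ω => InnerProductSpace.rankOne 𝕜 (U ω) (W ω)) P := by
  have h1 : Integrable (fun ω => ‖U ω‖ * ‖W ω‖) P := hU.norm.integrable_mul hW.norm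
  refine h1.mono' (aestronglyMeasurable_rankOne hU.1 hW.1) (ae_of_all _ fun ω => ?_)
  rw [InnerProductSpace.norm_rankOne]

/-- The operator `E[⟨W, ·⟩ U]`. -/
noncomputable def crossCov (P : Measure Ω) (U W : Ω → E) : E →L[ℝ] E :=
  ∫ ω, InnerProductSpace.rankOne ℝ (U ω) (W ω) ∂P

theorem inner_crossCov {U W : Ω → E} (hU : MemLp U 2 P) (hW : MemLp W 2 P) (u v : E) :
    inner ℝ u (crossCov P U W v) = inner ℝ (proj hU u) (proj hW v) := by
  have h1 := integrable_rankOne (𝕜 := ℝ) hU hW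
  rw [crossCov, ContinuousLinearMap.integral_apply h1,
    ← integral_inner (h1.apply_continuousLinearMap v), inner_proj]
  refine integral_congr_ae (ae_of_all _ fun ω => ?_)
  simp only [InnerProductSpace.rankOne_apply, real_inner_smul_right]
  rw [real_inner_comm v, mul_comm]

end CrossCov

section NuclearMore

variable {E : Type*} [NormedAddCommGroup E] [InnerProductSpace ℝ E]

/-- Test the form with u = A v and cancel one factor ‖A v‖. -/
theorem HasNuclearBound.enorm_le {A : E →L[ℝ] E} {ν : ℝ≥0∞} (hA : HasNuclearBound A ν) :
    ‖A‖ₑ ≤ ν := by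
  by_cases hν : ν = ∞
  · rw [hν]; exact le_top
  obtain ⟨κ, x, y, h, hle⟩ := hA
  have hin : ∀ a b : E, ‖inner ℝ a b‖ₑ ≤ ‖a‖ₑ * ‖b‖ₑ := by
    intro a b
    rw [← ofReal_norm, ← ofReal_norm, ← ofReal_norm, ← ENNReal.ofReal_mul (norm_nonneg _)]
    exact ENNReal.ofReal_le_ofReal (norm_inner_le_norm _ _)
  have h1 : ∀ u v, ‖inner ℝ u (A v)‖ₑ ≤ ν * (‖u‖ₑ * ‖v‖ₑ) := by
    intro u v
    refine (h u v).trans ?_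
    refine le_trans ?_ (mul_le_mul' hle le_rfl)
    rw [← ENNReal.tsum_mul_right]
    refine ENNReal.tsum_le_tsum fun n => ?_
    refine (mul_le_mul' (hin _ _) (hin _ _)).trans (le_of_eq ?_)
    ring
  have h2 : ∀ v, ‖A v‖ ≤ ν.toReal * ‖v‖ := by
    intro v
    have h3 := ENNReal.toReal_mono (ENNReal.mul_ne_top hν (ENNReal.mul_ne_top (by simp) (by simp)))
      (h1 (A v) v)
    simp only [toReal_enorm, ENNReal.toReal_mul] at h3
    rw [real_inner_self_eq_norm_sq, Real.norm_eq_abs, abs_of_nonneg (sq_nonneg _)] at h3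
    rcases eq_or_lt_of_le (norm_nonneg (A v)) with h0 | h0
    · rw [← h0]; positivity
    · refine le_of_mul_le_mul_left ?_ h0
      nlinarith
  rw [← ofReal_norm]
  exact ENNReal.ofReal_le_of_le_toReal (A.opNorm_le_bound ENNReal.toReal_nonneg h2)

end NuclearMore

/-! ### Stationarity and nuclear covariances of the pair (Y, X). -/

section Pair

variable {Ω : Type*} [MeasurableSpace Ω] {P : Measure Ω} [IsProbabilityMeasure P]
variable {E : Type*} [NormedAddCommGroup E] [InnerProductSpace ℝ E] [CompleteSpace E]
variable {G : Type*} [AddCommGroup G]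
variable {M : Submodule ℝ (Lp ℝ 2 P)} {X : G → Ω → E} {C : G → E →L[ℝ] E} {c : G → ℝ} {a : G → E}

/-- The joint field `(Y_s, X_s)`, where `Y` is the filtered field. -/
noncomputable def pairField (hX : IsStationaryIn M X C) (a : G → E) (s : G) (ω : Ω) :
    WithLp 2 (ℝ × E) :=
  WithLp.toLp 2 (filtered hX a s ω, X s ω)

theorem IsStationaryIn.memLp_pairField (hX : IsStationaryIn M X C) (a : G → E) (s : G) :
    MemLp (pairField hX a s) 2 P := by
  have h1 := (Lp.memLp (filtered hX a s)).norm.add (hX.memLp s).norm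
  refine h1.mono ?_ (ae_of_all _ fun ω => ?_)
  · exact (WithLp.prod_continuous_toLp 2 ℝ E).comp_aestronglyMeasurable
      ((Lp.aestronglyMeasurable _).prodMk (hX.memLp s).1)
  · rw [Pi.add_apply, Real.norm_eq_abs _, abs_of_nonneg (by positivity)]
    refine le_of_sq_le_sq ?_ (by positivity)
    rw [WithLp.prod_norm_sq_eq_of_L2]
    have h2 : 0 ≤ ‖filtered hX a s ω‖ * ‖X s ω‖ := by positivity
    change ‖filtered hX a s ω‖ ^ 2 + ‖X s ω‖ ^ 2 ≤ _
    nlinarith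

theorem IsStationaryIn.proj_pairField (hX : IsStationaryIn M X C) (a : G → E) (s : G)
    (u : WithLp 2 (ℝ × E)) :
    proj (hX.memLp_pairField a s) u = u.fst • filtered hX a s + proj (hX.memLp s) u.snd := by
  refine Lp.ext ?_
  filter_upwards [coeFn_proj (hX.memLp_pairField a s) u, coeFn_proj (hX.memLp s) u.snd,
    Lp.coeFn_add (u.fst • filtered hX a s) (proj (hX.memLp s) u.snd),
    Lp.coeFn_smul u.fst (filtered hX a s)] with ω h1 h2 h3 h4
  rw [h1, h3, Pi.add_apply, h4, h2, WithLp.prod_inner_apply]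
  simp [pairField, mul_comm]

/-- The covariance operators of the joint field. -/
noncomputable def pairCov (hX : IsStationaryIn M X C) (a : G → E) (h : G) :
    WithLp 2 (ℝ × E) →L[ℝ] WithLp 2 (ℝ × E) :=
  crossCov P (pairField hX a h) (pairField hX a 0)

/-- Each of the four blocks of the covariance is a series depending on s and t only through s - t.
-/
theorem IsStationaryIn.pair (hX : IsStationaryIn M X C) (hc : Summable c)
    (hC : ∀ h, ‖C h‖ ≤ c h) (ha : Summable fun l => ‖a l‖ ^ 2)
    (hM : IsClosed (M : Set (Lp ℝ 2 P))) :
    IsStationaryIn M (pairField hX a) (pairCov hX a) where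
  memLp := hX.memLp_pairField a
  proj_mem s u := by
    rw [hX.proj_pairField]
    exact M.add_mem (M.smul_mem _ (hX.filtered_mem hc hC ha hM s)) (hX.proj_mem _ _)
  cov s t u v := by
    have h1 : ∀ (s t : G) (x : E), inner ℝ (proj (hX.memLp s) x) (filtered hX a t) =
        ∑' l, inner ℝ (a l) (C (t - s - l) x) := by
      intro s t x
      rw [real_inner_comm, hX.inner_filtered_proj hc hC ha]
    rw [pairCov, inner_crossCov (hX.memLp_pairField a (s - t)) (hX.memLp_pairField a 0)]
    simp only [hX.proj_pairField, inner_add_left, inner_add_right, real_inner_smul_left,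
      real_inner_smul_right, hX.inner_filtered_filtered hc hC ha,
      hX.inner_filtered_proj hc hC ha, h1, hX.cov, sub_zero, zero_sub, neg_sub]

theorem inner_pairCov_symm (hX : IsStationaryIn M X C) (hc : Summable c)
    (hC : ∀ h, ‖C h‖ ≤ c h) (ha : Summable fun l => ‖a l‖ ^ 2)
    (hM : IsClosed (M : Set (Lp ℝ 2 P))) (h : G) (u v : WithLp 2 (ℝ × E)) :
    inner ℝ u (pairCov hX a h v) = inner ℝ v (pairCov hX a (-h) u) := by
  have hp := hX.pair hc hC ha hM
  rw [← sub_zero h, ← hp.cov h 0, real_inner_comm, hp.cov, sub_zero, zero_sub]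

theorem norm_sum_proj_pairField_sq_le (hX : IsStationaryIn M X C) (hc : Summable c)
    (hC : ∀ h, ‖C h‖ ≤ c h) (ha : Summable fun l => ‖a l‖ ^ 2)
    (hconv : ∀ (S F : Finset G) (α : G → ℝ),
      ∑ u ∈ F, ‖∑ s ∈ S, α s • a (s + u)‖ ^ 2 ≤ ∑ s ∈ S, α s ^ 2)
    (F : Finset G) (w : G → WithLp 2 (ℝ × E)) :
    ‖∑ s ∈ F, proj (hX.memLp_pairField a s) (w s)‖ ^ 2 ≤
      2 * (∑' h, c h) * ∑ s ∈ F, ‖w s‖ ^ 2 := by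
  simp_rw [hX.proj_pairField, Finset.sum_add_distrib]
  have h1 := hX.norm_sum_smul_filtered_sq_le hc hC ha hconv F fun s => (w s).fst
  have h2 := hX.norm_sum_proj_sq_le hc hC F Function.injective_id fun s => (w s).snd
  have h3 : ∑ s ∈ F, ‖w s‖ ^ 2 = ∑ s ∈ F, (w s).fst ^ 2 + ∑ s ∈ F, ‖(w s).snd‖ ^ 2 := by
    rw [← Finset.sum_add_distrib]
    refine Finset.sum_congr rfl fun s _ => ?_
    rw [WithLp.prod_norm_sq_eq_of_L2, Real.norm_eq_abs, sq_abs]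
  simp only [id] at h2
  rw [h3]
  have h4 := norm_add_le (∑ s ∈ F, (w s).fst • filtered hX a s)
    (∑ s ∈ F, proj (hX.memLp s) (w s).snd)
  have h5 : ∀ x y z : ℝ, 0 ≤ z → z ≤ x + y → z ^ 2 ≤ 2 * (x ^ 2 + y ^ 2) := by
    intro x y z hz h
    nlinarith [sq_nonneg (x - y)]
  have h6 := h5 _ _ _ (norm_nonneg _) h4
  nlinarith

/-- Duality: the sum q equals the inner product of U = ∑ ⟨C_h v, Z_h⟩ with ⟨v, Z_0⟩, while the ℓ²
bound on linear forms gives ‖U‖² ≤ 2 (∑ c) q. Cauchy–Schwarz and cancelling q give the claim. -/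
theorem sum_norm_pairCov_sq_le (hX : IsStationaryIn M X C) (hc : Summable c)
    (hC : ∀ h, ‖C h‖ ≤ c h) (ha : Summable fun l => ‖a l‖ ^ 2)
    (hM : IsClosed (M : Set (Lp ℝ 2 P)))
    (hconv : ∀ (S F : Finset G) (α : G → ℝ),
      ∑ u ∈ F, ‖∑ s ∈ S, α s • a (s + u)‖ ^ 2 ≤ ∑ s ∈ S, α s ^ 2)
    (F : Finset G) (v : WithLp 2 (ℝ × E)) :
    ∑ h ∈ F, ‖pairCov hX a h v‖ ^ 2 ≤
      2 * (∑' h, c h) * ‖proj (hX.memLp_pairField a 0) v‖ ^ 2 := by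
  have hp := hX.pair hc hC ha hM
  set q := ∑ h ∈ F, ‖pairCov hX a h v‖ ^ 2 with hq
  have hq0 : 0 ≤ q := Finset.sum_nonneg fun _ _ => sq_nonneg _
  set U := ∑ h ∈ F, proj (hX.memLp_pairField a h) (pairCov hX a h v)
  have h1 : q = inner ℝ U (proj (hX.memLp_pairField a 0) v) := by
    rw [sum_inner, hq]
    refine Finset.sum_congr rfl fun h _ => ?_
    rw [hp.cov, sub_zero, real_inner_self_eq_norm_sq]
  have h2 : ‖U‖ ^ 2 ≤ 2 * (∑' h, c h) * q := norm_sum_proj_pairField_sq_le hX hc hC ha hconv F _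
  have h3 : q ≤ ‖U‖ * ‖proj (hX.memLp_pairField a 0) v‖ := h1 ▸ real_inner_le_norm _ _
  rcases eq_or_lt_of_le hq0 with h0 | h0
  · rw [← h0]
    have : 0 ≤ ∑' h, c h := tsum_nonneg fun h => (norm_nonneg _).trans (hC h)
    positivity
  refine le_of_mul_le_mul_left ?_ h0
  have h4 : q ^ 2 ≤ ‖U‖ ^ 2 * ‖proj (hX.memLp_pairField a 0) v‖ ^ 2 := by
    rw [← mul_pow]
    exact pow_le_pow_left₀ hq0 h3 2
  have h5 := mul_le_mul_of_nonneg_right h2 (sq_nonneg ‖proj (hX.memLp_pairField a 0) v‖)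
  nlinarith

/-- The vector `(1, 0)`, which selects the filtered field. -/
noncomputable def unitVec (E : Type*) [NormedAddCommGroup E] : WithLp 2 (ℝ × E) :=
  WithLp.toLp 2 (1, 0)

/-- The vector `(0, x)`. -/
noncomputable def inrVec (x : E) : WithLp 2 (ℝ × E) := WithLp.toLp 2 (0, x)

theorem norm_inrVec (x : E) : ‖inrVec x‖ = ‖x‖ := by
  have h : ‖inrVec x‖ ^ 2 = ‖x‖ ^ 2 := by
    rw [WithLp.prod_norm_sq_eq_of_L2]
    simp [inrVec]
  exact (sq_eq_sq₀ (norm_nonneg _) (norm_nonneg _)).1 h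

theorem eq_smul_unitVec_add_inrVec (u : WithLp 2 (ℝ × E)) :
    u = u.fst • unitVec E + inrVec u.snd := by
  refine (WithLp.equiv 2 (ℝ × E)).injective (Prod.ext ?_ ?_) <;> simp [unitVec, inrVec]

/-- In block form, the first row and the first column are one rank-one term each, and the remaining
block is `C h`. The column uses only the second component, so that the corner γ_h is counted once.
-/
theorem hasNuclearBound_pairCov (hX : IsStationaryIn M X C) (hc : Summable c)
    (hC : ∀ h, ‖C h‖ ≤ c h) (ha : Summable fun l => ‖a l‖ ^ 2)
    (hM : IsClosed (M : Set (Lp ℝ 2 P))) {h : G} {τ : ℝ≥0∞} (hτ : HasNuclearBound (C h) τ) :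
    HasNuclearBound (pairCov hX a h)
      (‖pairCov hX a (-h) (unitVec E)‖ₑ + ‖pairCov hX a h (unitVec E)‖ₑ + τ) := by
  have hp := hX.pair hc hC ha hM
  obtain ⟨κ, x, y, hxy, hle⟩ := hτ
  refine ⟨Bool ⊕ κ, Sum.elim (fun b => bif b then unitVec E
      else inrVec (pairCov hX a h (unitVec E)).snd) (fun n => inrVec (x n)),
    Sum.elim (fun b => bif b then pairCov hX a (-h) (unitVec E) else unitVec E)
      (fun n => inrVec (y n)), ?_, ?_⟩
  · intro u v
    rw [Summable.tsum_sum ENNReal.summable ENNReal.summable, tsum_bool]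
    simp only [Sum.elim_inl, Sum.elim_inr, cond_true, cond_false]
    have hu := eq_smul_unitVec_add_inrVec u
    have hv := eq_smul_unitVec_add_inrVec v
    have he : ∀ w : WithLp 2 (ℝ × E), inner ℝ (unitVec E) w = w.fst := by
      intro w
      simp [unitVec, WithLp.prod_inner_apply]
    have hr : ∀ (z : E) (w : WithLp 2 (ℝ × E)), inner ℝ (inrVec z) w = inner ℝ z w.snd := by
      intro z w
      simp [inrVec, WithLp.prod_inner_apply]
    have h3 : inner ℝ (inrVec u.snd) (pairCov hX a h (inrVec v.snd)) =
        inner ℝ u.snd (C h v.snd) := by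
      rw [← sub_zero h, ← hp.cov h 0, ← hX.cov h 0, hX.proj_pairField, hX.proj_pairField]
      simp [inrVec]
    have h4 : inner ℝ u (pairCov hX a h v) =
        inner ℝ (inrVec (pairCov hX a h (unitVec E)).snd) u * inner ℝ (unitVec E) v
        + inner ℝ (unitVec E) u * inner ℝ (pairCov hX a (-h) (unitVec E)) v
        + inner ℝ u.snd (C h v.snd) := by
      conv_lhs => rw [hu]
      rw [inner_add_left, real_inner_smul_left, inner_pairCov_symm hX hc hC ha hM,
        real_inner_comm _ v]
      conv_lhs => enter [2]; rw [hv]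
      rw [map_add, map_smul, inner_add_right, real_inner_smul_right, h3, he, he, hr, hr,
        real_inner_comm u.snd, real_inner_comm v]
      ring
    rw [h4]
    refine (enorm_add_le _ _).trans (add_le_add ((enorm_add_le _ _).trans (add_le_add ?_ ?_)) ?_)
    · rw [enorm_mul]
    · rw [enorm_mul]
    · simp_rw [hr]
      exact hxy _ _
  · rw [Summable.tsum_sum ENNReal.summable ENNReal.summable, tsum_bool]
    simp only [Sum.elim_inl, Sum.elim_inr, cond_true, cond_false]
    have hone : ‖unitVec E‖ₑ = 1 := by
      rw [← ofReal_norm]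
      have := WithLp.prod_norm_sq_eq_of_L2 (unitVec E)
      have h1 : ‖unitVec E‖ = 1 := by
        have h2 : ‖unitVec E‖ ^ 2 = 1 := by rw [this]; simp [unitVec]
        nlinarith [norm_nonneg (unitVec E)]
      rw [h1]; simp
    have hr : ∀ z : E, ‖inrVec z‖ₑ = ‖z‖ₑ := fun z => by
      rw [← ofReal_norm, norm_inrVec, ofReal_norm]
    have hs : ∀ w : WithLp 2 (ℝ × E), ‖w.snd‖ₑ ≤ ‖w‖ₑ := by
      intro w
      rw [← ofReal_norm, ← ofReal_norm]
      refine ENNReal.ofReal_le_ofReal (le_of_sq_le_sq ?_ (norm_nonneg _))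
      rw [WithLp.prod_norm_sq_eq_of_L2 w]
      exact le_add_of_nonneg_left (sq_nonneg _)
    simp_rw [hr, hone, one_mul, mul_one]
    refine add_le_add ?_ hle
    rw [add_comm]
    exact add_le_add le_rfl (hs _)

end Pair

/-! ### The Gaussian field `X` -/

/-- Instance search for separability of `L2R` passes through this fact. -/
instance : Fact ((2 : ℝ≥0∞) ≠ ∞) := ⟨by simp⟩

section RealPart

/-- The real part of a function. -/
noncomputable def reL : L2C →L[ℝ] L2R := Complex.reCLM.compLpL 2 unitMeasure

/-- The imaginary part of a function. -/
noncomputable def imL : L2C →L[ℝ] L2R := Complex.imCLM.compLpL 2 unitMeasure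

theorem norm_reL_le (ψ : L2C) : ‖reL ψ‖ ≤ ‖ψ‖ := by
  refine (Complex.reCLM.norm_compLp_le ψ).trans ?_
  simp

theorem norm_imL_le (ψ : L2C) : ‖imL ψ‖ ≤ ‖ψ‖ := by
  refine (Complex.imCLM.norm_compLp_le ψ).trans ?_
  simp

theorem integrable_mul_L2R (x y : L2R) : Integrable (fun t => x t * y t) unitMeasure :=
  (Lp.memLp x).integrable_mul (Lp.memLp y)

theorem inner_L2R (x y : L2R) : inner ℝ x y = ∫ t, x t * y t ∂unitMeasure := by
  rw [L2.inner_def]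
  simp [mul_comm]

theorem inner_toC (ψ : L2C) (x : L2R) :
    inner ℂ ψ (toC x) = (inner ℝ (reL ψ) x : ℂ) - (inner ℝ (imL ψ) x : ℂ) * Complex.I := by
  rw [L2.inner_def, inner_L2R, inner_L2R, ← integral_complex_ofReal, ← integral_complex_ofReal,
    ← integral_mul_const, ← integral_sub]
  · refine integral_congr_ae ?_
    filter_upwards [Complex.reCLM.coeFn_compLpL (p := 2) (μ := unitMeasure) ψ,
      Complex.imCLM.coeFn_compLpL (p := 2) (μ := unitMeasure) ψ,
      Complex.ofRealCLM.coeFn_compLpL (p := 2) (μ := unitMeasure) x] with t h1 h2 h3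
    rw [reL, imL, toC, h1, h2, h3]
    apply Complex.ext <;> simp <;> ring
  · exact (integrable_mul_L2R _ _).ofReal
  · exact ((integrable_mul_L2R _ _).ofReal).mul_const _

theorem reL_toC (x : L2R) : reL (toC x) = x := by
  refine Lp.ext ?_
  filter_upwards [Complex.reCLM.coeFn_compLpL (p := 2) (μ := unitMeasure) (toC x),
    Complex.ofRealCLM.coeFn_compLpL (p := 2) (μ := unitMeasure) x] with t h1 h3
  rw [reL, h1, toC, h3]
  simp

theorem imL_toC (x : L2R) : imL (toC x) = 0 := by
  refine Lp.ext ?_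
  filter_upwards [Complex.imCLM.coeFn_compLpL (p := 2) (μ := unitMeasure) (toC x),
    Complex.ofRealCLM.coeFn_compLpL (p := 2) (μ := unitMeasure) x,
    Lp.coeFn_zero ℝ 2 unitMeasure] with t h1 h3 h4
  rw [imL, h1, toC, h3, h4]
  simp

theorem inner_toC_toC (x y : L2R) : inner ℂ (toC x) (toC y) = (inner ℝ x y : ℂ) := by
  rw [inner_toC, reL_toC, imL_toC]
  simp

/-- For real x only the real part of the filter function matters, so the scores can be studied in
the real Hilbert space. -/
theorem pairing_eq_inner (ψ : L2C) (x : L2R) : pairing ψ x = inner ℝ (reL ψ) x := by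
  change (inner ℂ ψ (toC x)).re = _
  rw [inner_toC]
  simp

end RealPart

/-! ### The Gaussian space and the nuclear covariances generated by the field. -/

section FieldX

variable {Ω : Type*} [MeasurableSpace Ω] {P : Measure Ω} [IsProbabilityMeasure P] {d : ℕ}
variable {X : (Fin d → ℤ) → Ω → L2R}

theorem inner_covOp {U V : Ω → L2R} (hU : MemLp U 2 P) (hV : MemLp V 2 P)
    (hU0 : ∫ ω, U ω ∂P = 0) (hV0 : ∫ ω, V ω ∂P = 0) (x y : L2R) :
    inner ℂ (toC x) (covOp P U V (toC y)) = ((∫ ω, inner ℝ x (U ω) * inner ℝ y (V ω) ∂P : ℝ) : ℂ) := by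
  have hU' : MemLp (fun ω => toC (U ω)) 2 P := toC.comp_memLp' hU
  have hV' : MemLp (fun ω => toC (V ω)) 2 P := toC.comp_memLp' hV
  have h1 := integrable_rankOne (𝕜 := ℂ) hU' hV'
  rw [covOp, hU0, hV0]
  simp only [sub_zero]
  rw [ContinuousLinearMap.integral_apply h1,
    ← integral_inner (h1.apply_continuousLinearMap (toC y)), ← integral_complex_ofReal]
  refine integral_congr_ae (ae_of_all _ fun ω => ?_)
  simp only [InnerProductSpace.rankOne_apply, inner_smul_right, inner_toC_toC]
  rw [real_inner_comm y]
  push_cast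
  ring

/-- The Gaussian Hilbert space generated by the field. -/
noncomputable def gaussSpace (hX : ∀ s, MemLp (X s) 2 P) : Submodule ℝ (Lp ℝ 2 P) :=
  (Submodule.span ℝ (Set.range fun q : (Fin d → ℤ) × L2R => proj (hX q.1) q.2)).topologicalClosure

/-- A finite combination of projections is the sum of the coordinates of a Gaussian vector, and the
closure stays Gaussian because Gaussianity is a closed condition. -/
theorem isCenteredGaussian_of_mem_gaussSpace (hX : ∀ s, MemLp (X s) 2 P)
    (hgauss : IsGaussianField P X) (hmean : ∀ s, ∫ ω, X s ω ∂P = 0) :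
    ∀ f ∈ gaussSpace hX, IsCenteredGaussian f := by
  have hspan : (Submodule.span ℝ (Set.range fun q : (Fin d → ℤ) × L2R => proj (hX q.1) q.2) :
      Set (Lp ℝ 2 P)) ⊆ {f | IsCenteredGaussian f} := by
    intro f hf
    obtain ⟨c, rfl⟩ := Finsupp.mem_span_range_iff_exists_finsupp.1 hf
    let e := c.support.equivFin.symm
    let s : Fin c.support.card → Fin d → ℤ := fun i => (e i).1.1
    -- Absorbing the scalar coefficients into the test functions leaves a plain sum of coordinates.
    let v : Fin c.support.card → L2R := fun i => c (e i).1 • (e i).1.2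
    have hcoe : ∀ᵐ ω ∂P, (c.sum fun q r => r • proj (hX q.1) q.2 : Lp ℝ 2 P) ω =
        ∑ i, inner ℝ (X (s i) ω) (v i) := by
      have h1 : (c.sum fun q r => r • proj (hX q.1) q.2 : Lp ℝ 2 P) =
          ∑ i, proj (hX (s i)) (v i) := by
        rw [Finsupp.sum, ← Finset.sum_coe_sort, ← e.sum_comp]
        refine Finset.sum_congr rfl fun i _ => ?_
        rw [proj_smul]
      rw [h1]
      filter_upwards [coeFn_lp_sum Finset.univ fun i => proj (hX (s i)) (v i),
        ae_all_iff.2 fun i => coeFn_proj (hX (s i)) (v i)] with ω h2 h3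
      rw [h2]
      refine Finset.sum_congr rfl fun i _ => ?_
      rw [h3 i, real_inner_comm]
    have hlaw : HasGaussianLaw (fun ω => ∑ i, inner ℝ (X (s i) ω) (v i)) P :=
      (hgauss _ s v).fun_sum
    have hmem : MemLp (fun ω => ∑ i, inner ℝ (X (s i) ω) (v i)) 2 P :=
      memLp_finsetSum _ fun i _ => (hX (s i)).inner_const (v i)
    have h0 : ∫ ω, ∑ i, inner ℝ (X (s i) ω) (v i) ∂P = 0 := by
      rw [integral_finsetSum _ fun i _ =>
        ((hX (s i)).inner_const (𝕜 := ℝ) (v i)).integrable (by norm_num)]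
      refine Finset.sum_eq_zero fun i _ => ?_
      simp_rw [real_inner_comm (v i)]
      rw [integral_inner ((hX (s i)).integrable (by norm_num)), hmean, inner_zero_right]
    have heq : (c.sum fun q r => r • proj (hX q.1) q.2 : Lp ℝ 2 P) = hmem.toLp _ := by
      refine Lp.ext ?_
      filter_upwards [hcoe, hmem.coeFn_toLp] with ω h1 h2
      rw [h1, h2]
    change IsCenteredGaussian _
    rw [heq]
    exact isCenteredGaussian_toLp hmem hlaw h0
  intro f hf
  exact isClosed_setOf_isCenteredGaussian.closure_subset_iff.2 hspan hf

/-- The covariance operators of the field, acting on real-valued functions. -/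
noncomputable def realCov (P : Measure Ω) (X : (Fin d → ℤ) → Ω → L2R) (h : Fin d → ℤ) :
    L2R →L[ℝ] L2R := crossCov P (X h) (X 0)

theorem isStationaryIn_gaussSpace (hX : ∀ s, MemLp (X s) 2 P) (hstat : IsWeaklyStationary P X)
    (hmean : ∀ s, ∫ ω, X s ω ∂P = 0) : IsStationaryIn (gaussSpace hX) X (realCov P X) where
  memLp := hX
  proj_mem s u := Submodule.le_topologicalClosure _ (Submodule.subset_span ⟨(s, u), rfl⟩)
  cov s t u v := by
    rw [realCov, inner_crossCov (hX (s - t)) (hX 0), inner_proj, inner_proj]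
    have h1 := inner_covOp (hX (t + (s - t))) (hX t) (hmean _) (hmean _) u v
    rw [hstat.cov_eq, autocovOp, inner_covOp (hX (s - t)) (hX 0) (hmean _) (hmean _) u v] at h1
    rw [show t + (s - t) = s by abel] at h1
    exact_mod_cast h1.symm

/-- On real functions, the real part of a complex rank-one term σ⟨e, ·⟩f is the sum of two real
ones, from the real and the imaginary parts of e and f. Each has norm at most σ, hence the factor 2.
-/
theorem hasNuclearBound_realCov (hX : ∀ s, MemLp (X s) 2 P) (hmean : ∀ s, ∫ ω, X s ω ∂P = 0)
    {h : Fin d → ℤ} {σ : ℕ → ℝ≥0} {e f : ℕ → L2C} (hs : IsSVD (autocovOp P X h) σ e f) :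
    HasNuclearBound (realCov P X h) (2 * ∑' n, (σ n : ℝ≥0∞)) := by
  refine ⟨ℕ × Bool, fun q => bif q.2 then (σ q.1 : ℝ) • reL (f q.1) else (σ q.1 : ℝ) • imL (f q.1),
    fun q => bif q.2 then reL (e q.1) else imL (e q.1), ?_, ?_⟩
  · intro u v
    rw [ENNReal.tsum_prod (f := fun n b =>
      ‖inner ℝ (bif b then (σ n : ℝ) • reL (f n) else (σ n : ℝ) • imL (f n)) u‖ₑ *
      ‖inner ℝ (bif b then reL (e n) else imL (e n)) v‖ₑ)]
    simp_rw [tsum_bool]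
    simp only [cond_true, cond_false]
    have h1 : (inner ℂ (toC u) (autocovOp P X h (toC v))) = (inner ℝ u (realCov P X h v) : ℂ) := by
      rw [autocovOp, inner_covOp (hX h) (hX 0) (hmean _) (hmean _), realCov,
        inner_crossCov (hX h) (hX 0), inner_proj]
    have h2 := (hs.hasSum (toC v)).mapL (innerSL ℂ (toC u))
    have h3 : HasSum (fun n => (σ n : ℝ) * (inner ℝ (reL (e n)) v * inner ℝ (reL (f n)) u
        + inner ℝ (imL (e n)) v * inner ℝ (imL (f n)) u)) (inner ℝ u (realCov P X h v)) := by
      have h4 := h2.mapL Complex.reCLM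
      have h5 : Complex.reCLM (innerSL ℂ (toC u) (autocovOp P X h (toC v))) =
          inner ℝ u (realCov P X h v) := by
        rw [innerSL_apply_apply, h1]
        exact Complex.ofReal_re _
      rw [h5] at h4
      refine h4.congr_fun fun n => ?_
      rw [innerSL_apply_apply, inner_smul_right, ← inner_conj_symm (toC u), inner_toC, inner_toC]
      simp
      ring
    rw [← h3.tsum_eq]
    refine enorm_tsum_le_tsum_enorm.trans (ENNReal.tsum_le_tsum fun n => ?_)
    rw [mul_add, add_comm]
    refine (enorm_add_le _ _).trans (le_of_eq ?_)
    simp only [real_inner_smul_left, enorm_mul]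
    ring
  · rw [ENNReal.tsum_prod (f := fun n b =>
      ‖bif b then (σ n : ℝ) • reL (f n) else (σ n : ℝ) • imL (f n)‖ₑ *
      ‖bif b then reL (e n) else imL (e n)‖ₑ)]
    simp_rw [tsum_bool]
    simp only [cond_true, cond_false]
    rw [← ENNReal.tsum_mul_left]
    refine ENNReal.tsum_le_tsum fun n => ?_
    have hle1 : ∀ ψ : L2C, ‖ψ‖ = 1 → ‖reL ψ‖ₑ ≤ 1 := by
      intro ψ hψ
      rw [← ofReal_norm, ← ENNReal.ofReal_one, ← hψ]
      exact ENNReal.ofReal_le_ofReal (norm_reL_le ψ)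
    have hle2 : ∀ ψ : L2C, ‖ψ‖ = 1 → ‖imL ψ‖ₑ ≤ 1 := by
      intro ψ hψ
      rw [← ofReal_norm, ← ENNReal.ofReal_one, ← hψ]
      exact ENNReal.ofReal_le_ofReal (norm_imL_le ψ)
    have hσ : ‖(σ n : ℝ)‖ₑ = (σ n : ℝ≥0∞) := by simp
    rw [enorm_smul, enorm_smul, hσ, two_mul]
    have hf := hs.orthonormal_right.1 n
    have he := hs.orthonormal_left.1 n
    refine add_le_add ?_ ?_
    · calc _ ≤ (σ n : ℝ≥0∞) * 1 * 1 := by gcongr; exacts [hle2 _ hf, hle2 _ he]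
        _ = _ := by ring
    · calc _ ≤ (σ n : ℝ≥0∞) * 1 * 1 := by gcongr; exacts [hle1 _ hf, hle1 _ he]
        _ = _ := by ring

/-- Summable trace norms give summable nuclear bounds. -/
theorem exists_nuclearBound_realCov (hX : ∀ s, MemLp (X s) 2 P)
    (hmean : ∀ s, ∫ ω, X s ω ∂P = 0) (hsum : ∑' h, traceNorm (autocovOp P X h) < ∞) :
    ∃ τ : (Fin d → ℤ) → ℝ≥0∞, (∀ h, HasNuclearBound (realCov P X h) (τ h)) ∧ ∑' h, τ h ≠ ∞ := by
  -- The trace norm is defined as an infimum, so a near-optimal decomposition is chosen at each lag,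
  -- with slacks of finite total.
  obtain ⟨ε, hε0, hε⟩ := ENNReal.exists_pos_sum_of_countable (ε := 1) (by simp) (Fin d → ℤ)
  have hfin : ∀ h, traceNorm (autocovOp P X h) ≠ ∞ := fun h =>
    ne_top_of_le_ne_top hsum.ne (ENNReal.le_tsum h)
  have hex : ∀ h, ∃ t, HasNuclearBound (realCov P X h) t ∧
      t ≤ 2 * (traceNorm (autocovOp P X h) + ε h) := by
    intro h
    have hlt : traceNorm (autocovOp P X h) < traceNorm (autocovOp P X h) + ε h :=
      ENNReal.lt_add_right (hfin h) (by exact_mod_cast (hε0 h).ne')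
    conv_lhs at hlt => rw [traceNorm]
    simp only [iInf_lt_iff] at hlt
    obtain ⟨σ, e, f, hs, hlt⟩ := hlt
    exact ⟨_, hasNuclearBound_realCov hX hmean hs, by gcongr⟩
  choose τ h1 h2 using hex
  refine ⟨τ, h1, ne_top_of_le_ne_top ?_ (ENNReal.tsum_le_tsum h2)⟩
  rw [ENNReal.tsum_mul_left, ENNReal.tsum_add]
  exact ENNReal.mul_ne_top (by simp) (ENNReal.add_ne_top.2 ⟨hsum.ne, (hε.trans (by simp)).ne⟩)

theorem scoreTerm_eq_proj (hX : ∀ s, MemLp (X s) 2 P) (φ : (Fin d → ℝ) → L2C) (s l : Fin d → ℤ) :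
    scoreTerm hX φ s l = proj (hX (s - l)) (reL (filterCoeff φ l)) := by
  refine Lp.ext ?_
  filter_upwards [((pairing (filterCoeff φ l)).comp_memLp' (hX (s - l))).coeFn_toLp,
    coeFn_proj (hX (s - l)) (reL (filterCoeff φ l))] with ω h1 h2
  rw [scoreTerm, h1, h2]
  exact pairing_eq_inner _ _

theorem IsCenteredGaussian.integral_eq_zero {f : Lp ℝ 2 P} (hf : IsCenteredGaussian f) :
    ∫ ω, f ω ∂P = 0 := by
  have h : ∫ x, x ∂(P.map f) = ∫ ω, f ω ∂P :=
    integral_map (Lp.aestronglyMeasurable f).aemeasurable (by fun_prop)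
  rw [← h, hf, integral_id_gaussianReal]

theorem covariance_eq_inner {f g : Lp ℝ 2 P} (hf : IsCenteredGaussian f) :
    covariance f g P = inner ℝ f g := by
  rw [covariance_eq_sub (Lp.memLp f) (Lp.memLp g), hf.integral_eq_zero, zero_mul, sub_zero,
    lp_inner]
  rfl

theorem summable_norm_filterCoeff_sq {φ : (Fin d → ℝ) → L2C}
    (hφ : AEStronglyMeasurable φ (cubeMeasure d)) (hB : ∀ᵐ θ ∂cubeMeasure d, ‖φ θ‖ ≤ 1) :
    Summable fun l => ‖filterCoeff φ l‖ ^ 2 :=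
  summable_of_sum_le (fun _ => sq_nonneg _) fun F => sum_norm_filterCoeff_sq_le hφ hB F

theorem sum_norm_conv_reL_sq_le {φ : (Fin d → ℝ) → L2C}
    (hφ : AEStronglyMeasurable φ (cubeMeasure d)) (hB : ∀ᵐ θ ∂cubeMeasure d, ‖φ θ‖ ≤ 1)
    (S F : Finset (Fin d → ℤ)) (α : (Fin d → ℤ) → ℝ) :
    ∑ u ∈ F, ‖∑ s ∈ S, α s • reL (filterCoeff φ (s + u))‖ ^ 2 ≤ ∑ s ∈ S, α s ^ 2 := by
  refine (Finset.sum_le_sum fun u _ => ?_).trans (sum_norm_conv_filterCoeff_sq_le hφ hB S F α)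
  refine pow_le_pow_left₀ (norm_nonneg _) ?_ 2
  have h1 : ∑ s ∈ S, α s • reL (filterCoeff φ (s + u)) =
      reL (∑ s ∈ S, (α s : ℂ) • filterCoeff φ (s + u)) := by
    rw [map_sum]
    refine Finset.sum_congr rfl fun s _ => ?_
    rw [← map_smul]
    rfl
  rw [h1]
  exact norm_reL_le _

end FieldX

/-! ### Deterministic estimates -/

section Deterministic

/-- In the binomial expansion the mixed term |b| δ² is absorbed by the arithmetic–geometric mean
inequality. Only b² |δ|, summable through b² with uniformly small δ, and |δ|³ remain. -/
theorem abs_add_pow_sub_le {r : ℕ} (hr : r = 3 ∨ r = 4) {b δ K : ℝ} (hb : |b| ≤ K) (hδ : |δ| ≤ 1) :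
    |(b + δ) ^ r - b ^ r| ≤ 6 * (K + 1) * (b ^ 2 * |δ| + |δ| ^ 3) := by
  have hb2 : b ^ 2 = |b| ^ 2 := (sq_abs b).symm
  have hK : 0 ≤ K := (abs_nonneg b).trans hb
  have h0 := abs_nonneg b
  have h1 := abs_nonneg δ
  rw [hb2]
  have hpos : 0 ≤ |b| ^ 2 * |δ| + |δ| ^ 3 := by positivity
  have hAG : |b| * |δ| ^ 2 ≤ (|b| ^ 2 * |δ| + |δ| ^ 3) / 2 := by
    nlinarith [mul_nonneg h1 (sq_nonneg (|b| - |δ|))]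
  rcases hr with rfl | rfl
  · have e : (b + δ) ^ 3 - b ^ 3 = 3 * b ^ 2 * δ + 3 * b * δ ^ 2 + δ ^ 3 := by ring
    have h2 : |(b + δ) ^ 3 - b ^ 3| ≤ 3 * |b| ^ 2 * |δ| + 3 * (|b| * |δ| ^ 2) + |δ| ^ 3 := by
      rw [e]
      refine (abs_add_three _ _ _).trans (le_of_eq ?_)
      simp only [abs_mul, abs_pow, abs_of_nonneg (show (0 : ℝ) ≤ 3 by norm_num)]
      ring
    have h3 : 0 ≤ K * (|b| ^ 2 * |δ| + |δ| ^ 3) := mul_nonneg hK hpos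
    have h4 : 0 ≤ |b| ^ 2 * |δ| := by positivity
    have h5 : 0 ≤ |δ| ^ 3 := by positivity
    nlinarith
  · have e : (b + δ) ^ 4 - b ^ 4 = b * (4 * b ^ 2 * δ) + 6 * b ^ 2 * δ ^ 2 + (4 * b * δ ^ 3 + δ ^ 4) := by
      ring
    have h2 : |(b + δ) ^ 4 - b ^ 4| ≤
        |b| * (4 * (|b| ^ 2 * |δ|)) + 6 * (|b| ^ 2 * |δ|) * |δ| + (4 * |b| * |δ| ^ 3 + |δ| ^ 3 * |δ|) := by
      rw [e]
      refine (abs_add_three _ _ _).trans ?_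
      refine add_le_add (le_of_eq ?_) ((abs_add_le _ _).trans (le_of_eq ?_))
      · simp only [abs_mul, abs_pow, abs_of_nonneg (show (0 : ℝ) ≤ 4 by norm_num),
          abs_of_nonneg (show (0 : ℝ) ≤ 6 by norm_num)]
        ring
      · simp only [abs_mul, abs_pow, abs_of_nonneg (show (0 : ℝ) ≤ 4 by norm_num)]
        ring
    have h4 : 0 ≤ |b| ^ 2 * |δ| := by positivity
    have h5 : 0 ≤ |δ| ^ 3 := by positivity
    have h6 : |b| * (|b| ^ 2 * |δ|) ≤ K * (|b| ^ 2 * |δ|) := mul_le_mul_of_nonneg_right hb h4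
    have h7 : |b| * |δ| ^ 3 ≤ K * |δ| ^ 3 := mul_le_mul_of_nonneg_right hb h5
    have h8 : |b| ^ 2 * |δ| * |δ| ≤ |b| ^ 2 * |δ| := mul_le_of_le_one_right h4 hδ
    have h9 : |δ| ^ 3 * |δ| ≤ |δ| ^ 3 := mul_le_of_le_one_right h5 hδ
    have h10 : 0 ≤ K * |δ| ^ 3 := mul_nonneg hK h5
    have h11 : 0 ≤ K * (|b| ^ 2 * |δ|) := mul_nonneg hK h4
    nlinarith

/-- Perturbation of a sum of powers by a summand that is small in `ℓ²` and one that is uniformly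
small. -/
theorem abs_sum_pow_sub_sum_pow_le {ι : Type*} {r : ℕ} (hr : r = 3 ∨ r = 4) (J : Finset ι)
    {b δ α : ι → ℝ} {K A τ : ℝ} (hK : 0 ≤ K) (hb : ∀ h ∈ J, |b h| ≤ K)
    (hA : ∑ h ∈ J, (α h - b h) ^ 2 ≤ A) (hτ : ∀ h ∈ J, |δ h - α h| ≤ τ) (hτ0 : 0 ≤ τ)
    (hs : √A + τ ≤ 1) :
    |∑ h ∈ J, δ h ^ r - ∑ h ∈ J, b h ^ r| ≤
      6 * (K + 1) * ((√A + τ) * ∑ h ∈ J, b h ^ 2 + 4 * (√A * A + J.card * τ ^ 3)) := by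
  have hα : ∀ h ∈ J, |α h - b h| ≤ √A := fun h hh => by
    refine Real.abs_le_sqrt (le_trans ?_ hA)
    exact Finset.single_le_sum (f := fun h => (α h - b h) ^ 2) (fun i _ => sq_nonneg _) hh
  have key : ∀ h ∈ J, |δ h ^ r - b h ^ r| ≤
      6 * (K + 1) * ((√A + τ) * b h ^ 2 + 4 * (√A * (α h - b h) ^ 2 + τ ^ 3)) := by
    intro h hh
    have h1 : |δ h - b h| ≤ |α h - b h| + τ := by
      have := abs_add_le (δ h - α h) (α h - b h)
      rw [sub_add_sub_cancel] at this
      linarith [hτ h hh]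
    have h2 := abs_add_pow_sub_le hr (hb h hh) (h1.trans ((add_le_add_left (hα h hh) τ).trans hs))
    rw [add_sub_cancel] at h2
    refine h2.trans (mul_le_mul_of_nonneg_left ?_ (by positivity))
    have ha := abs_nonneg (α h - b h)
    refine add_le_add ?_ ?_
    · rw [mul_comm]
      exact mul_le_mul_of_nonneg_right (h1.trans (add_le_add_left (hα h hh) τ)) (sq_nonneg _)
    · have h3 : |δ h - b h| ^ 3 ≤ (|α h - b h| + τ) ^ 3 := pow_le_pow_left₀ (abs_nonneg _) h1 3
      have h4 : (|α h - b h| + τ) ^ 3 ≤ 4 * (|α h - b h| ^ 3 + τ ^ 3) := by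
        -- Convexity of the cube, (x + τ)³ ≤ 4 (x³ + τ³).
        nlinarith [mul_nonneg (add_nonneg ha hτ0) (sq_nonneg (|α h - b h| - τ))]
      have h5 : |α h - b h| ^ 3 ≤ √A * (α h - b h) ^ 2 := by
        rw [← sq_abs (α h - b h), pow_succ']
        exact mul_le_mul_of_nonneg_right (hα h hh) (sq_nonneg _)
      linarith
  rw [← Finset.sum_sub_distrib]
  refine (Finset.abs_sum_le_sum_abs _ _).trans ((Finset.sum_le_sum key).trans ?_)
  rw [← Finset.mul_sum, Finset.sum_add_distrib, ← Finset.mul_sum, ← Finset.mul_sum,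
    Finset.sum_add_distrib, ← Finset.mul_sum, Finset.sum_const, nsmul_eq_mul]
  gcongr

/-- Weighted Cauchy–Schwarz at each h, followed by exchanging the sums. -/
theorem sum_sum_mul_sq_le {ι κ : Type*} (J : Finset ι) (Q : Finset κ) {w : κ → ℝ}
    (hw : ∀ q ∈ Q, 0 ≤ w q) (f : ι → κ → ℝ) :
    ∑ h ∈ J, (∑ q ∈ Q, w q * f h q) ^ 2 ≤
      (∑ q ∈ Q, w q) * ∑ q ∈ Q, w q * ∑ h ∈ J, f h q ^ 2 := by
  have h1 : ∀ h ∈ J, (∑ q ∈ Q, w q * f h q) ^ 2 ≤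
      (∑ q ∈ Q, w q) * ∑ q ∈ Q, w q * f h q ^ 2 := fun h _ =>
    Finset.sum_sq_le_sum_mul_sum_of_sq_le_mul Q hw
      (fun q hq => mul_nonneg (hw q hq) (sq_nonneg _)) (fun q _ => le_of_eq (by ring))
  refine (Finset.sum_le_sum h1).trans (le_of_eq ?_)
  rw [← Finset.mul_sum, Finset.sum_comm]
  simp_rw [Finset.mul_sum]

/-- The empirical Cauchy–Schwarz inequality. -/
theorem abs_sum_mul_shift_le {G : Type*} [AddCommGroup G] {R S : Finset G} {h : G} (hSR : S ⊆ R)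
    (hSh : ∀ s ∈ S, s + h ∈ R) {u v : G → ℝ} {a b : ℝ} (ha : 0 ≤ a) (hb : 0 ≤ b)
    {N : ℝ} (hN : 0 ≤ N) (hu : N * ∑ s ∈ R, u s ^ 2 ≤ a ^ 2) (hv : N * ∑ s ∈ R, v s ^ 2 ≤ b ^ 2) :
    |N * ∑ s ∈ S, u (s + h) * v s| ≤ a * b := by
  refine abs_le_of_sq_le_sq ?_ (mul_nonneg ha hb)
  have h1 := Finset.sum_mul_sq_le_sq_mul_sq S (fun s => u (s + h)) v
  have h2 : ∑ s ∈ S, u (s + h) ^ 2 ≤ ∑ s ∈ R, u s ^ 2 := by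
    refine (Finset.sum_map S (addRightEmbedding h) (fun s => u s ^ 2)).symm.le.trans ?_
    refine Finset.sum_le_sum_of_subset_of_nonneg ?_ (fun _ _ _ => sq_nonneg _)
    intro x hx
    obtain ⟨s, hs, rfl⟩ := Finset.mem_map.1 hx
    exact hSh s hs
  have h3 : ∑ s ∈ S, v s ^ 2 ≤ ∑ s ∈ R, v s ^ 2 :=
    Finset.sum_le_sum_of_subset_of_nonneg hSR (fun _ _ _ => sq_nonneg _)
  have h4 : 0 ≤ ∑ s ∈ S, v s ^ 2 := Finset.sum_nonneg fun _ _ => sq_nonneg _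
  have h5 : 0 ≤ ∑ s ∈ R, v s ^ 2 := h4.trans h3
  calc (N * ∑ s ∈ S, u (s + h) * v s) ^ 2
      ≤ N ^ 2 * ((∑ s ∈ S, u (s + h) ^ 2) * ∑ s ∈ S, v s ^ 2) := by
        rw [mul_pow]; exact mul_le_mul_of_nonneg_left h1 (sq_nonneg _)
    _ ≤ N ^ 2 * ((∑ s ∈ R, u s ^ 2) * ∑ s ∈ R, v s ^ 2) := by
        refine mul_le_mul_of_nonneg_left ?_ (sq_nonneg _)
        exact mul_le_mul h2 h3 h4 (Finset.sum_nonneg fun _ _ => sq_nonneg _)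
    _ = (N * ∑ s ∈ R, u s ^ 2) * (N * ∑ s ∈ R, v s ^ 2) := by ring
    _ ≤ a ^ 2 * b ^ 2 := mul_le_mul hu hv (mul_nonneg hN h5) (sq_nonneg _)
    _ = (a * b) ^ 2 := by ring

theorem abs_sum_mul_shift_sub_le {G : Type*} [AddCommGroup G] {R S : Finset G} {h : G} (hSR : S ⊆ R)
    (hSh : ∀ s ∈ S, s + h ∈ R) {w u : G → ℝ} {a b : ℝ} (ha : 0 ≤ a) (hb : 0 ≤ b)
    {N : ℝ} (hN : 0 ≤ N) (hw : N * ∑ s ∈ R, (u s - w s) ^ 2 ≤ a ^ 2)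
    (hu : N * ∑ s ∈ R, u s ^ 2 ≤ b ^ 2) :
    |N * ∑ s ∈ S, w (s + h) * w s - N * ∑ s ∈ S, u (s + h) * u s| ≤ 2 * a * b + a ^ 2 := by
  have h1 := abs_sum_mul_shift_le hSR hSh (u := fun s => u s - w s) ha hb hN hw hu
  have h2 := abs_sum_mul_shift_le hSR hSh (v := fun s => u s - w s) hb ha hN hu hw
  have h3 := abs_sum_mul_shift_le hSR hSh (u := fun s => u s - w s) (v := fun s => u s - w s)
    ha ha hN hw hw
  have e : N * ∑ s ∈ S, w (s + h) * w s - N * ∑ s ∈ S, u (s + h) * u s =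
      -(N * ∑ s ∈ S, (u (s + h) - w (s + h)) * u s) +
      -(N * ∑ s ∈ S, u (s + h) * (u s - w s)) +
      N * ∑ s ∈ S, (u (s + h) - w (s + h)) * (u s - w s) := by
    rw [← mul_neg, ← mul_neg, ← mul_sub, ← mul_add, ← mul_add, ← Finset.sum_sub_distrib,
      ← Finset.sum_neg_distrib, ← Finset.sum_neg_distrib, ← Finset.sum_add_distrib,
      ← Finset.sum_add_distrib]
    refine congrArg _ (Finset.sum_congr rfl fun s _ => ?_)
    ring
  rw [e]
  refine (abs_add_three _ _ _).trans ?_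
  rw [abs_neg, abs_neg]
  nlinarith

/-- The effect on the sample autocovariances of an additive perturbation of the field and of the
centering. -/
theorem abs_sampleAutocov_sub_le {d : ℕ} {n : Fin d → ℕ} (hR : (region n).Nonempty)
    {B T Z : (Fin d → ℤ) → ℝ} (hZ : ∀ s, Z s = B s - T s) {V b : ℝ} (hb : 0 ≤ b)
    (hV : ((region n).card : ℝ)⁻¹ * ∑ s ∈ region n, T s ^ 2 ≤ V)
    (hB : ((region n).card : ℝ)⁻¹ * ∑ s ∈ region n, B s ^ 2 ≤ b ^ 2) (h : Fin d → ℤ) :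
    |sampleAutocov n Z h - ((region n).card : ℝ)⁻¹ *
      ∑ s ∈ (region n).filter (fun s => s + h ∈ region n), B (s + h) * B s| ≤
      2 * √(6 * V + 3 * sampleMean n B ^ 2) * b + √(6 * V + 3 * sampleMean n B ^ 2) ^ 2 := by
  have hN : (0 : ℝ) < (region n).card := by exact_mod_cast hR.card_pos
  have hV0 : 0 ≤ V := le_trans (by positivity) hV
  refine abs_sum_mul_shift_sub_le (w := fun s => Z s - sampleMean n Z) (Finset.filter_subset _ _)
    (fun s hs => (Finset.mem_filter.1 hs).2) (Real.sqrt_nonneg _) hb (by positivity) ?_ hB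
  rw [Real.sq_sqrt (by positivity)]
  have hm : sampleMean n Z = sampleMean n B - sampleMean n T := by
    simp only [sampleMean, hZ, Finset.sum_sub_distrib, mul_sub]
  have hT : sampleMean n T ^ 2 ≤ V := by
    refine le_trans ?_ hV
    rw [sampleMean, mul_pow]
    have := Finset.sum_mul_sq_le_sq_mul_sq (region n) (fun _ => (1 : ℝ)) T
    simp only [one_mul, one_pow, Finset.sum_const, nsmul_eq_mul, mul_one] at this
    refine (mul_le_mul_of_nonneg_left this (sq_nonneg _)).trans (le_of_eq ?_)
    field_simp
  -- The difference is T_s plus the mean of B minus the mean of T. Averaging the squares with factor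
  -- 3 gives 6V, because the squared mean of T is also at most V.
  have h1 : ∀ s ∈ region n, (B s - (Z s - sampleMean n Z)) ^ 2 ≤
      3 * T s ^ 2 + 3 * (sampleMean n B ^ 2 + sampleMean n T ^ 2) := by
    intro s _
    rw [hZ, hm]
    nlinarith [sq_nonneg (T s - sampleMean n B), sq_nonneg (T s + sampleMean n T),
      sq_nonneg (sampleMean n B + sampleMean n T)]
  refine (mul_le_mul_of_nonneg_left (Finset.sum_le_sum h1) (by positivity)).trans ?_
  rw [Finset.sum_add_distrib, ← Finset.mul_sum, Finset.sum_const, nsmul_eq_mul, mul_add,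
    inv_mul_cancel_left₀ hN.ne']
  linarith

/-- Stability of the sums of powers of the sample autocovariances: `p` is the cube root of the
number of lags, and the perturbation of the field is of order `e / p` in empirical mean square. -/
theorem abs_sum_sampleAutocov_pow_sub_le {d r : ℕ} (hr : r = 3 ∨ r = 4) {n : Fin d → ℕ}
    (hR : (region n).Nonempty) {J : Finset (Fin d → ℤ)} (hJ : 0 ∈ J)
    {B T Z γ : (Fin d → ℤ) → ℝ} (hZ : ∀ s, Z s = B s - T s) {A K K₂ V e p : ℝ}
    (hγ : ∀ h, |γ h| ≤ K) (hγ₂ : ∑ h ∈ J, γ h ^ 2 ≤ K₂)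
    (hA : ∑ h ∈ J, (((region n).card : ℝ)⁻¹ *
      ∑ s ∈ (region n).filter (fun s => s + h ∈ region n), B (s + h) * B s - γ h) ^ 2 ≤ A)
    (hV : ((region n).card : ℝ)⁻¹ * ∑ s ∈ region n, T s ^ 2 ≤ V)
    (hp : 1 ≤ p) (hpJ : p ^ 3 = J.card) (he : 0 ≤ e)
    (hpe : p ^ 2 * (6 * V + 3 * sampleMean n B ^ 2) ≤ e ^ 2)
    (hs : √A + (2 * e * √(K + 1) + e ^ 2) ≤ 1) :
    |∑ h ∈ J, sampleAutocov n Z h ^ r - ∑ h ∈ J, γ h ^ r| ≤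
      6 * (K + 1) * ((√A + (2 * e * √(K + 1) + e ^ 2)) * K₂ +
        4 * (√A * A + (2 * e * √(K + 1) + e ^ 2) ^ 3)) := by
  set b := √(K + 1) with hb
  set e' := 2 * e * b + e ^ 2 with he'
  have hK0 : 0 ≤ K := (abs_nonneg _).trans (hγ 0)
  have hb0 : 0 ≤ b := Real.sqrt_nonneg _
  have he0 : 0 ≤ e' := by positivity
  have hA0 : 0 ≤ A := (Finset.sum_nonneg fun _ _ => sq_nonneg _).trans hA
  have hp0 : 0 < p := by linarith
  have hV0 : 0 ≤ V := le_trans (by positivity) hV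
  -- Lag 0 of the ℓ² bound: the empirical second moment of B is at most γ_0 + √A ≤ K + 1.
  have hB : ((region n).card : ℝ)⁻¹ * ∑ s ∈ region n, B s ^ 2 ≤ b ^ 2 := by
    have h1 := (Finset.single_le_sum (f := fun h => (((region n).card : ℝ)⁻¹ *
      ∑ s ∈ (region n).filter (fun s => s + h ∈ region n), B (s + h) * B s - γ h) ^ 2)
      (fun _ _ => sq_nonneg _) hJ).trans hA
    have h2 := Real.abs_le_sqrt h1
    simp only [add_zero, Finset.filter_mem_eq_inter, Finset.inter_self, ← sq] at h2
    rw [hb, Real.sq_sqrt (by linarith)]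
    linarith [(abs_le.1 h2).2, (abs_le.1 (hγ 0)).2]
  set t := √(6 * V + 3 * sampleMean n B ^ 2) with ht
  have ht0 : 0 ≤ t := Real.sqrt_nonneg _
  have ht2 : t ^ 2 = 6 * V + 3 * sampleMean n B ^ 2 := Real.sq_sqrt (by positivity)
  have hpt : p * t ≤ e := by
    refine abs_le_of_sq_le_sq' ?_ he |>.2
    rw [mul_pow, ht2]
    exact hpe
  have hτ : 2 * t * b + t ^ 2 ≤ e' / p := by
    rw [le_div_iff₀ hp0, he']
    have h1 : t ≤ e := (le_mul_of_one_le_left ht0 hp).trans hpt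
    have h2 : t * (p * t) ≤ e * e := mul_le_mul h1 hpt (by positivity) he
    have h3 : b * (p * t) ≤ b * e := mul_le_mul_of_nonneg_left hpt hb0
    nlinarith
  have hep : e' / p ≤ e' := div_le_self he0 hp
  refine (abs_sum_pow_sub_sum_pow_le hr J hK0 (fun h _ => hγ h) hA
    (fun h _ => (abs_sampleAutocov_sub_le hR hZ hb0 hV hB h).trans hτ)
    (div_nonneg he0 hp0.le) ((add_le_add_right hep _).trans hs)).trans ?_
  -- The cube root p of the number of lags exactly compensates the sum of the cubed uniform errors.
  have h4 : (J.card : ℝ) * (e' / p) ^ 3 = e' ^ 3 := by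
    rw [← hpJ, div_pow]
    field_simp
  rw [h4]
  have hA1 : 0 ≤ √A := Real.sqrt_nonneg _
  have hγ0 : 0 ≤ ∑ h ∈ J, γ h ^ 2 := Finset.sum_nonneg fun _ _ => sq_nonneg _
  gcongr

end Deterministic

/-! ### Lag products of a field with sample-dependent coefficients. -/

section LagProducts

variable {Ω G E : Type*} [AddCommGroup G] [NormedAddCommGroup E] [InnerProductSpace ℝ E]

theorem sum_mul_eq_noise_add {ι : Type*} (Z : G → Ω → E) (C : G → E →L[ℝ] E) (S : Finset G)
    (h : G) (ω : Ω) (I : Finset ι) (w : ι → E) (c : ι → G) :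
    ∑ s ∈ S, (∑ i ∈ I, inner ℝ (w i) (Z (s + h - c i) ω)) *
        (∑ i ∈ I, inner ℝ (w i) (Z (s - c i) ω)) =
      ∑ q ∈ I ×ˢ I, (inner ℝ (w q.1) (noise Z C S (h - c q.1) (-c q.2) ω (w q.2)) +
        S.card * inner ℝ (w q.1) (C (h - c q.1 + c q.2) (w q.2))) := by
  simp_rw [Finset.sum_mul_sum, ← Finset.sum_product' I I]
  rw [Finset.sum_comm]
  refine Finset.sum_congr rfl fun q _ => ?_
  rw [noise, sum_apply, inner_sum]
  simp_rw [sub_apply, inner_sub_right]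
  rw [Finset.sum_sub_distrib, Finset.sum_const, nsmul_eq_mul, sub_neg_eq_add, sub_add_cancel]
  refine Finset.sum_congr rfl fun s _ => ?_
  rw [InnerProductSpace.rankOne_apply, real_inner_smul_right, add_sub_assoc, ← sub_eq_add_neg,
    real_inner_comm (w q.2), mul_comm]

/-- The shifts in a filter `e + ∑_{l ∈ J} v_l`, where `none` stands for the leading term. -/
def lagShift (o : Option G) : G := o.getD 0

/-- Deterministic weights dominating the norms of the coefficients of the filter. -/
noncomputable def lagWeight (J : Finset G) (o : Option G) : ℝ :=
  o.elim 1 (fun _ => (J.card : ℝ)⁻¹)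

/-- The leading term has weight 1 and the weights 1/|J| add up to at most 1; the inequality covers
empty J. -/
theorem sum_lagWeight_le (J : Finset G) : ∑ i ∈ Finset.insertNone J, lagWeight J i ≤ 2 := by
  rw [Finset.sum_insertNone]
  simp only [lagWeight, Option.elim, Finset.sum_const, nsmul_eq_mul]
  have : (J.card : ℝ) * (J.card : ℝ)⁻¹ ≤ 1 := mul_inv_le_one
  linarith

theorem lagWeight_nonneg (J : Finset G) (o : Option G) : 0 ≤ lagWeight J o := by
  cases o <;> simp [lagWeight]

/-- The total weighted squared norm of the noise in the lag products. -/
noncomputable def noiseEnergy (Z : G → Ω → E) (C : G → E →L[ℝ] E) (S : G → Finset G)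
    (J' J : Finset G) (ω : Ω) : ℝ :=
  ∑ q ∈ Finset.insertNone J ×ˢ Finset.insertNone J, lagWeight J q.1 * lagWeight J q.2 *
    ∑ h ∈ J', ‖noise Z C (S h) (h - lagShift q.1) (-lagShift q.2) ω‖ ^ 2

/-- The bound holds pointwise, so v may depend on the sample in any way. The error at a lag consists
of the edge effect (1 - |S h|/N), the noise operators, and the covariances in which at least one
factor carries a v. Replacing ‖v l‖ by 1/|J| in the noise makes `noiseEnergy` free of v, so that its
expectation can be bounded. -/
theorem sum_lagProduct_sub_sq_le (Z : G → Ω → E) (C : G → E →L[ℝ] E) (ω : Ω) {e : E}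
    (he : ‖e‖ ≤ 1) (v : G → E) (J J' : Finset G) (S : G → Finset G) {N g ζ K₂ : ℝ} (hN : 0 < N)
    (hSN : ∀ h ∈ J', ((S h).card : ℝ) ≤ N) (hζ : ∀ h ∈ J', 1 - (S h).card / N ≤ ζ) (hg : 0 ≤ g)
    (hv : ∀ l ∈ J, ‖v l‖ ≤ g) (hgJ : J.card * g ≤ 1)
    (hK₂ : ∀ F : Finset G, ∑ h ∈ F, ‖C h‖ ^ 2 ≤ K₂) {B : G → ℝ}
    (hB : ∀ s, B s = inner ℝ e (Z s ω) + ∑ l ∈ J, inner ℝ (v l) (Z (s - l) ω)) :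
    ∑ h ∈ J', (N⁻¹ * ∑ s ∈ S h, B (s + h) * B s - inner ℝ e (C h e)) ^ 2 ≤
      3 * (ζ ^ 2 * K₂ + 4 * ((N⁻¹) ^ 2 * noiseEnergy Z C S J' J ω) +
        (2 * (J.card * g) + (J.card * g) ^ 2) ^ 2 * K₂) := by
  classical
  set w : Option G → E := fun o => o.elim e v with hw
  set β : Option G → ℝ := fun o => o.elim 1 (fun _ => g) with hβ
  set I := Finset.insertNone J with hI
  have hβ0 : ∀ o, 0 ≤ β o := by rintro (_ | l) <;> simp [hβ, hg]
  have hwβ : ∀ o ∈ I, ‖w o‖ ≤ β o := by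
    rintro (_ | l) ho
    · simpa [hw, hβ] using he
    · exact hv l (Finset.some_mem_insertNone.1 ho)
  have hβρ : ∀ o ∈ I, β o ≤ lagWeight J o := by
    rintro (_ | l) ho
    · simp [hβ, lagWeight]
    · have hl := Finset.some_mem_insertNone.1 ho
      have hJ : (0 : ℝ) < J.card := by exact_mod_cast Finset.card_pos.2 ⟨l, hl⟩
      change g ≤ (J.card : ℝ)⁻¹
      rw [← one_div, le_div_iff₀ hJ, mul_comm]
      exact hgJ
  have hB' : ∀ s, B s = ∑ i ∈ I, inner ℝ (w i) (Z (s - lagShift i) ω) := by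
    intro s
    rw [hB, hI, Finset.sum_insertNone]
    simp [hw, lagShift]
  set Q := I ×ˢ I with hQ
  have hnone : (none, none) ∈ Q := by simp [hQ, hI]
  -- The pair of leading terms produces the target ⟨e, C h e⟩; the remaining covariance terms each
  -- carry a factor g or g².
  set Q' := Q.erase (none, none) with hQ'
  have hQI : ∀ q ∈ Q, q.1 ∈ I ∧ q.2 ∈ I := fun q hq => Finset.mem_product.1 hq
  have hbil : ∀ q ∈ Q, ∀ A : E →L[ℝ] E, |inner ℝ (w q.1) (A (w q.2))| ≤ β q.1 * β q.2 * ‖A‖ := by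
    intro q hq A
    obtain ⟨h1, h2⟩ := hQI q hq
    calc |inner ℝ (w q.1) (A (w q.2))| ≤ ‖w q.1‖ * (‖A‖ * ‖w q.2‖) :=
          (abs_real_inner_le_norm _ _).trans
            (mul_le_mul_of_nonneg_left (A.le_opNorm _) (norm_nonneg _))
      _ ≤ β q.1 * (‖A‖ * β q.2) := by
          have := hwβ _ h1
          have := hwβ _ h2
          have := hβ0 q.1
          gcongr
      _ = β q.1 * β q.2 * ‖A‖ := by ring
  have key : ∀ h ∈ J', |N⁻¹ * ∑ s ∈ S h, B (s + h) * B s - inner ℝ e (C h e)| ≤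
      ζ * ‖C h‖ + (∑ q ∈ Q, lagWeight J q.1 * lagWeight J q.2 *
        (N⁻¹ * ‖noise Z C (S h) (h - lagShift q.1) (-lagShift q.2) ω‖)) +
        ∑ q ∈ Q', β q.1 * β q.2 * ‖C (h - lagShift q.1 + lagShift q.2)‖ := by
    intro h hh
    have e1 : N⁻¹ * ∑ s ∈ S h, B (s + h) * B s - inner ℝ e (C h e) =
        -(1 - (S h).card / N) * inner ℝ e (C h e) +
        (∑ q ∈ Q, N⁻¹ * inner ℝ (w q.1)
          (noise Z C (S h) (h - lagShift q.1) (-lagShift q.2) ω (w q.2))) +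
        ∑ q ∈ Q', ((S h).card / N) * inner ℝ (w q.1)
          (C (h - lagShift q.1 + lagShift q.2) (w q.2)) := by
      simp_rw [hB']
      rw [sum_mul_eq_noise_add Z C, Finset.sum_add_distrib, ← Finset.mul_sum, ← Finset.mul_sum,
        ← Finset.mul_sum, ← Finset.add_sum_erase Q (fun q => inner ℝ (w q.1)
          (C (h - lagShift q.1 + lagShift q.2) (w q.2))) hnone]
      have : inner ℝ (w none) (C (h - lagShift none + lagShift none) (w none)) =
          inner ℝ e (C h e) := by simp [hw, lagShift]
      dsimp only
      rw [this]
      ring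
    rw [e1]
    have hS0 : 0 ≤ (S h).card / N := by positivity
    have hS1 : (S h).card / N ≤ 1 := (div_le_one hN).2 (hSN h hh)
    refine (abs_add_three _ _ _).trans (add_le_add (add_le_add ?_ ?_) ?_)
    · rw [abs_mul, abs_neg, abs_of_nonneg (sub_nonneg.2 hS1)]
      refine mul_le_mul (hζ h hh) ?_ (abs_nonneg _) ((sub_nonneg.2 hS1).trans (hζ h hh))
      simpa [hw, hβ] using hbil (none, none) hnone (C h)
    · refine (Finset.abs_sum_le_sum_abs _ _).trans (Finset.sum_le_sum fun q hq => ?_)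
      obtain ⟨h1, h2⟩ := hQI q hq
      rw [abs_mul, abs_of_pos (inv_pos.2 hN)]
      calc N⁻¹ * _ ≤ N⁻¹ * (β q.1 * β q.2 * _) :=
            mul_le_mul_of_nonneg_left (hbil q hq _) (inv_pos.2 hN).le
        _ = β q.1 * β q.2 * (N⁻¹ * ‖noise Z C (S h) (h - lagShift q.1) (-lagShift q.2) ω‖) := by
            ring
        _ ≤ _ := by
            refine mul_le_mul_of_nonneg_right ?_ (by positivity)
            exact mul_le_mul (hβρ _ h1) (hβρ _ h2) (hβ0 _) (lagWeight_nonneg _ _)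
    · refine (Finset.abs_sum_le_sum_abs _ _).trans (Finset.sum_le_sum fun q hq => ?_)
      rw [abs_mul, abs_of_nonneg hS0]
      exact (mul_le_of_le_one_left (abs_nonneg _) hS1).trans
        (hbil q (Finset.mem_of_mem_erase hq) _)
  have key2 : ∀ h ∈ J', (N⁻¹ * ∑ s ∈ S h, B (s + h) * B s - inner ℝ e (C h e)) ^ 2 ≤
      3 * ((ζ * ‖C h‖) ^ 2 + (∑ q ∈ Q, lagWeight J q.1 * lagWeight J q.2 *
        (N⁻¹ * ‖noise Z C (S h) (h - lagShift q.1) (-lagShift q.2) ω‖)) ^ 2 +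
        (∑ q ∈ Q', β q.1 * β q.2 * ‖C (h - lagShift q.1 + lagShift q.2)‖) ^ 2) := by
    intro h hh
    refine (sq_le_sq.2 ((key h hh).trans (le_abs_self _))).trans ?_
    generalize ζ * ‖C h‖ = x
    generalize (∑ q ∈ Q, _ : ℝ) = y
    generalize (∑ q ∈ Q', _ : ℝ) = z
    nlinarith [sq_nonneg (x - y), sq_nonneg (x - z), sq_nonneg (y - z)]
  refine (Finset.sum_le_sum key2).trans ?_
  rw [← Finset.mul_sum, Finset.sum_add_distrib, Finset.sum_add_distrib]
  have hK0 : 0 ≤ K₂ := by simpa using hK₂ ∅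
  refine mul_le_mul_of_nonneg_left (add_le_add (add_le_add ?_ ?_) ?_) (by norm_num)
  · simp_rw [mul_pow]
    rw [← Finset.mul_sum]
    exact mul_le_mul_of_nonneg_left (hK₂ J') (sq_nonneg _)
  · refine (sum_sum_mul_sq_le J' Q (fun q _ => mul_nonneg (lagWeight_nonneg _ _)
      (lagWeight_nonneg _ _)) _).trans ?_
    have e2 : ∑ q ∈ Q, lagWeight J q.1 * lagWeight J q.2 * ∑ h ∈ J',
        (N⁻¹ * ‖noise Z C (S h) (h - lagShift q.1) (-lagShift q.2) ω‖) ^ 2 =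
        (N⁻¹) ^ 2 * noiseEnergy Z C S J' J ω := by
      simp_rw [mul_pow, ← Finset.mul_sum]
      rw [noiseEnergy, Finset.mul_sum]
      exact Finset.sum_congr rfl fun q _ => by ring
    rw [e2]
    have h0 : 0 ≤ (N⁻¹) ^ 2 * noiseEnergy Z C S J' J ω := by
      rw [← e2]
      exact Finset.sum_nonneg fun q _ => mul_nonneg (mul_nonneg (lagWeight_nonneg _ _)
        (lagWeight_nonneg _ _)) (Finset.sum_nonneg fun _ _ => sq_nonneg _)
    refine mul_le_mul_of_nonneg_right ?_ h0
    rw [hQ, Finset.sum_product, ← Finset.sum_mul_sum]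
    have h1 := sum_lagWeight_le J
    have h2 : 0 ≤ ∑ i ∈ I, lagWeight J i := Finset.sum_nonneg fun i _ => lagWeight_nonneg J i
    nlinarith
  · refine (sum_sum_mul_sq_le J' Q' (fun q _ => mul_nonneg (hβ0 _) (hβ0 _)) _).trans ?_
    -- For fixed q the lags are merely translated, which is why `hK₂` is required for arbitrary
    -- finite sets.
    have h1 : ∀ q ∈ Q', β q.1 * β q.2 * ∑ h ∈ J', ‖C (h - lagShift q.1 + lagShift q.2)‖ ^ 2 ≤
        β q.1 * β q.2 * K₂ := by
      intro q _
      refine mul_le_mul_of_nonneg_left ?_ (mul_nonneg (hβ0 _) (hβ0 _))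
      have := hK₂ (J'.map (addRightEmbedding (-lagShift q.1 + lagShift q.2)))
      rw [Finset.sum_map] at this
      refine le_trans (le_of_eq (Finset.sum_congr rfl fun h _ => ?_)) this
      rw [addRightEmbedding_apply, sub_eq_add_neg, add_assoc]
    -- The total mass is (1 + |J| g)², and the erased pair has mass 1.
    have h2 : ∑ q ∈ Q', β q.1 * β q.2 = 2 * (J.card * g) + (J.card * g) ^ 2 := by
      have h3 : ∑ i ∈ I, β i = 1 + J.card * g := by
        rw [hI, Finset.sum_insertNone]
        simp [hβ]
      have h4 := Finset.add_sum_erase Q (fun q => β q.1 * β q.2) hnone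
      have h5 : ∑ q ∈ Q, β q.1 * β q.2 = (1 + J.card * g) * (1 + J.card * g) := by
        rw [hQ, Finset.sum_product, ← Finset.sum_mul_sum, h3]
      rw [h5] at h4
      have h6 : β none = 1 := rfl
      simp only [h6] at h4
      linarith
    refine (mul_le_mul_of_nonneg_left (Finset.sum_le_sum h1)
      (Finset.sum_nonneg fun q _ => mul_nonneg (hβ0 _) (hβ0 _))).trans (le_of_eq ?_)
    rw [← Finset.sum_mul, h2]
    ring

end LagProducts

/-! ### Counting lattice points -/

section Counting

variable {d : ℕ}

theorem mem_box {K : ℕ} {l : Fin d → ℤ} : l ∈ box d K ↔ ∀ i, |l i| ≤ K := by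
  simp [box, Finset.mem_Icc, Pi.le_def, abs_le, forall_and]

theorem card_box (d K : ℕ) : (box d K).card = (2 * K + 1) ^ d := by
  rw [box, Pi.card_Icc]
  simp only [Int.card_Icc, Finset.prod_const, Finset.card_univ, Fintype.card_fin]
  congr 1
  omega

theorem card_region (n : Fin d → ℕ) : (region n).card = ∏ i, n i := by
  rw [region, Pi.card_Icc]
  simp

theorem zero_mem_box (d K : ℕ) : (0 : Fin d → ℤ) ∈ box d K := by simp [mem_box]

theorem tendsto_box (d : ℕ) : Tendsto (box d) atTop atTop := by
  refine tendsto_atTop_finset_of_monotone (fun K K' h l hl => ?_) (fun l => ?_)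
  · rw [mem_box] at hl ⊢
    exact fun i => (hl i).trans (by exact_mod_cast h)
  · refine ⟨∑ i, (l i).natAbs, mem_box.2 fun i => ?_⟩
    rw [Int.abs_eq_natAbs]
    exact_mod_cast Finset.single_le_sum (f := fun i => (l i).natAbs) (fun _ _ => Nat.zero_le _)
      (Finset.mem_univ i)

/-- Sites at distance at least K from the boundary remain in the region under every shift in the
box. -/
theorem prod_le_card_filter_region {n : Fin d → ℕ} {K : ℕ} (hn : ∀ i, 0 < n i)
    (hK : ∀ i, 2 * K ≤ n i) {h : Fin d → ℤ} (hh : h ∈ box d K) :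
    ∏ i, (1 - 2 * (K / n i : ℝ)) ≤
      (((region n).filter (fun s => s + h ∈ region n)).card : ℝ) / (region n).card := by
  have hsub : Finset.Icc (fun _ => 1 + (K : ℤ)) (fun i => (n i : ℤ) - K) ⊆
      (region n).filter (fun s => s + h ∈ region n) := by
    intro s hs
    rw [mem_box] at hh
    simp only [region, Finset.mem_filter, Finset.mem_Icc, Pi.le_def, Pi.add_apply] at hs ⊢
    have h1 := fun i => abs_le.1 (hh i)
    refine ⟨⟨fun i => ?_, fun i => ?_⟩, fun i => ?_, fun i => ?_⟩ <;>
    · have := h1 i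
      have := hs.1 i
      have := hs.2 i
      omega
  have hc := Finset.card_le_card hsub
  rw [Pi.card_Icc] at hc
  have hprod : (0 : ℝ) < ∏ i, (n i : ℝ) := Finset.prod_pos fun i _ => by exact_mod_cast hn i
  rw [card_region, Nat.cast_prod, le_div_iff₀ hprod, ← Finset.prod_mul_distrib]
  refine le_trans (le_of_eq ?_) (Nat.cast_le.2 hc)
  rw [Nat.cast_prod]
  refine Finset.prod_congr rfl fun i _ => ?_
  have hni : (n i : ℝ) ≠ 0 := by exact_mod_cast (hn i).ne'
  have e : (Finset.Icc (1 + (K : ℤ)) ((n i : ℤ) - K)).card = n i - 2 * K := by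
    rw [Int.card_Icc]
    omega
  rw [e, Nat.cast_sub (hK i), sub_mul, one_mul]
  push_cast
  field_simp

theorem tendsto_one_sub_prod {n : ℕ → Fin d → ℕ} {L' : ℕ → ℕ}
    (h : ∀ i, (fun k => (L' k : ℝ)) =o[atTop] (fun k => (n k i : ℝ))) :
    Tendsto (fun k => 1 - ∏ i, (1 - 2 * (L' k / n k i : ℝ))) atTop (𝓝 0) := by
  have h1 : ∀ i ∈ (Finset.univ : Finset (Fin d)),
      Tendsto (fun k => 1 - 2 * (L' k / n k i : ℝ)) atTop (𝓝 (1 - 2 * 0)) := fun i _ =>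
    ((h i).tendsto_div_nhds_zero.const_mul 2).const_sub 1
  have h2 := (tendsto_finsetProd Finset.univ h1).const_sub 1
  simpa using h2

/-- The ratio is a product of d factors tending to 0; for d = 0 it would be identically 1. -/
theorem tendsto_card_box_div_card_region (hd : 0 < d) {n : ℕ → Fin d → ℕ} {L' : ℕ → ℕ}
    (hn : ∀ i, Tendsto (fun k => n k i) atTop atTop)
    (h : ∀ i, (fun k => (L' k : ℝ)) =o[atTop] (fun k => (n k i : ℝ))) :
    Tendsto (fun k => ((box d (L' k)).card : ℝ) / (region (n k)).card) atTop (𝓝 0) := by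
  have h1 : ∀ i ∈ (Finset.univ : Finset (Fin d)),
      Tendsto (fun k => 2 * (L' k / n k i : ℝ) + ((n k i : ℝ))⁻¹) atTop (𝓝 (2 * 0 + 0)) := fun i _ =>
    ((h i).tendsto_div_nhds_zero.const_mul 2).add
      (tendsto_inv_atTop_zero.comp (tendsto_natCast_atTop_atTop.comp (hn i)))
  have h2 := tendsto_finsetProd Finset.univ h1
  simp only [mul_zero, add_zero, Finset.prod_const, Finset.card_univ, Fintype.card_fin,
    zero_pow hd.ne'] at h2
  refine h2.congr fun k => ?_
  rw [card_box, card_region, Nat.cast_prod, Nat.cast_pow]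
  have : ((2 * L' k + 1 : ℕ) : ℝ) ^ d = ∏ _i : Fin d, ((2 * L' k + 1 : ℕ) : ℝ) := by simp
  rw [this, ← Finset.prod_div_distrib]
  refine Finset.prod_congr rfl fun i _ => ?_
  push_cast
  rw [add_div, mul_div_assoc, one_div]

end Counting

/-! ### Convergence in probability of the random error terms -/

section Markov

variable {Ω : Type*} [MeasurableSpace Ω] {P : Measure Ω}

theorem tendsto_probFilter_of_lintegral_enorm_le {f : ℕ → Ω → ℝ} (hf : ∀ k, AEMeasurable (f k) P)
    {b : ℕ → ℝ} (hb : ∀ᶠ k in atTop, ∫⁻ ω, ‖f k ω‖ₑ ∂P ≤ ENNReal.ofReal (b k))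
    (h : Tendsto b atTop (𝓝 0)) :
    Tendsto (fun x : ℕ × Ω => f x.1 x.2) (probFilter P) (𝓝 0) := by
  have h1 : Tendsto (fun k => ∫⁻ ω, ‖f k ω‖ₑ ∂P) atTop (𝓝 0) := by
    have h2 := ENNReal.tendsto_ofReal h
    rw [ENNReal.ofReal_zero] at h2
    exact tendsto_of_tendsto_of_tendsto_of_le_of_le' tendsto_const_nhds h2
      (Eventually.of_forall fun _ => zero_le) hb
  have h2 := tendsto_probFilter_of_lintegral (fun k => (hf k).enorm) h1
  exact tendsto_zero_iff_enorm_tendsto_zero.2 h2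

theorem lintegral_enorm_sum_mul_norm_sq_le {ι E : Type*} [NormedAddCommGroup E] {F : ι → Ω → E}
    (I : Finset ι) {w : ι → ℝ} (hw : ∀ i ∈ I, 0 ≤ w i)
    (hF : ∀ i ∈ I, AEStronglyMeasurable (F i) P) {b : ℝ}
    (hb : ∀ i ∈ I, ∫⁻ ω, ‖F i ω‖ₑ ^ 2 ∂P ≤ ENNReal.ofReal b) :
    ∫⁻ ω, ‖∑ i ∈ I, w i * ‖F i ω‖ ^ 2‖ₑ ∂P ≤ ENNReal.ofReal ((∑ i ∈ I, w i) * b) := by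
  have h1 : ∀ ω, ‖∑ i ∈ I, w i * ‖F i ω‖ ^ 2‖ₑ =
      ∑ i ∈ I, ENNReal.ofReal (w i) * ‖F i ω‖ₑ ^ 2 := by
    intro ω
    rw [Real.enorm_of_nonneg (Finset.sum_nonneg fun i hi => mul_nonneg (hw i hi) (sq_nonneg _)),
      ENNReal.ofReal_sum_of_nonneg fun i hi => mul_nonneg (hw i hi) (sq_nonneg _)]
    refine Finset.sum_congr rfl fun i hi => ?_
    rw [ENNReal.ofReal_mul (hw i hi), enorm_sq_eq_ofReal]
  simp_rw [h1]
  rw [lintegral_finsetSum' _ fun i hi => (((hF i hi).enorm.pow_const 2).const_mul _)]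
  rw [ENNReal.ofReal_mul (Finset.sum_nonneg hw), ENNReal.ofReal_sum_of_nonneg hw, Finset.sum_mul]
  refine Finset.sum_le_sum fun i hi => ?_
  rw [lintegral_const_mul'' _ ((hF i hi).enorm.pow_const 2)]
  gcongr
  exact hb i hi

theorem aemeasurable_sum_mul_norm_sq {ι E : Type*} [NormedAddCommGroup E] {F : ι → Ω → E}
    (I : Finset ι) {w : ι → ℝ} (hF : ∀ i ∈ I, AEStronglyMeasurable (F i) P) :
    AEMeasurable (fun ω => ∑ i ∈ I, w i * ‖F i ω‖ ^ 2) P := by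
  refine Finset.aemeasurable_fun_sum I fun i hi => ?_
  exact ((hF i hi).norm.aemeasurable.pow_const 2).const_mul _

end Markov

section NoiseEnergy

variable {Ω G E : Type*} [MeasurableSpace Ω] {P : Measure Ω} [IsProbabilityMeasure P]
  [AddCommGroup G] [NormedAddCommGroup E] [InnerProductSpace ℝ E] [CompleteSpace E]
  [TopologicalSpace.SeparableSpace E]
  {M : Submodule ℝ (Lp ℝ 2 P)} {Z : G → Ω → E} {C : G → E →L[ℝ] E}

theorem noiseEnergy_eq (S : G → Finset G) (J' J : Finset G) (ω : Ω) :
    noiseEnergy Z C S J' J ω =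
      ∑ q ∈ (Finset.insertNone J ×ˢ Finset.insertNone J) ×ˢ J',
        lagWeight J q.1.1 * lagWeight J q.1.2 *
          ‖noise Z C (S q.2) (q.2 - lagShift q.1.1) (-lagShift q.1.2) ω‖ ^ 2 := by
  rw [Finset.sum_product, noiseEnergy]
  simp_rw [Finset.mul_sum]

theorem IsStationaryIn.aemeasurable_noiseEnergy (hZ : IsStationaryIn M Z C) (S : G → Finset G)
    (J' J : Finset G) : AEMeasurable (noiseEnergy Z C S J' J) P := by
  have : noiseEnergy Z C S J' J = _ := funext fun ω => noiseEnergy_eq S J' J ω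
  rw [this]
  exact aemeasurable_sum_mul_norm_sq _ fun q _ => hZ.aestronglyMeasurable_noise _ _ _

/-- The constant is 12 = 3 · 2²: the factor 3 from the mean square of the noise and total weight at
most 2 in each coefficient. -/
theorem IsStationaryIn.lintegral_enorm_noiseEnergy_le (hM : ∀ f ∈ M, IsCenteredGaussian f)
    (hZ : IsStationaryIn M Z C) {ν : G → ℝ≥0∞} (hν : ∀ h, HasNuclearBound (C h) (ν h)) {K : ℝ}
    (hK : ∑' h, ν h ^ 2 ≤ ENNReal.ofReal K) (hK0 : 0 ≤ K)
    (S : G → Finset G) (J' J : Finset G) {N : ℕ} (hN : ∀ h ∈ J', (S h).card ≤ N) :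
    ∫⁻ ω, ‖noiseEnergy Z C S J' J ω‖ₑ ∂P ≤ ENNReal.ofReal (12 * J'.card * N * K) := by
  simp_rw [noiseEnergy_eq]
  refine (lintegral_enorm_sum_mul_norm_sq_le _
    (fun q _ => mul_nonneg (lagWeight_nonneg _ _) (lagWeight_nonneg _ _))
    (fun q _ => hZ.aestronglyMeasurable_noise _ _ _) (b := 3 * (N * K)) fun q hq => ?_).trans ?_
  · refine (IsStationaryIn.lintegral_enorm_noise_sq_le hM hZ hν _ _ _).trans ?_
    rw [ENNReal.ofReal_mul (by norm_num), ENNReal.ofReal_mul (by positivity),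
      ENNReal.ofReal_natCast]
    have h1 : ((S q.2).card : ℝ≥0∞) ≤ N := by exact_mod_cast hN _ (Finset.mem_product.1 hq).2
    rw [show ENNReal.ofReal 3 = 3 by simp]
    gcongr
  · refine ENNReal.ofReal_le_ofReal ?_
    have h1 : ∑ q ∈ (Finset.insertNone J ×ˢ Finset.insertNone J) ×ˢ J',
        lagWeight J q.1.1 * lagWeight J q.1.2 ≤ 4 * J'.card := by
      rw [Finset.sum_product]
      simp only [Finset.sum_const, nsmul_eq_mul]
      rw [← Finset.mul_sum, Finset.sum_product, ← Finset.sum_mul_sum, mul_comm]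
      refine mul_le_mul_of_nonneg_right ?_ (Nat.cast_nonneg _)
      have h1 := sum_lagWeight_le J
      have h2 : 0 ≤ ∑ i ∈ Finset.insertNone J, lagWeight J i :=
        Finset.sum_nonneg fun i _ => lagWeight_nonneg J i
      nlinarith
    calc _ ≤ (4 * J'.card : ℝ) * (3 * (N * K)) := mul_le_mul_of_nonneg_right h1 (by positivity)
      _ = _ := by ring

end NoiseEnergy

/-! ### Consistency for a filtered stationary Gaussian field -/

section Moments

variable {Ω : Type*} [MeasurableSpace Ω] {P : Measure Ω} [IsProbabilityMeasure P]
variable {E : Type*} [NormedAddCommGroup E] [InnerProductSpace ℝ E] [CompleteSpace E]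
variable {G : Type*} [AddCommGroup G]
variable {M : Submodule ℝ (Lp ℝ 2 P)} {X : G → Ω → E} {C : G → E →L[ℝ] E} {c : G → ℝ} {a : G → E}

theorem norm_unitVec : ‖unitVec E‖ = 1 := by
  have h : ‖unitVec E‖ ^ 2 = 1 ^ 2 := by
    rw [WithLp.prod_norm_sq_eq_of_L2]
    simp [unitVec]
  exact (sq_eq_sq₀ (norm_nonneg _) zero_le_one).1 h

/-- The nuclear bound at h consists of the row, the column and the block of X. The first two are
square summable by duality, the last because it is even summable. -/
theorem exists_summable_bound_pairCov (hX : IsStationaryIn M X C) (hc : Summable c)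
    (hC : ∀ h, ‖C h‖ ≤ c h) (ha : Summable fun l => ‖a l‖ ^ 2)
    (hM : IsClosed (M : Set (Lp ℝ 2 P)))
    (hconv : ∀ (S F : Finset G) (α : G → ℝ),
      ∑ u ∈ F, ‖∑ s ∈ S, α s • a (s + u)‖ ^ 2 ≤ ∑ s ∈ S, α s ^ 2)
    {τ : G → ℝ≥0∞} (hτ : ∀ h, HasNuclearBound (C h) (τ h)) (hτs : ∑' h, τ h ≠ ∞) :
    ∃ κ : G → ℝ, (Summable fun h => κ h ^ 2) ∧
      (∀ h, HasNuclearBound (pairCov hX a h) (ENNReal.ofReal (κ h))) ∧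
      ∀ h, ‖pairCov hX a h‖ ≤ κ h := by
  have hfin : ∀ h, τ h ≠ ∞ := fun h => ne_top_of_le_ne_top hτs (ENNReal.le_tsum h)
  set v : G → ℝ := fun h => ‖pairCov hX a h (unitVec E)‖ with hv
  have hvs : Summable fun h => v h ^ 2 := summable_of_sum_le (fun _ => sq_nonneg _) fun F =>
    sum_norm_pairCov_sq_le hX hc hC ha hM hconv F (unitVec E)
  have hvs' : Summable fun h => v (-h) ^ 2 := (Equiv.neg G).summable_iff.2 hvs
  have hts : Summable fun h => (τ h).toReal ^ 2 := by
    have h1 := ENNReal.summable_toReal hτs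
    have h2 : ∀ h, (τ h).toReal ^ 2 ≤ (∑' h, (τ h).toReal) * (τ h).toReal := fun h => by
      rw [sq]
      exact mul_le_mul_of_nonneg_right (h1.le_tsum h fun _ _ => ENNReal.toReal_nonneg)
        ENNReal.toReal_nonneg
    exact (h1.mul_left _).of_nonneg_of_le (fun _ => sq_nonneg _) h2
  have hnb : ∀ h, HasNuclearBound (pairCov hX a h)
      (ENNReal.ofReal (v (-h) + v h + (τ h).toReal)) := by
    intro h
    have h1 := hasNuclearBound_pairCov hX hc hC ha hM (hτ h)
    rw [ENNReal.ofReal_add (by positivity) ENNReal.toReal_nonneg,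
      ENNReal.ofReal_add (by positivity) (by positivity), ENNReal.ofReal_toReal (hfin h)]
    simpa [hv, ofReal_norm] using h1
  refine ⟨fun h => v (-h) + v h + (τ h).toReal, ?_, hnb, fun h => ?_⟩
  · refine (((hvs'.add hvs).add hts).mul_left 3).of_nonneg_of_le (fun _ => sq_nonneg _) fun h => ?_
    nlinarith [sq_nonneg (v (-h) - v h), sq_nonneg (v (-h) - (τ h).toReal),
      sq_nonneg (v h - (τ h).toReal)]
  · have h1 := (hnb h).enorm_le
    rw [← ofReal_norm] at h1
    exact (ENNReal.ofReal_le_ofReal_iff (by positivity)).1 h1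

theorem inner_unitVec_pairCov (hX : IsStationaryIn M X C) (a : G → E) (h : G) :
    inner ℝ (unitVec E) (pairCov hX a h (unitVec E)) =
      inner ℝ (filtered hX a h) (filtered hX a 0) := by
  have h0 : ∀ s, proj (hX.memLp_pairField a s) (unitVec E) = filtered hX a s := by
    intro s
    have h1 : proj (hX.memLp s) (0 : E) = 0 := by
      simpa using proj_smul (hX.memLp s) 0 (0 : E)
    rw [hX.proj_pairField]
    simp [unitVec, h1]
  rw [pairCov, inner_crossCov (hX.memLp_pairField a h) (hX.memLp_pairField a 0), h0, h0]

theorem aestronglyMeasurable_truncation (hX : IsStationaryIn M X C) (a : G → E) (F : Finset G)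
    (s : G) : AEStronglyMeasurable
      (fun ω => filtered hX a s ω - ∑ l ∈ F, inner ℝ (a l) (X (s - l) ω)) P := by
  refine (Lp.aestronglyMeasurable _).sub (Finset.aestronglyMeasurable_fun_sum F fun l _ => ?_)
  exact aestronglyMeasurable_const.inner (hX.memLp _).1

theorem lintegral_enorm_truncation_sq_le (hX : IsStationaryIn M X C) (hc : Summable c)
    (hC : ∀ h, ‖C h‖ ≤ c h) (ha : Summable fun l => ‖a l‖ ^ 2) (F : Finset G) (s : G) :
    ∫⁻ ω, ‖filtered hX a s ω - ∑ l ∈ F, inner ℝ (a l) (X (s - l) ω)‖ₑ ^ 2 ∂P ≤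
      ENNReal.ofReal ((∑' h, c h) * ∑' l : {l // l ∉ F}, ‖a l‖ ^ 2) := by
  refine le_trans (le_of_eq ?_)
    (ENNReal.ofReal_le_ofReal (hX.norm_filtered_sub_sum_sq_le hc hC ha s F))
  rw [← enorm_sq_eq_ofReal, ← lintegral_enorm_sq_lp]
  refine lintegral_congr_ae ?_
  filter_upwards [Lp.coeFn_sub (filtered hX a s) (∑ l ∈ F, proj (hX.memLp (s - l)) (a l)),
    coeFn_lp_sum F fun l => proj (hX.memLp (s - l)) (a l),
    (eventually_all_finset F).2 fun l _ => coeFn_proj (hX.memLp (s - l)) (a l)] with ω h1 h2 h3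
  rw [h1, Pi.sub_apply, h2, Finset.sum_congr rfl h3]

/-- The ℓ² bound for linear forms in Y with constant weights 1/|R|, whose squares sum to 1/|R|. -/
theorem lintegral_enorm_mean_filtered_sq_le (hX : IsStationaryIn M X C) (hc : Summable c)
    (hC : ∀ h, ‖C h‖ ≤ c h) (ha : Summable fun l => ‖a l‖ ^ 2)
    (hconv : ∀ (S F : Finset G) (α : G → ℝ),
      ∑ u ∈ F, ‖∑ s ∈ S, α s • a (s + u)‖ ^ 2 ≤ ∑ s ∈ S, α s ^ 2) (R : Finset G) :
    ∫⁻ ω, ‖(R.card : ℝ)⁻¹ * ∑ s ∈ R, filtered hX a s ω‖ₑ ^ 2 ∂P ≤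
      ENNReal.ofReal ((∑' h, c h) * (R.card : ℝ)⁻¹) := by
  have h0 := hX.norm_sum_smul_filtered_sq_le hc hC ha hconv R fun _ => (R.card : ℝ)⁻¹
  have h1 : ∑ s ∈ R, ((R.card : ℝ)⁻¹) ^ 2 = (R.card : ℝ)⁻¹ := by
    rw [Finset.sum_const, nsmul_eq_mul]
    rcases eq_or_ne (R.card : ℝ) 0 with h | h
    · simp [h]
    · field_simp
  rw [h1] at h0
  refine le_trans (le_of_eq ?_) (ENNReal.ofReal_le_ofReal h0)
  rw [← enorm_sq_eq_ofReal, ← lintegral_enorm_sq_lp]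
  refine lintegral_congr_ae ?_
  filter_upwards [coeFn_lp_sum R fun s => (R.card : ℝ)⁻¹ • filtered hX a s,
    (eventually_all_finset R).2 fun s _ => Lp.coeFn_smul (R.card : ℝ)⁻¹ (filtered hX a s)]
    with ω h1 h2
  rw [h1, Finset.sum_congr rfl h2, Finset.mul_sum]
  rfl

theorem lintegral_enorm_mean_sq_le [TopologicalSpace.SeparableSpace E]
    (hX : IsStationaryIn M X C) {τ : G → ℝ≥0∞}
    (hτ : ∀ h, HasNuclearBound (C h) (τ h)) (hτs : ∑' h, τ h ≠ ∞) (R : Finset G) (b : G) :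
    ∫⁻ ω, ‖(R.card : ℝ)⁻¹ • ∑ s ∈ R, X (s + b) ω‖ₑ ^ 2 ∂P ≤
      ENNReal.ofReal ((∑' h, τ h).toReal * (R.card : ℝ)⁻¹) := by
  simp_rw [enorm_smul, mul_pow]
  have hm : AEMeasurable (fun ω => ‖∑ s ∈ R, X (s + b) ω‖ₑ ^ 2) P :=
    (Finset.aestronglyMeasurable_fun_sum R fun s _ => (hX.memLp _).1).enorm.pow_const 2
  rw [lintegral_const_mul'' _ hm]
  refine (mul_le_mul_right (hX.lintegral_enorm_sum_sq_le hτ R b) _).trans (le_of_eq ?_)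
  rw [enorm_sq_eq_ofReal, ← ENNReal.ofReal_natCast R.card, ← ENNReal.ofReal_toReal hτs,
    ← ENNReal.ofReal_mul (by positivity), ← ENNReal.ofReal_mul (by positivity),
    ENNReal.toReal_ofReal ENNReal.toReal_nonneg]
  congr 1
  rw [Real.norm_eq_abs, sq_abs]
  rcases eq_or_ne (R.card : ℝ) 0 with h | h
  · simp [h]
  · field_simp

end Moments

/-! ### Limits in probability of the separate error terms. -/

section Consistency

variable {Ω : Type*} [MeasurableSpace Ω] {P : Measure Ω} [IsProbabilityMeasure P]
variable {E : Type*} [NormedAddCommGroup E] [InnerProductSpace ℝ E]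
variable {d : ℕ}

/-- Exchanging sums pairs each coefficient error with a mean of translated observations;
Cauchy–Schwarz then separates the sample-dependent `Δ` from quantities whose second moments are
known. -/
theorem sampleMean_add_sq_le (n : Fin d → ℕ) (J : Finset (Fin d → ℤ)) {g : ℝ}
    (Y : (Fin d → ℤ) → ℝ) {Δ : (Fin d → ℤ) → E} (x : (Fin d → ℤ) → E)
    (hΔ : ∀ l ∈ J, ‖Δ l‖ ≤ g) :
    sampleMean n (fun s => Y s + ∑ l ∈ J, inner ℝ (Δ l) (x (s - l))) ^ 2 ≤
      2 * sampleMean n Y ^ 2 + 2 * ((J.card * g) ^ 2 *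
        ((J.card : ℝ)⁻¹ * ∑ l ∈ J, ‖((region n).card : ℝ)⁻¹ • ∑ s ∈ region n, x (s + -l)‖ ^ 2)) := by
  set y : (Fin d → ℤ) → E := fun l => ((region n).card : ℝ)⁻¹ • ∑ s ∈ region n, x (s + -l) with hy
  have e : sampleMean n (fun s => Y s + ∑ l ∈ J, inner ℝ (Δ l) (x (s - l))) =
      sampleMean n Y + ∑ l ∈ J, inner ℝ (Δ l) (y l) := by
    simp only [sampleMean, Finset.sum_add_distrib, mul_add, hy, real_inner_smul_right, inner_sum]
    rw [Finset.sum_comm]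
    simp only [sub_eq_add_neg, Finset.mul_sum]
  have h1 : (∑ l ∈ J, inner ℝ (Δ l) (y l)) ^ 2 ≤ J.card * ∑ l ∈ J, (inner ℝ (Δ l) (y l)) ^ 2 :=
    sq_sum_le_card_mul_sum_sq
  have h2 : ∑ l ∈ J, (inner ℝ (Δ l) (y l)) ^ 2 ≤ ∑ l ∈ J, g ^ 2 * ‖y l‖ ^ 2 := by
    refine Finset.sum_le_sum fun l hl => ?_
    rw [← sq_abs, ← mul_pow]
    refine pow_le_pow_left₀ (abs_nonneg _) ((abs_real_inner_le_norm _ _).trans ?_) 2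
    exact mul_le_mul_of_nonneg_right (hΔ l hl) (norm_nonneg _)
  have h3 : (J.card : ℝ) * ∑ l ∈ J, g ^ 2 * ‖y l‖ ^ 2 =
      (J.card * g) ^ 2 * ((J.card : ℝ)⁻¹ * ∑ l ∈ J, ‖y l‖ ^ 2) := by
    rw [← Finset.mul_sum]
    rcases eq_or_ne (J.card : ℝ) 0 with h | h
    · simp [h]
    · field_simp
  have h4 : (∑ l ∈ J, inner ℝ (Δ l) (y l)) ^ 2 ≤
      (J.card * g) ^ 2 * ((J.card : ℝ)⁻¹ * ∑ l ∈ J, ‖y l‖ ^ 2) :=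
    h3 ▸ h1.trans (mul_le_mul_of_nonneg_left h2 (Nat.cast_nonneg _))
  rw [e]
  nlinarith [sq_nonneg (sampleMean n Y - ∑ l ∈ J, inner ℝ (Δ l) (y l))]

variable [CompleteSpace E]
variable {M : Submodule ℝ (Lp ℝ 2 P)} {X : (Fin d → ℤ) → Ω → E} {C : (Fin d → ℤ) → E →L[ℝ] E}
variable {c : (Fin d → ℤ) → ℝ} {a : (Fin d → ℤ) → E}
variable {n : ℕ → Fin d → ℕ} {L L' : ℕ → ℕ}

theorem tendsto_truncation (hX : IsStationaryIn M X C) (hc : Summable c)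
    (hC : ∀ h, ‖C h‖ ≤ c h) (ha : Summable fun l => ‖a l‖ ^ 2) (n : ℕ → Fin d → ℕ) {w : ℕ → ℝ}
    (hw : ∀ k, 0 ≤ w k)
    (htail : Tendsto (fun k => w k * ∑' l : {l // l ∉ box d (L k)}, ‖a l‖ ^ 2) atTop (𝓝 0)) :
    Tendsto (fun x : ℕ × Ω => ∑ s ∈ region (n x.1), w x.1 * ((region (n x.1)).card : ℝ)⁻¹ *
      ‖filtered hX a s x.2 - ∑ l ∈ box d (L x.1), inner ℝ (a l) (X (s - l) x.2)‖ ^ 2)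
      (probFilter P) (𝓝 0) := by
  have hK : 0 ≤ ∑' h, c h := tsum_nonneg fun h => (norm_nonneg _).trans (hC h)
  refine tendsto_probFilter_of_lintegral_enorm_le (f := fun k ω => ∑ s ∈ region (n k),
    w k * ((region (n k)).card : ℝ)⁻¹ *
      ‖filtered hX a s ω - ∑ l ∈ box d (L k), inner ℝ (a l) (X (s - l) ω)‖ ^ 2)
    (b := fun k => (∑' h, c h) * (w k * ∑' l : {l // l ∉ box d (L k)}, ‖a l‖ ^ 2))
    (fun k => aemeasurable_sum_mul_norm_sq _ fun s _ => aestronglyMeasurable_truncation hX a _ s)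
    (Eventually.of_forall fun k => ?_) (by simpa using htail.const_mul (∑' h, c h))
  refine (lintegral_enorm_sum_mul_norm_sq_le _ (fun s _ => mul_nonneg (hw k) (by positivity))
    (fun s _ => aestronglyMeasurable_truncation hX a _ s)
    (fun s _ => lintegral_enorm_truncation_sq_le hX hc hC ha _ s)).trans ?_
  refine ENNReal.ofReal_le_ofReal ?_
  rw [Finset.sum_const, nsmul_eq_mul]
  have h1 : ((region (n k)).card : ℝ) * (w k * ((region (n k)).card : ℝ)⁻¹) ≤ w k := by
    rw [mul_left_comm]
    exact mul_le_of_le_one_right (hw k) mul_inv_le_one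
  have h2 : 0 ≤ ∑' l : {l // l ∉ box d (L k)}, ‖a l‖ ^ 2 := tsum_nonneg fun _ => sq_nonneg _
  calc _ ≤ w k * ((∑' h, c h) * ∑' l : {l // l ∉ box d (L k)}, ‖a l‖ ^ 2) :=
        mul_le_mul_of_nonneg_right h1 (mul_nonneg hK h2)
    _ = _ := by ring

theorem tendsto_sampleMean_filtered (hX : IsStationaryIn M X C) (hc : Summable c)
    (hC : ∀ h, ‖C h‖ ≤ c h) (ha : Summable fun l => ‖a l‖ ^ 2)
    (hconv : ∀ (S F : Finset (Fin d → ℤ)) (α : (Fin d → ℤ) → ℝ),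
      ∑ u ∈ F, ‖∑ s ∈ S, α s • a (s + u)‖ ^ 2 ≤ ∑ s ∈ S, α s ^ 2) {w : ℕ → ℝ}
    (hw : ∀ k, 0 ≤ w k)
    (hwN : Tendsto (fun k => w k * ((region (n k)).card : ℝ)⁻¹) atTop (𝓝 0)) :
    Tendsto (fun x : ℕ × Ω => w x.1 * sampleMean (n x.1) (fun s => filtered hX a s x.2) ^ 2)
      (probFilter P) (𝓝 0) := by
  have hm : ∀ k, AEStronglyMeasurable
      (fun ω => ((region (n k)).card : ℝ)⁻¹ * ∑ s ∈ region (n k), filtered hX a s ω) P := fun k =>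
    (Finset.aestronglyMeasurable_fun_sum _ fun s _ => Lp.aestronglyMeasurable _).const_mul _
  refine tendsto_probFilter_of_lintegral_enorm_le
    (f := fun k ω => w k * sampleMean (n k) (fun s => filtered hX a s ω) ^ 2)
    (b := fun k => (∑' h, c h) * (w k * ((region (n k)).card : ℝ)⁻¹))
    (fun k => ((hm k).aemeasurable.pow_const 2).const_mul _)
    (Eventually.of_forall fun k => ?_) (by simpa using hwN.const_mul (∑' h, c h))
  -- A one-element index set reduces a single weighted square to the bound for weighted sums.
  have h1 := lintegral_enorm_sum_mul_norm_sq_le (Finset.univ : Finset Unit) (w := fun _ => w k)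
    (fun _ _ => hw k) (fun _ _ => hm k)
    (fun _ _ => lintegral_enorm_mean_filtered_sq_le hX hc hC ha hconv (region (n k)))
  simp only [Finset.univ_unique, Finset.sum_singleton, Real.norm_eq_abs, sq_abs] at h1
  refine h1.trans (le_of_eq ?_)
  congr 1
  ring

theorem tendsto_sampleMean [TopologicalSpace.SeparableSpace E]
    (hX : IsStationaryIn M X C) {τ : (Fin d → ℤ) → ℝ≥0∞}
    (hτ : ∀ h, HasNuclearBound (C h) (τ h)) (hτs : ∑' h, τ h ≠ ∞)
    (J : ℕ → Finset (Fin d → ℤ)) {w : ℕ → ℝ} (hw : ∀ k, 0 ≤ w k)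
    (hwN : Tendsto (fun k => w k * ((region (n k)).card : ℝ)⁻¹) atTop (𝓝 0)) :
    Tendsto (fun x : ℕ × Ω => ∑ l ∈ J x.1, w x.1 * ((J x.1).card : ℝ)⁻¹ *
      ‖((region (n x.1)).card : ℝ)⁻¹ • ∑ s ∈ region (n x.1), X (s + -l) x.2‖ ^ 2)
      (probFilter P) (𝓝 0) := by
  have hm : ∀ k l, AEStronglyMeasurable
      (fun ω => ((region (n k)).card : ℝ)⁻¹ • ∑ s ∈ region (n k), X (s + -l) ω) P := fun k l =>
    (Finset.aestronglyMeasurable_fun_sum _ fun s _ => (hX.memLp _).1).const_smul _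
  refine tendsto_probFilter_of_lintegral_enorm_le
    (f := fun k ω => ∑ l ∈ J k, w k * ((J k).card : ℝ)⁻¹ *
      ‖((region (n k)).card : ℝ)⁻¹ • ∑ s ∈ region (n k), X (s + -l) ω‖ ^ 2)
    (b := fun k => (∑' h, τ h).toReal * (w k * ((region (n k)).card : ℝ)⁻¹))
    (fun k => aemeasurable_sum_mul_norm_sq _ fun l _ => hm k l)
    (Eventually.of_forall fun k => ?_) (by simpa using hwN.const_mul (∑' h, τ h).toReal)
  refine (lintegral_enorm_sum_mul_norm_sq_le _ (fun s _ => mul_nonneg (hw k) (by positivity))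
    (fun l _ => hm k l) (fun l _ => lintegral_enorm_mean_sq_le hX hτ hτs _ _)).trans ?_
  refine ENNReal.ofReal_le_ofReal ?_
  rw [Finset.sum_const, nsmul_eq_mul]
  have h1 : ((J k).card : ℝ) * (w k * ((J k).card : ℝ)⁻¹) ≤ w k := by
    rw [mul_left_comm]
    exact mul_le_of_le_one_right (hw k) mul_inv_le_one
  calc _ ≤ w k * ((∑' h, τ h).toReal * ((region (n k)).card : ℝ)⁻¹) :=
        mul_le_mul_of_nonneg_right h1 (by positivity)
    _ = _ := by ring

/-- The expected energy is of order |J'| N, so division by N² leaves |J'| / N, whatever the size of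
`J`. -/
theorem tendsto_noiseEnergy {F : Type*} [NormedAddCommGroup F] [InnerProductSpace ℝ F]
    [CompleteSpace F] [TopologicalSpace.SeparableSpace F] {Z : (Fin d → ℤ) → Ω → F}
    {D : (Fin d → ℤ) → F →L[ℝ] F} (hG : ∀ f ∈ M, IsCenteredGaussian f)
    (hZ : IsStationaryIn M Z D) {κ : (Fin d → ℤ) → ℝ}
    (hκ : ∀ h, HasNuclearBound (D h) (ENNReal.ofReal (κ h))) (hκ0 : ∀ h, 0 ≤ κ h)
    (hκs : Summable fun h => κ h ^ 2) (J' J : ℕ → Finset (Fin d → ℤ))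
    (hJN : Tendsto (fun k => ((J' k).card : ℝ) / (region (n k)).card) atTop (𝓝 0)) :
    Tendsto (fun x : ℕ × Ω => (((region (n x.1)).card : ℝ)⁻¹) ^ 2 *
      noiseEnergy Z D (fun h => (region (n x.1)).filter (fun s => s + h ∈ region (n x.1)))
        (J' x.1) (J x.1) x.2) (probFilter P) (𝓝 0) := by
  have hK : ∑' h, ENNReal.ofReal (κ h) ^ 2 ≤ ENNReal.ofReal (∑' h, κ h ^ 2) := by
    rw [ENNReal.ofReal_tsum_of_nonneg (fun _ => sq_nonneg _) hκs]
    simp_rw [ENNReal.ofReal_pow (hκ0 _)]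
    exact le_rfl
  have hK0 : 0 ≤ ∑' h, κ h ^ 2 := tsum_nonneg fun _ => sq_nonneg _
  refine tendsto_probFilter_of_lintegral_enorm_le
    (f := fun k ω => (((region (n k)).card : ℝ)⁻¹) ^ 2 *
      noiseEnergy Z D (fun h => (region (n k)).filter (fun s => s + h ∈ region (n k)))
        (J' k) (J k) ω)
    (b := fun k => (12 * ∑' h, κ h ^ 2) * (((J' k).card : ℝ) / (region (n k)).card))
    (fun k => (hZ.aemeasurable_noiseEnergy _ _ _).const_mul _)
    (Eventually.of_forall fun k => ?_) (by simpa using hJN.const_mul (12 * ∑' h, κ h ^ 2))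
  simp_rw [enorm_mul]
  rw [lintegral_const_mul'' _ (hZ.aemeasurable_noiseEnergy _ _ _).enorm,
    Real.enorm_of_nonneg (by positivity)]
  refine (mul_le_mul_right (hZ.lintegral_enorm_noiseEnergy_le hG hκ hK hK0 _ _ _
    (N := (region (n k)).card) fun h _ => Finset.card_le_card (Finset.filter_subset _ _)) _).trans ?_
  rw [← ENNReal.ofReal_mul (by positivity)]
  refine ENNReal.ofReal_le_ofReal (le_of_eq ?_)
  rcases eq_or_ne ((region (n k)).card : ℝ) 0 with h | h
  · simp [h]
  · field_simp

end Consistency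

/-! ### Consistency of sums of powers of sample autocovariances. -/

section PowerSums

variable {Ω : Type*} [MeasurableSpace Ω] {P : Measure Ω} [IsProbabilityMeasure P]
variable {E : Type*} [NormedAddCommGroup E] [InnerProductSpace ℝ E] [CompleteSpace E]
variable {d : ℕ}
variable {M : Submodule ℝ (Lp ℝ 2 P)} {X : (Fin d → ℤ) → Ω → E} {C : (Fin d → ℤ) → E →L[ℝ] E}
variable {c : (Fin d → ℤ) → ℝ} {a : (Fin d → ℤ) → E}
variable {n : ℕ → Fin d → ℕ} {L L' : ℕ → ℕ}

theorem abs_inner_filtered_le (hX : IsStationaryIn M X C) (a : (Fin d → ℤ) → E)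
    (h : Fin d → ℤ) : |inner ℝ (filtered hX a h) (filtered hX a 0)| ≤ ‖pairCov hX a h‖ := by
  rw [← inner_unitVec_pairCov]
  refine (abs_real_inner_le_norm _ _).trans ?_
  rw [norm_unitVec, one_mul]
  simpa [norm_unitVec] using (pairCov hX a h).le_opNorm (unitVec E)

/-- A square summable family is bounded, so further powers only cost a constant. -/
theorem summable_pow_of_summable_sq {ι : Type*} {γ κ : ι → ℝ} (hγ : ∀ h, |γ h| ≤ κ h)
    (hκ : Summable fun h => κ h ^ 2) {r : ℕ} (hr : 2 ≤ r) : Summable fun h => γ h ^ r := by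
  have h1 : ∀ h, κ h ≤ √(∑' h, κ h ^ 2) := fun h =>
    Real.le_sqrt_of_sq_le (hκ.le_tsum h fun _ _ => sq_nonneg _)
  obtain ⟨q, rfl⟩ := Nat.exists_eq_add_of_le hr
  refine Summable.of_norm_bounded (hκ.mul_right (√(∑' h, κ h ^ 2) ^ q)) fun h => ?_
  have h2 := abs_nonneg (γ h)
  have h3 := hγ h
  rw [norm_pow, Real.norm_eq_abs, pow_add]
  exact mul_le_mul (pow_le_pow_left₀ h2 h3 2) (pow_le_pow_left₀ h2 (h3.trans (h1 h)) q)
    (by positivity) (by positivity)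

theorem exists_bounds_of_summable_sq {ι : Type*} {γ δ κ : ι → ℝ}
    (hγ : ∀ h, |γ h| ≤ κ h) (hδ0 : ∀ h, 0 ≤ δ h) (hδ : ∀ h, δ h ≤ κ h)
    (hκ : Summable fun h => κ h ^ 2) :
    ∃ K K₂ : ℝ, (∀ h, |γ h| ≤ K) ∧ (∀ J : Finset ι, ∑ h ∈ J, γ h ^ 2 ≤ K₂) ∧
      ∀ J : Finset ι, ∑ h ∈ J, δ h ^ 2 ≤ K₂ := by
  have h1 := fun J : Finset ι => hκ.sum_le_tsum J fun _ _ => sq_nonneg _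
  refine ⟨√(∑' h, κ h ^ 2), ∑' h, κ h ^ 2, fun h => (hγ h).trans ?_, fun J => ?_, fun J => ?_⟩
  · exact Real.le_sqrt_of_sq_le (hκ.le_tsum h fun _ _ => sq_nonneg _)
  · exact (Finset.sum_le_sum fun h _ => sq_le_sq.2 ((hγ h).trans (le_abs_self _))).trans (h1 J)
  · exact (Finset.sum_le_sum fun h _ => pow_le_pow_left₀ (hδ0 h) (hδ h) 2).trans (h1 J)

/-- The pointwise error bound for the sums of powers of the sample autocovariances. -/
theorem abs_sum_sampleAutocov_filter_sub_le {r : ℕ} (hr : r = 3 ∨ r = 4)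
    (hX : IsStationaryIn M X C) (a : (Fin d → ℤ) → E) {K K₂ : ℝ}
    (hγK : ∀ h, |inner ℝ (filtered hX a h) (filtered hX a 0)| ≤ K)
    (hγ₂ : ∀ J : Finset (Fin d → ℤ), ∑ h ∈ J, inner ℝ (filtered hX a h) (filtered hX a 0) ^ 2 ≤ K₂)
    (hC₂ : ∀ J : Finset (Fin d → ℤ), ∑ h ∈ J, ‖pairCov hX a h‖ ^ 2 ≤ K₂) (ω : Ω)
    {n : Fin d → ℕ} {L' : ℕ} (hn : ∀ i, 0 < n i ∧ 2 * L' ≤ n i) (J : Finset (Fin d → ℤ))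
    {p : ℝ} (hp1 : 1 ≤ p) (hp3 : p ^ 3 = (box d L').card) {Δ : (Fin d → ℤ) → E} {g : ℝ}
    (hg0 : 0 ≤ g) (hΔ : ∀ l ∈ J, ‖Δ l‖ ≤ g) (hg : J.card * g ≤ 1) {A e : ℝ}
    (hA : 3 * ((1 - ∏ i, (1 - 2 * (L' / n i : ℝ))) ^ 2 * K₂ + 4 * ((((region n).card : ℝ)⁻¹) ^ 2 *
      noiseEnergy (pairField hX a) (pairCov hX a)
        (fun h => (region n).filter (fun s => s + h ∈ region n)) (box d L') J ω) +
      (2 * (J.card * g) + (J.card * g) ^ 2) ^ 2 * K₂) ≤ A)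
    (he0 : 0 ≤ e)
    (he : 6 * (∑ s ∈ region n, p ^ 2 * ((region n).card : ℝ)⁻¹ *
        ‖filtered hX a s ω - ∑ l ∈ J, inner ℝ (a l) (X (s - l) ω)‖ ^ 2) +
      6 * (p ^ 2 * sampleMean n (fun s => filtered hX a s ω) ^ 2) +
      6 * ((J.card * g) ^ 2 * ∑ l ∈ J, p ^ 2 * (J.card : ℝ)⁻¹ *
        ‖((region n).card : ℝ)⁻¹ • ∑ s ∈ region n, X (s + -l) ω‖ ^ 2) ≤ e ^ 2)
    (hs : √A + (2 * e * √(K + 1) + e ^ 2) ≤ 1) :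
    |∑ h ∈ box d L', sampleAutocov n
        (fun s => ∑ l ∈ J, inner ℝ (a l + Δ l) (X (s - l) ω)) h ^ r -
      ∑ h ∈ box d L', inner ℝ (filtered hX a h) (filtered hX a 0) ^ r| ≤
      6 * (K + 1) * ((√A + (2 * e * √(K + 1) + e ^ 2)) * K₂ +
        4 * (√A * A + (2 * e * √(K + 1) + e ^ 2) ^ 3)) := by
  have hRne : (region n).Nonempty := by
    rw [← Finset.card_pos, card_region]
    exact Finset.prod_pos fun i _ => (hn i).1
  have hRpos : (0 : ℝ) < (region n).card := by exact_mod_cast hRne.card_pos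
  -- The full score Y, rather than its truncation, is put into B, so that B is a finite combination
  -- of the coordinates of Z and the truncation enters only through T.
  refine abs_sum_sampleAutocov_pow_sub_le hr hRne (zero_mem_box d _)
    (B := fun s => filtered hX a s ω + ∑ l ∈ J, inner ℝ (Δ l) (X (s - l) ω))
    (T := fun s => filtered hX a s ω - ∑ l ∈ J, inner ℝ (a l) (X (s - l) ω))
    (fun s => ?_) hγK (hγ₂ _) ?_ le_rfl hp1 hp3 he0 ?_ hs
  · simp only [inner_add_left, Finset.sum_add_distrib]
    ring
  · have h1 := sum_lagProduct_sub_sq_le (pairField hX a) (pairCov hX a) ω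
      (norm_unitVec (E := E)).le (fun l => inrVec (Δ l)) J (box d L')
      (fun h => (region n).filter (fun s => s + h ∈ region n)) hRpos
      (fun h _ => by exact_mod_cast Finset.card_le_card (Finset.filter_subset _ _))
      (ζ := 1 - ∏ i, (1 - 2 * (L' / n i : ℝ))) (fun h hh => ?_) hg0
      (fun l hl => (norm_inrVec _).trans_le (hΔ l hl)) hg hC₂
      (B := fun s => filtered hX a s ω + ∑ l ∈ J, inner ℝ (Δ l) (X (s - l) ω))
      (fun s => ?_)
    · simp only [inner_unitVec_pairCov] at h1
      exact h1.trans hA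
    · have h2 := prod_le_card_filter_region (fun i => (hn i).1) (fun i => (hn i).2) hh
      linarith
    · simp [pairField, unitVec, inrVec, WithLp.prod_inner_apply]
  · have h1 := sampleMean_add_sq_le n J (fun s => filtered hX a s ω) (fun s => X s ω) hΔ
    simp only [Real.norm_eq_abs, sq_abs, mul_assoc] at he h1 ⊢
    rw [← Finset.mul_sum, ← Finset.mul_sum, ← Finset.mul_sum, ← Finset.mul_sum] at he
    have h4 := mul_le_mul_of_nonneg_left h1 (sq_nonneg p)
    linarith

/-- Once all six error terms vanish, the deterministic bound is a continuous function of them with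
value 0 at 0; A and e are taken as small as their constraints permit. -/
theorem exists_tendsto_errorBound {α : Type*} {l : Filter α} (K K₂ : ℝ) {ζ N G V Y U : α → ℝ}
    (hζ : Tendsto ζ l (𝓝 0)) (hN : Tendsto N l (𝓝 0)) (hG : Tendsto G l (𝓝 0))
    (hV : Tendsto V l (𝓝 0)) (hY : Tendsto Y l (𝓝 0)) (hU : Tendsto U l (𝓝 0)) :
    ∃ A e : α → ℝ,
      (∀ x, 3 * (ζ x ^ 2 * K₂ + 4 * N x + (2 * G x + G x ^ 2) ^ 2 * K₂) ≤ A x) ∧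
      (∀ x, 0 ≤ e x) ∧ (∀ x, 6 * V x + 6 * Y x + 6 * (G x ^ 2 * U x) ≤ e x ^ 2) ∧
      (∀ᶠ x in l, √(A x) + (2 * e x * √(K + 1) + e x ^ 2) ≤ 1) ∧
      Tendsto (fun x => 6 * (K + 1) * ((√(A x) + (2 * e x * √(K + 1) + e x ^ 2)) * K₂ +
        4 * (√(A x) * A x + (2 * e x * √(K + 1) + e x ^ 2) ^ 3))) l (𝓝 0) := by
  obtain ⟨A, hA⟩ : ∃ A : α → ℝ, A = fun x =>
    3 * (ζ x ^ 2 * K₂ + 4 * N x + (2 * G x + G x ^ 2) ^ 2 * K₂) := ⟨_, rfl⟩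
  obtain ⟨e, he⟩ : ∃ e : α → ℝ, e = fun x => √(6 * V x + 6 * Y x + 6 * (G x ^ 2 * U x)) :=
    ⟨_, rfl⟩
  have hAt : Tendsto A l (𝓝 0) := by
    have := ((((hζ.pow 2).mul_const K₂).add (hN.const_mul 4)).add
      ((((hG.const_mul 2).add (hG.pow 2)).pow 2).mul_const K₂)).const_mul 3
    rw [hA]
    simpa using this
  have het : Tendsto e l (𝓝 0) := by
    have := (((hV.const_mul 6).add (hY.const_mul 6)).add (((hG.pow 2).mul hU).const_mul 6)).sqrt
    rw [he]
    simpa using this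
  have hAs : Tendsto (fun x => √(A x)) l (𝓝 0) := by simpa using hAt.sqrt
  have he' : Tendsto (fun x => 2 * e x * √(K + 1) + e x ^ 2) l (𝓝 0) := by
    simpa using ((het.const_mul 2).mul_const √(K + 1)).add (het.pow 2)
  refine ⟨A, e, fun x => by rw [hA], fun x => ?_, fun x => ?_,
    (hAs.add he').eventually_le_const (by norm_num), ?_⟩
  · rw [he]
    exact Real.sqrt_nonneg _
  -- The radicand has no assumed sign; the squared root is its maximum with 0, which suffices.
  · rw [he, Real.sq_sqrt']
    exact le_max_left _ _
  · simpa using ((((hAs.add he').mul_const K₂).add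
      (((hAs.mul hAt).add (he'.pow 3)).const_mul 4)).const_mul (6 * (K + 1)))

/-- Consistency of the sums of powers of the sample autocovariances of a truncated and perturbed
linear filter of a stationary Gaussian field. -/
theorem tendsto_sum_sampleAutocov_pow [TopologicalSpace.SeparableSpace E] {r : ℕ}
    (hr : r = 3 ∨ r = 4) (hd : 0 < d) (hX : IsStationaryIn M X C)
    (hc : Summable c) (hC : ∀ h, ‖C h‖ ≤ c h) (ha : Summable fun l => ‖a l‖ ^ 2)
    (hM : IsClosed (M : Set (Lp ℝ 2 P))) (hG : ∀ f ∈ M, IsCenteredGaussian f)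
    (hconv : ∀ (S F : Finset (Fin d → ℤ)) (α : (Fin d → ℤ) → ℝ),
      ∑ u ∈ F, ‖∑ s ∈ S, α s • a (s + u)‖ ^ 2 ≤ ∑ s ∈ S, α s ^ 2)
    {τ : (Fin d → ℤ) → ℝ≥0∞} (hτ : ∀ h, HasNuclearBound (C h) (τ h)) (hτs : ∑' h, τ h ≠ ∞)
    (hn : ∀ i, Tendsto (fun k => n k i) atTop atTop) (hL' : Tendsto L' atTop atTop)
    (hL'n : ∀ i, (fun k => (L' k : ℝ)) =o[atTop] (fun k => (n k i : ℝ)))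
    (htail : Tendsto (fun k => (((box d (L' k)).card : ℝ) ^ ((1 : ℝ) / 3)) ^ 2 *
      ∑' l : {l // l ∉ box d (L k)}, ‖a l‖ ^ 2) atTop (𝓝 0))
    {Δ : ℕ × Ω → (Fin d → ℤ) → E} {g : ℕ × Ω → ℝ} (hg0 : ∀ x, 0 ≤ g x)
    (hΔ : ∀ᶠ x in probFilter P, ∀ l ∈ box d (L x.1), ‖Δ x l‖ ≤ g x)
    (hg : Tendsto (fun x : ℕ × Ω => (box d (L x.1)).card * g x) (probFilter P) (𝓝 0)) :
    Tendsto (fun x : ℕ × Ω => ∑ h ∈ box d (L' x.1), sampleAutocov (n x.1)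
      (fun s => ∑ l ∈ box d (L x.1), inner ℝ (a l + Δ x l) (X (s - l) x.2)) h ^ r)
      (probFilter P) (𝓝 (∑' h, inner ℝ (filtered hX a h) (filtered hX a 0) ^ r)) := by
  obtain ⟨κ, hκs, hκn, hκ⟩ := exists_summable_bound_pairCov hX hc hC ha hM hconv hτ hτs
  have hγκ : ∀ h, |inner ℝ (filtered hX a h) (filtered hX a 0)| ≤ κ h := fun h =>
    (abs_inner_filtered_le hX a h).trans (hκ h)
  have hκ0 : ∀ h, 0 ≤ κ h := fun h => (abs_nonneg _).trans (hγκ h)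
  obtain ⟨K, K₂, hγK, hγ₂, hC₂⟩ := exists_bounds_of_summable_sq hγκ
    (fun h => ContinuousLinearMap.opNorm_nonneg (pairCov hX a h)) hκ hκs
  obtain ⟨p, hp⟩ : ∃ p : ℕ → ℝ, p = fun k => ((box d (L' k)).card : ℝ) ^ ((1 : ℝ) / 3) := ⟨_, rfl⟩
  replace htail : Tendsto (fun k => p k ^ 2 *
      ∑' l : {l // l ∉ box d (L k)}, ‖a l‖ ^ 2) atTop (𝓝 0) := by
    rw [hp]
    exact htail
  have hcard1 : ∀ k, (1 : ℝ) ≤ (box d (L' k)).card := fun k => by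
    exact_mod_cast Finset.card_pos.2 ⟨0, zero_mem_box d _⟩
  have hp1 : ∀ k, 1 ≤ p k := fun k => by
    rw [hp]
    exact Real.one_le_rpow (hcard1 k) (by norm_num)
  have hp3 : ∀ k, p k ^ 3 = (box d (L' k)).card := fun k => by
    rw [hp, ← Real.rpow_natCast, ← Real.rpow_mul (by positivity)]
    norm_num
  -- Since |box|^{2/3} ≤ |box| = o(N), sample means with variance O(1/N) survive multiplication by
  -- p².
  have hp2 : ∀ k, p k ^ 2 ≤ (box d (L' k)).card := fun k => by
    rw [← hp3]
    exact pow_le_pow_right₀ (hp1 k) (by norm_num)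
  have hJN := tendsto_card_box_div_card_region hd hn hL'n
  have hpN : Tendsto (fun k => p k ^ 2 * ((region (n k)).card : ℝ)⁻¹) atTop (𝓝 0) := by
    refine squeeze_zero (fun k => by positivity) (fun k => ?_) hJN
    rw [div_eq_mul_inv]
    exact mul_le_mul_of_nonneg_right (hp2 k) (by positivity)
  have hNE := tendsto_noiseEnergy hG (hX.pair hc hC ha hM) hκn hκ0 hκs
    (fun k => box d (L' k)) (fun k => box d (L k)) hJN
  have hV := tendsto_truncation hX hc hC ha n (fun k => sq_nonneg (p k)) htail
  have hY := tendsto_sampleMean_filtered hX hc hC ha hconv (fun k => sq_nonneg (p k)) hpN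
  have hU := tendsto_sampleMean hX hτ hτs (fun k => box d (L k)) (fun k => sq_nonneg (p k)) hpN
  have hζ := (tendsto_one_sub_prod hL'n).comp (tendsto_fst_probFilter (P := P))
  obtain ⟨A, e, hA, he0, he, hs, hΦ⟩ := exists_tendsto_errorBound K K₂ hζ hNE hg hV hY hU
  have hsum : Tendsto (fun x : ℕ × Ω => ∑ h ∈ box d (L' x.1),
      inner ℝ (filtered hX a h) (filtered hX a 0) ^ r) (probFilter P)
      (𝓝 (∑' h, inner ℝ (filtered hX a h) (filtered hX a 0) ^ r)) := by
    have h1 : Summable fun h => inner ℝ (filtered hX a h) (filtered hX a 0) ^ r :=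
      summable_pow_of_summable_sq hγκ hκs (by rcases hr with rfl | rfl <;> norm_num)
    exact h1.hasSum.comp ((tendsto_box d).comp (hL'.comp tendsto_fst_probFilter))
  have hnk : ∀ᶠ k in atTop, ∀ i, 0 < n k i ∧ 2 * L' k ≤ n k i := by
    refine eventually_all.2 fun i => ?_
    filter_upwards [(hn i).eventually_gt_atTop 0,
      (hL'n i).bound (show (0 : ℝ) < 1 / 2 by norm_num)] with k h1 h2
    refine ⟨h1, ?_⟩
    simp only [Real.norm_natCast] at h2
    have : (2 * L' k : ℝ) ≤ n k i := by linarith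
    exact_mod_cast this
  suffices hdiff : Tendsto (fun x : ℕ × Ω => (∑ h ∈ box d (L' x.1), sampleAutocov (n x.1)
      (fun s => ∑ l ∈ box d (L x.1), inner ℝ (a l + Δ x l) (X (s - l) x.2)) h ^ r) -
      ∑ h ∈ box d (L' x.1), inner ℝ (filtered hX a h) (filtered hX a 0) ^ r)
      (probFilter P) (𝓝 0) by
    simpa using hdiff.add hsum
  refine squeeze_zero_norm' ?_ hΦ
  filter_upwards [tendsto_fst_probFilter.eventually hnk, hΔ,
    hg.eventually_le_const (show (0 : ℝ) < 1 by norm_num), hs] with x hx1 hx2 hx3 hx4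
  exact abs_sum_sampleAutocov_filter_sub_le hr hX a hγK hγ₂ hC₂ x.2 hx1 (box d (L x.1))
    (hp1 x.1) (hp3 x.1) (hg0 x) hx2 hx3 (hA x) (he0 x) (he x) hx4

end PowerSums

/-! ### Verification of the assumptions for the estimated scores -/

section Scores

variable {Ω : Type*} [MeasurableSpace Ω] {P : Measure Ω} {d : ℕ}

/-- The tail sum is at most H⁴, and p² is at most a constant times q² with q = (L')^{d/3}. As q ≥ 1
eventually, q² H⁴ ≤ (q H)⁴, which tends to 0. -/
theorem tendsto_card_rpow_mul_tail {φ : (Fin d → ℝ) → L2C}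
    (hφ : Summable fun l => ‖filterCoeff φ l‖ ^ 2) {L L' : ℕ → ℕ} (hL' : Tendsto L' atTop atTop)
    (hL'H : Tendsto (fun k => (L' k : ℝ) ^ ((d : ℝ) / 3) * tailH φ (L k)) atTop (𝓝 0)) :
    Tendsto (fun k => (((box d (L' k)).card : ℝ) ^ ((1 : ℝ) / 3)) ^ 2 *
      ∑' l : {l // l ∉ box d (L k)}, ‖reL (filterCoeff φ l)‖ ^ 2) atTop (𝓝 0) := by
  have h0 := (hL'H.pow 4).const_mul (((3 : ℝ) ^ ((d : ℝ) / 3)) ^ 2)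
  rw [zero_pow (by norm_num), mul_zero] at h0
  refine squeeze_zero' (Eventually.of_forall fun k => ?_) ?_ h0
  · exact mul_nonneg (sq_nonneg _) (tsum_nonneg fun _ => sq_nonneg _)
  filter_upwards [hL'.eventually_ge_atTop 1] with k hk
  have hk' : (1 : ℝ) ≤ L' k := by exact_mod_cast hk
  have hS : Summable fun l : {l // l ∉ box d (L k)} => ‖filterCoeff φ l‖ ^ 2 := hφ.subtype _
  have h1 : ∑' l : {l // l ∉ box d (L k)}, ‖reL (filterCoeff φ l)‖ ^ 2 ≤ tailH φ (L k) ^ 4 := by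
    have e : tailH φ (L k) ^ 4 = ∑' l : {l // l ∉ box d (L k)}, ‖filterCoeff φ l‖ ^ 2 := by
      rw [tailH, ← Real.rpow_natCast, ← Real.rpow_mul (tsum_nonneg fun _ => sq_nonneg _)]
      norm_num
    rw [e]
    have hle : ∀ l : {l // l ∉ box d (L k)},
        ‖reL (filterCoeff φ l)‖ ^ 2 ≤ ‖filterCoeff φ l‖ ^ 2 := fun l =>
      pow_le_pow_left₀ (norm_nonneg _) (norm_reL_le _) 2
    exact (hS.of_nonneg_of_le (fun _ => sq_nonneg _) hle).tsum_le_tsum hle hS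
  have h2 : ((box d (L' k)).card : ℝ) ^ ((1 : ℝ) / 3) ≤
      (3 : ℝ) ^ ((d : ℝ) / 3) * (L' k : ℝ) ^ ((d : ℝ) / 3) := by
    rw [← Real.mul_rpow (by norm_num) (by positivity), card_box, Nat.cast_pow,
      ← Real.rpow_natCast, ← Real.rpow_mul (by positivity), mul_one_div]
    refine Real.rpow_le_rpow (by positivity) ?_ (by positivity)
    push_cast
    linarith
  have h3 : 1 ≤ (L' k : ℝ) ^ ((d : ℝ) / 3) := Real.one_le_rpow hk' (by positivity)
  have hH : 0 ≤ tailH φ (L k) := Real.rpow_nonneg (tsum_nonneg fun _ => sq_nonneg _) _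
  set q := (L' k : ℝ) ^ ((d : ℝ) / 3)
  calc _ ≤ ((3 : ℝ) ^ ((d : ℝ) / 3) * q) ^ 2 * tailH φ (L k) ^ 4 :=
        mul_le_mul (pow_le_pow_left₀ (by positivity) h2 2) h1
          (tsum_nonneg fun _ => sq_nonneg _) (by positivity)
    _ = ((3 : ℝ) ^ ((d : ℝ) / 3)) ^ 2 * (q ^ 2 * tailH φ (L k) ^ 4) := by ring
    _ ≤ ((3 : ℝ) ^ ((d : ℝ) / 3)) ^ 2 * (q * tailH φ (L k)) ^ 4 := by
        refine mul_le_mul_of_nonneg_left ?_ (by positivity)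
        rw [mul_pow]
        exact mul_le_mul_of_nonneg_right (pow_le_pow_right₀ h3 (by norm_num)) (by positivity)

theorem card_box_le {K : ℕ} (hK : 1 ≤ K) : (box d K).card ≤ 3 ^ d * K ^ d := by
  rw [card_box, ← mul_pow]
  exact Nat.pow_le_pow_left (by omega) d

/-- The error of the estimated filter coefficients is controlled by that of the spectral density
operator. -/
theorem enorm_filterCoeff_sub_le_specError {X : (Fin d → ℤ) → Ω → L2R} {p m : ℕ} (hm : m < p)
    {lam lamhat : (Fin d → ℝ) → ℕ → ℝ} {φ φhat : ℕ → (Fin d → ℝ) → L2C}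
    {Fhat : (Fin d → ℝ) → L2C →L[ℂ] L2C}
    (heig : ∀ θ ∈ cube d, IsLeadingEigensystem (spectralDensity P X θ) (p + 1) (lam θ)
      (fun j => φ j θ))
    (hφ : AEStronglyMeasurable (φ m) (cubeMeasure d)) {β : ℝ} (hβ : 0 < β)
    (hgap : ∀ θ ∈ cube d, β ≤ lam θ m - lam θ (m + 1) ∧ (1 ≤ m → β ≤ lam θ (m - 1) - lam θ m))
    (heighat : ∀ᵐ θ ∂cubeMeasure d, IsLeadingEigensystem (Fhat θ) p (lamhat θ)
      (fun j => φhat j θ))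
    (hφhat : AEStronglyMeasurable (φhat m) (cubeMeasure d))
    (hphase : ∀ᵐ θ ∂cubeMeasure d,
      0 ≤ (inner ℂ (φ m θ) (φhat m θ)).re ∧ (inner ℂ (φ m θ) (φhat m θ)).im = 0)
    (l : Fin d → ℤ) :
    ‖filterCoeff (φhat m) l - filterCoeff (φ m) l‖ₑ ≤
      ENNReal.ofReal (4 / β) * specError P X Fhat := by
  have hcube : ∀ᵐ θ ∂cubeMeasure d, θ ∈ cube d := ae_restrict_mem measurableSet_Icc
  have h1 : Integrable (φ m) (cubeMeasure d) := by
    refine Integrable.of_bound hφ 1 ?_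
    filter_upwards [hcube] with θ hθ
    exact ((heig θ hθ).orthonormal.1 ⟨m, by omega⟩).le
  have h2 : Integrable (φhat m) (cubeMeasure d) := by
    refine Integrable.of_bound hφhat 1 ?_
    filter_upwards [heighat] with θ hθ
    exact (hθ.orthonormal.1 ⟨m, hm⟩).le
  refine (enorm_filterCoeff_sub_le h2 h1 l).trans ?_
  rw [specError, ← lintegral_const_mul' _ _ ENNReal.ofReal_ne_top]
  refine lintegral_mono_ae ?_
  filter_upwards [hcube, heighat, hphase] with θ h3 h4 h5
  rw [← ofReal_norm, ← ofReal_norm, ← ENNReal.ofReal_mul (by positivity)]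
  exact ENNReal.ofReal_le_ofReal (norm_eigenvector_sub_le (heig θ h3) h4 hm hβ (hgap θ h3).1
    (hgap θ h3).2 h5.1 h5.2)

/-- G takes values in [0, ∞]. It is finite with probability tending to one, because L ≥ 1 eventually
and L^d G < 1 with probability tending to one; only then does passing to real numbers make sense. -/
theorem tendsto_card_box_mul_specError {X : (Fin d → ℤ) → Ω → L2R}
    {Fhat : ℕ → Ω → (Fin d → ℝ) → L2C →L[ℂ] L2C} {L : ℕ → ℕ} (hL : Tendsto L atTop atTop)
    (hLG : ∀ ε : ℝ≥0∞, 0 < ε → Tendsto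
      (fun k => P {ω | ε ≤ (L k : ℝ≥0∞) ^ d * specError P X (Fhat k ω)}) atTop (𝓝 0)) (b : ℝ) :
    (∀ᶠ x in probFilter P, specError P X (Fhat x.1 x.2) ≠ ∞) ∧
    Tendsto (fun x : ℕ × Ω => ((box d (L x.1)).card : ℝ) *
      (ENNReal.ofReal b * specError P X (Fhat x.1 x.2)).toReal) (probFilter P) (𝓝 0) := by
  have h1 := tendsto_probFilter_of_measure_le hLG
  have h2 := (tendsto_fst_probFilter (P := P)).eventually (hL.eventually_ge_atTop 1)
  have h3 := h1.eventually (gt_mem_nhds (show (0 : ℝ≥0∞) < 1 by simp))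
  have hfin : ∀ᶠ x in probFilter P, specError P X (Fhat x.1 x.2) ≠ ∞ := by
    filter_upwards [h2, h3] with x hx1 hx2 hc
    rw [hc, ENNReal.mul_top (pow_ne_zero _ (by exact_mod_cast (show L x.1 ≠ 0 by omega)))] at hx2
    simp at hx2
  refine ⟨hfin, ?_⟩
  have h4 := ENNReal.Tendsto.const_mul (a := (3 : ℝ≥0∞) ^ d * ENNReal.ofReal b) h1
    (Or.inr (ENNReal.mul_ne_top (by simp) ENNReal.ofReal_ne_top))
  rw [mul_zero] at h4
  have h5 := (ENNReal.tendsto_toReal ENNReal.zero_ne_top).comp h4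
  rw [ENNReal.toReal_zero] at h5
  refine squeeze_zero' (Eventually.of_forall fun x => by positivity) ?_ h5
  filter_upwards [h2, hfin] with x hx1 hx2
  rw [← ENNReal.toReal_natCast, ← ENNReal.toReal_mul]
  refine ENNReal.toReal_mono ?_ ?_
  · exact ENNReal.mul_ne_top (ENNReal.mul_ne_top (by simp) ENNReal.ofReal_ne_top)
      (ENNReal.mul_ne_top (by simp) hx2)
  · calc _ ≤ ((3 ^ d * L x.1 ^ d : ℕ) : ℝ≥0∞) *
          (ENNReal.ofReal b * specError P X (Fhat x.1 x.2)) := by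
          gcongr
          exact card_box_le hx1
      _ = _ := by
          push_cast
          ring

variable [IsProbabilityMeasure P] {X : (Fin d → ℤ) → Ω → L2R}

theorem score_eq_filtered (hX : ∀ s, MemLp (X s) 2 P) {C : (Fin d → ℤ) → L2R →L[ℝ] L2R}
    {M : Submodule ℝ (Lp ℝ 2 P)} (hS : IsStationaryIn M X C) (φ : (Fin d → ℝ) → L2C)
    (s : Fin d → ℤ) : score hX φ s = filtered hS (fun l => reL (filterCoeff φ l)) s :=
  tsum_congr fun l => scoreTerm_eq_proj hX φ s l

/-- The estimated coefficient is written as true coefficient plus error, the form expected by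
`tendsto_sum_sampleAutocov_pow`. -/
theorem estScore_eq (φ φhat : (Fin d → ℝ) → L2C) (L : ℕ) (ω : Ω) :
    estScore X φhat L ω = fun s => ∑ l ∈ box d L, inner ℝ (reL (filterCoeff φ l) +
      reL (filterCoeff φhat l - filterCoeff φ l)) (X (s - l) ω) := by
  funext s
  refine Finset.sum_congr rfl fun l _ => ?_
  rw [← map_add, add_sub_cancel, pairing_eq_inner]

end Scores

end SFPC

/-! ### Assembly of the proof. -/

theorem proposition1
    {Ω : Type*} [MeasurableSpace Ω] (P : Measure Ω) [IsProbabilityMeasure P]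
    (d : ℕ) (hd : 0 < d)
    -- the functional random field: square integrable, Gaussian, weakly stationary with mean zero
    -- and summable trace norms of the autocovariance operators
    (X : (Fin d → ℤ) → Ω → SFPC.L2R)
    (hX : ∀ s, MemLp (X s) 2 P)
    (hgauss : SFPC.IsGaussianField P X)
    (hstat : SFPC.IsWeaklyStationary P X)
    (hmean : ∫ ω, X 0 ω ∂P = 0)
    (hsum : ∑' h, SFPC.traceNorm (SFPC.autocovOp P X h) < ∞)
    -- the leading eigenvalues and eigenvectors of the spectral density operator, the latter
    -- measurable and such that the filter functions are real-valued
    (p : ℕ) (lam : (Fin d → ℝ) → ℕ → ℝ) (φ : ℕ → (Fin d → ℝ) → SFPC.L2C)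
    (heig : ∀ θ ∈ SFPC.cube d, SFPC.IsLeadingEigensystem (SFPC.spectralDensity P X θ) (p + 1)
      (lam θ) (fun j => φ j θ))
    (hφmeas : ∀ j < p, AEStronglyMeasurable (φ j) (SFPC.cubeMeasure d))
    (hφconj : ∀ j < p, ∀ᵐ θ ∂SFPC.cubeMeasure d, φ j (-θ) = star (φ j θ))
    -- the first `p` spectral gaps are bounded from below
    (hgap : ∀ j < p, ∃ β > 0, ∀ θ ∈ SFPC.cube d,
      β ≤ lam θ j - lam θ (j + 1) ∧ (1 ≤ j → β ≤ lam θ (j - 1) - lam θ j))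
    -- the expanding sampling regions
    (n : ℕ → Fin d → ℕ)
    (hn : ∀ i, Tendsto (fun k => n k i) atTop atTop)
    -- the estimator of the spectral density operator and its consistency
    (Fhat : ℕ → Ω → (Fin d → ℝ) → SFPC.L2C →L[ℂ] SFPC.L2C)
    (hFhat : Tendsto (fun k => ∫⁻ θ in SFPC.cube d, ∫⁻ ω,
      ‖Fhat k ω θ - SFPC.spectralDensity P X θ‖ₑ ∂P) atTop (𝓝 0))
    -- its leading eigenvalues and eigenvectors, the latter measurable, such that the estimated
    -- filters are real-valued, and with the phase chosen so that `⟨φ, φhat⟩ ≥ 0`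
    (lamhat : ℕ → Ω → (Fin d → ℝ) → ℕ → ℝ)
    (φhat : ℕ → ℕ → Ω → (Fin d → ℝ) → SFPC.L2C)
    (heighat : ∀ k, ∀ᵐ ω ∂P, ∀ᵐ θ ∂SFPC.cubeMeasure d,
      SFPC.IsLeadingEigensystem (Fhat k ω θ) p (lamhat k ω θ) (fun j => φhat k j ω θ))
    (hφhatmeas : ∀ k, ∀ j < p, AEStronglyMeasurable
      (fun x : Ω × (Fin d → ℝ) => φhat k j x.1 x.2) (P.prod (SFPC.cubeMeasure d)))
    (hφhatconj : ∀ k, ∀ j < p, ∀ᵐ ω ∂P, ∀ᵐ θ ∂SFPC.cubeMeasure d,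
      φhat k j ω (-θ) = star (φhat k j ω θ))
    (hphase : ∀ k, ∀ j < p, ∀ᵐ ω ∂P, ∀ᵐ θ ∂SFPC.cubeMeasure d,
      0 ≤ (inner ℂ (φ j θ) (φhat k j ω θ)).re ∧ (inner ℂ (φ j θ) (φhat k j ω θ)).im = 0)
    -- the truncation parameters, and the level `m` (counted from `0`)
    (m : ℕ) (hm : m < p)
    (L L' : ℕ → ℕ)
    (hL : Tendsto L atTop atTop) (hL' : Tendsto L' atTop atTop)
    (hLG : ∀ ε : ℝ≥0∞, 0 < ε → Tendsto
      (fun k => P {ω | ε ≤ (L k : ℝ≥0∞) ^ d * SFPC.specError P X (Fhat k ω)}) atTop (𝓝 0))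
    (hL'n : ∀ i, (fun k => (L' k : ℝ)) =o[atTop] (fun k => (n k i : ℝ)))
    (hL'H : Tendsto (fun k => (L' k : ℝ) ^ ((d : ℝ) / 3) * SFPC.tailH (φ m) (L k)) atTop (𝓝 0)) :
    -- the series that define the scores and the asymptotic variances converge
    (∀ s, Summable (fun l => SFPC.scoreTerm hX (φ m) s l)) ∧
    Summable (fun h => SFPC.scoreAutocov hX (φ m) h ^ 3) ∧
    Summable (fun h => SFPC.scoreAutocov hX (φ m) h ^ 4) ∧
    -- consistency of the two estimators
    TendstoInMeasure P
      (fun k ω => SFPC.varEstimator X (φhat k m ω) (n k) (L k) (L' k) 3 ω) atTop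
      (fun _ => ∑' h, SFPC.scoreAutocov hX (φ m) h ^ 3) ∧
    TendstoInMeasure P
      (fun k ω => SFPC.varEstimator X (φhat k m ω) (n k) (L k) (L' k) 4 ω) atTop
      (fun _ => ∑' h, SFPC.scoreAutocov hX (φ m) h ^ 4) := by
  have hmean' : ∀ s, ∫ ω, X s ω ∂P = 0 := fun s => (hstat.mean_eq s).trans hmean
  have hS := SFPC.isStationaryIn_gaussSpace hX hstat hmean'
  have hG := SFPC.isCenteredGaussian_of_mem_gaussSpace hX hgauss hmean'
  have hM : IsClosed (SFPC.gaussSpace hX : Set (Lp ℝ 2 P)) :=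
    Submodule.isClosed_topologicalClosure _
  obtain ⟨τ, hτ, hτs⟩ := SFPC.exists_nuclearBound_realCov hX hmean' hsum
  have hc : Summable fun h => (τ h).toReal := ENNReal.summable_toReal hτs
  have hC : ∀ h, ‖SFPC.realCov P X h‖ ≤ (τ h).toReal := fun h => by
    have h1 := ENNReal.toReal_mono (ne_top_of_le_ne_top hτs (ENNReal.le_tsum h)) (hτ h).enorm_le
    rwa [toReal_enorm] at h1
  have hφ1 : ∀ᵐ θ ∂SFPC.cubeMeasure d, ‖φ m θ‖ ≤ 1 := by
    filter_upwards [ae_restrict_mem (measurableSet_Icc (a := fun _ => -Real.pi)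
      (b := fun _ => Real.pi))] with θ hθ
    exact ((heig θ hθ).orthonormal.1 ⟨m, by omega⟩).le
  have hcoef := SFPC.summable_norm_filterCoeff_sq (hφmeas m hm) hφ1
  have ha : Summable fun l => ‖SFPC.reL (SFPC.filterCoeff (φ m) l)‖ ^ 2 :=
    hcoef.of_nonneg_of_le (fun _ => sq_nonneg _) fun l =>
      pow_le_pow_left₀ (norm_nonneg _) (SFPC.norm_reL_le _) 2
  have hconv := SFPC.sum_norm_conv_reL_sq_le (hφmeas m hm) hφ1
  have hγ : ∀ h, SFPC.scoreAutocov hX (φ m) h =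
      inner ℝ (SFPC.filtered hS (fun l => SFPC.reL (SFPC.filterCoeff (φ m) l)) h)
        (SFPC.filtered hS (fun l => SFPC.reL (SFPC.filterCoeff (φ m) l)) 0) := fun h => by
    rw [SFPC.scoreAutocov, SFPC.score_eq_filtered hX hS, SFPC.score_eq_filtered hX hS]
    exact SFPC.covariance_eq_inner (hG _ (hS.filtered_mem hc hC ha hM h))
  have hsummable : ∀ r, 2 ≤ r → Summable fun h => SFPC.scoreAutocov hX (φ m) h ^ r := by
    intro r hr
    obtain ⟨κ, hκs, -, hκ⟩ :=
      SFPC.exists_summable_bound_pairCov hS hc hC ha hM hconv hτ hτs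
    simp_rw [hγ]
    exact SFPC.summable_pow_of_summable_sq
      (fun h => (SFPC.abs_inner_filtered_le hS _ h).trans (hκ h)) hκs hr
  obtain ⟨β, hβ, hβgap⟩ := hgap m hm
  obtain ⟨hfin, hg⟩ := SFPC.tendsto_card_box_mul_specError hL hLG (4 / β)
  have hΔ : ∀ᶠ x in SFPC.probFilter P, ∀ l ∈ SFPC.box d (L x.1),
      ‖SFPC.reL (SFPC.filterCoeff (φhat x.1 m x.2) l - SFPC.filterCoeff (φ m) l)‖ ≤
        (ENNReal.ofReal (4 / β) * SFPC.specError P X (Fhat x.1 x.2)).toReal := by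
    have h1 : ∀ᶠ x in SFPC.probFilter P, ∀ l,
        ‖SFPC.filterCoeff (φhat x.1 m x.2) l - SFPC.filterCoeff (φ m) l‖ₑ ≤
          ENNReal.ofReal (4 / β) * SFPC.specError P X (Fhat x.1 x.2) := by
      refine SFPC.eventually_probFilter_of_ae fun k => ?_
      -- Joint measurability gives measurability in θ of the realized eigenvector for almost every
      -- outcome, which its coefficient integrals require.
      filter_upwards [heighat k, hphase k m hm, (hφhatmeas k m hm).prodMk_left] with ω h1 h2 h3 l
      exact SFPC.enorm_filterCoeff_sub_le_specError (φhat := fun j => φhat k j ω) hm heig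
        (hφmeas m hm) hβ hβgap h1 h3 h2 l
    filter_upwards [h1, hfin] with x hx1 hx2 l _
    refine (SFPC.norm_reL_le _).trans ?_
    rw [← toReal_enorm]
    exact ENNReal.toReal_mono (ENNReal.mul_ne_top ENNReal.ofReal_ne_top hx2) (hx1 l)
  have hlim : ∀ r, r = 3 ∨ r = 4 → TendstoInMeasure P
      (fun k ω => SFPC.varEstimator X (φhat k m ω) (n k) (L k) (L' k) r ω) atTop
      (fun _ => ∑' h, SFPC.scoreAutocov hX (φ m) h ^ r) := by
    intro r hr
    refine SFPC.tendstoInMeasure_of_tendsto_probFilter ?_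
    simp_rw [hγ, SFPC.varEstimator, SFPC.estScore_eq (φ m)]
    exact SFPC.tendsto_sum_sampleAutocov_pow hr hd hS hc hC ha hM hG hconv hτ hτs hn hL' hL'n
      (SFPC.tendsto_card_rpow_mul_tail hcoef hL' hL'H)
      (Δ := fun x l => SFPC.reL (SFPC.filterCoeff (φhat x.1 m x.2) l - SFPC.filterCoeff (φ m) l))
      (fun _ => ENNReal.toReal_nonneg) hΔ hg
  refine ⟨fun s => ?_, hsummable 3 (by norm_num), hsummable 4 (by norm_num), hlim 3 (Or.inl rfl),
    hlim 4 (Or.inr rfl)⟩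
  simp_rw [SFPC.scoreTerm_eq_proj]
  exact (hS.hasSum_filtered hc hC ha s).summable
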